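/- Let $a<b$, $T>0$, $\lambda_1,\lambda_2\in\mathbb R$, $\alpha\in(0,1)$, and let $m\ge 3$ be an integer. For $\varepsilon\in(0,1]$ consider the oscillatory nonlinear Dirac equation for $\widetilde\Phi=\widetilde\Phi(s,x)\in\mathbb C^2$, $$ i\partial_s\widetilde\Phi=\frac1{\varepsilon^2}\left(-i\sigma_1\partial_x+\sigma_3\right)\widetilde\Phi+\mathbf F(\widetilde\Phi)\widetilde\Phi,\qquad \mathbf F(\Phi)=\lambda_1(\Phi^*\sigma_3\Phi)\sigma_3+\lambda_2|\Phi|^2I_2,$$ on $[0,T]\times[a,b]$ with periodic boundary conditions, where $\sigma_1=\begin{pmatrix}0&1\\1&0\end{pmatrix}$, $\sigma_3=\begin{pmatrix}1&0\\0&-1\end{pmatrix}$. With $\mu_l=2\pi l/(b-a)$ and Fourier coefficients $\widehat u_l=\frac1{b-a}\int_a^bu(x)e^{-i\mu_l(x-a)}dx$, let $\|u\|_{H^k}^2=\sum_{l\in\mathbb Z}(1+\mu_l^2)^k|\widehat u_l|^2$. For an even $M\ge2$ put $h=(b-a)/M$, $x_j=a+jh$, $\mathcal T_M=\{-M/2,\dots,M/2-1\}$,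 $\Gamma_l=\mu_l\sigma_1+\sigma_3$, and for a grid function $U=(U_0,\dots,U_M)$ put $\widetilde U_l=\frac1M\sum_{j=0}^{M-1}U_je^{-2\pi ijl/M}$ and $(I_MU)(x)=\sum_{l\in\mathcal T_M}\widetilde U_le^{i\mu_l(x-a)}$. The time-splitting Fourier pseudospectral (TSFP) method with time step $\kappa>0$ is $\widetilde\Phi^0_j=\widetilde\Phi(0,x_j)$ and $$\Phi^{(1)}_j=\sum_{l\in\mathcal T_M}e^{-\frac{i\kappa}{2\varepsilon^2}\Gamma_l}\widetilde{(\widetilde\Phi^n)}_le^{i\mu_l(x_j-a)},\quad \Phi^{(2)}_j=e^{-i\kappa\mathbf F(\Phi^{(1)}_j)}\Phi^{(1)}_j,\quad \widetilde\Phi^{n+1}_j=\sum_{l\in\mathcal T_M}e^{-\frac{i\kappa}{2\varepsilon^2}\Gamma_l}\widetilde{(\Phi^{(2)})}_le^{i\mu_l(x_j-a)}.$$ Let $s_n=n\kappa$. (i) For every $R$ there are $h_0>0$, $\bar\kappa\in(0,1)$ and $C>0$, depending only on $a,b,T,\lambda_1,\lambda_2,\alpha,m,R$, such that for all $\kappa_0\in(0,\bar\kappa]$,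 all $\varepsilon\in(0,1]$, every solution with $\|\widetilde\Phi\|_{L^\infty([0,T];(H^m)^2)}\le R$, all even $M\geq 2$ with $h\le h_0$, all $0<\kappa\le\varepsilon^2\alpha\kappa_0$ and all integers $0\le n\le T/\kappa$, $$\|\widetilde\Phi(s_n,\cdot)-I_M\widetilde\Phi^n\|_{H^1}\le C\left(h^{m-1}+\frac{\kappa^2}{\varepsilon^2}+\kappa_0^{m-1}\right).$$ (ii) For smooth solutions the last term can be replaced by an arbitrarily high power of $\kappa_0$, and dropped once that power is below $\kappa^2/\varepsilon^2$: for every sequence $(R_k)_{k\ge0}$ and every $N\in\mathbb N$ there are $h_0>0$, $\bar\kappa\in(0,1)$ and $C>0$, depending only on $a,b,T,\lambda_1,\lambda_2,\alpha,m,(R_k),N$, such that for all $\kappa_0,\varepsilon,M,\kappa,n$ as in (i) and every solution with $\|\widetilde\Phi\|_{L^\infty([0,T];(H^k)^2)}\le R_k$ for all $k$, $$\|\widetilde\Phi(s_n,\cdot)-I_M\widetilde\Phi^n\|_{H^1}\le C\left(h^{m-1}+\frac{\kappa^2}{\varepsilon^2}+\kappa_0^{N}\right),$$ and $\|\widetilde\Phi(s_n,\cdot)-I_M\widetilde\Phi^n\|_{H^1}\le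 C\left(h^{m-1}+\frac{\kappa^2}{\varepsilon^2}\right)$ whenever $\kappa_0^N\le\kappa^2/\varepsilon^2$. -/

import Mathlib

namespace OscNLDE

open MeasureTheory

/-- Two-component spinors, `ℂ²`. The Euclidean length is used through `absSq`. -/
abbrev Spinor : Type := Fin 2 → ℂ

/-- The squared Euclidean length `|v|² = |v₁|² + |v₂|²`. -/
noncomputable def absSq (v : Spinor) : ℝ := ∑ i, ‖v i‖ ^ 2

/-- The Pauli matrix `σ₁`. -/
def sigma1 : Matrix (Fin 2) (Fin 2) ℂ := !![0, 1; 1, 0]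

/-- The Pauli matrix `σ₃`. -/
def sigma3 : Matrix (Fin 2) (Fin 2) ℂ := !![1, 0; 0, -1]

/-- The matrix nonlinearity `F(v) = lam1 (v* σ₃ v) σ₃ + lam2 |v|² I₂`. -/
noncomputable def nonlinF (lam1 lam2 : ℝ) (v : Spinor) : Matrix (Fin 2) (Fin 2) ℂ :=
  ((lam1 : ℂ) * (star v ⬝ᵥ Matrix.mulVec sigma3 v)) • sigma3
    + ((lam2 : ℂ) * (star v ⬝ᵥ v)) • (1 : Matrix (Fin 2) (Fin 2) ℂ)

/-- The frequencies `μ_l = 2πl/(b-a)`. -/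
noncomputable def mu (a b : ℝ) (l : ℤ) : ℝ := 2 * Real.pi * l / (b - a)

/-- The basis function `e^{iμ_l(x-a)}`. -/
noncomputable def mode (a b : ℝ) (l : ℤ) (x : ℝ) : ℂ :=
  Complex.exp (Complex.I * mu a b l * (x - a))

/-- The Fourier coefficient `(1/(b-a)) ∫_a^b u(x) e^{-iμ_l(x-a)} dx`. -/
noncomputable def fourierCoeffOn (a b : ℝ) (u : ℝ → Spinor) (l : ℤ) : Spinor :=
  (b - a)⁻¹ • ∫ x in a..b, Complex.exp (-(Complex.I * mu a b l * (x - a))) • u x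

/-- The periodic Sobolev norm, `‖u‖_{H^m}² = ∑_l (1+μ_l²)^m |û_l|²`, with the value `∞` when
the series diverges. -/
noncomputable def sobolevNorm (a b : ℝ) (m : ℕ) (u : ℝ → Spinor) : ENNReal :=
  (∑' l : ℤ, ENNReal.ofReal ((1 + mu a b l ^ 2) ^ m * absSq (fourierCoeffOn a b u l)))
    ^ (1 / 2 : ℝ)

/-- `Φ s x` is a (classical) solution on `[0,T] × [a,b]` of
`i ∂_s Φ = ε⁻² (-i σ₁ ∂_x + σ₃) Φ + F(Φ) Φ` with periodic boundary condition; the initial value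
is `Φ 0`. -/
structure IsSolution (a b T ε lam1 lam2 : ℝ) (Φ : ℝ → ℝ → Spinor) : Prop where
  cont : ContinuousOn (fun p : ℝ × ℝ => Φ p.1 p.2) (Set.Icc 0 T ×ˢ Set.Icc a b)
  periodic : ∀ s ∈ Set.Icc 0 T, Φ s a = Φ s b
  diff_time : ∀ s ∈ Set.Ioo 0 T, ∀ x ∈ Set.Ioo a b, DifferentiableAt ℝ (fun r => Φ r x) s
  diff_space : ∀ s ∈ Set.Ioo 0 T, ∀ x ∈ Set.Ioo a b, DifferentiableAt ℝ (Φ s) x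
  equation : ∀ s ∈ Set.Ioo 0 T, ∀ x ∈ Set.Ioo a b,
    Complex.I • deriv (fun r => Φ r x) s
      = (1 / (ε : ℂ) ^ 2) •
          ((-Complex.I) • Matrix.mulVec sigma1 (deriv (Φ s) x) + Matrix.mulVec sigma3 (Φ s x))
        + Matrix.mulVec (nonlinF lam1 lam2 (Φ s x)) (Φ s x)

/-- `‖Φ‖_{L^∞([0,T]; H^m)} ≤ R`. -/
def LinftyHBound (a b T : ℝ) (m : ℕ) (R : ℝ) (Φ : ℝ → ℝ → Spinor) : Prop :=
  ∀ᵐ s ∂(volume.restrict (Set.Icc 0 T)), sobolevNorm a b m (Φ s) ≤ ENNReal.ofReal R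

/-- Grid functions `(U_0, …, U_M)` on the points `x_j = a + j(b-a)/M`. -/
abbrev GridFun (M : ℕ) : Type := Fin (M + 1) → Spinor

/-- The grid point `x_j = a + j h`, `h = (b-a)/M`. -/
noncomputable def gridPt (a b : ℝ) (M : ℕ) (j : Fin (M + 1)) : ℝ :=
  a + ((j : ℕ) : ℝ) * ((b - a) / M)

/-- The index set `{-M/2, …, M/2-1}` (for even `M`). -/
noncomputable def freqs (M : ℕ) : Finset ℤ := Finset.Ico (-((M : ℤ) / 2)) ((M : ℤ) / 2)

/-- The discrete Fourier coefficient `(1/M) ∑_{j=0}^{M-1} U_j e^{-2ijlπ/M}`. -/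
noncomputable def dft (M : ℕ) (U : GridFun M) (l : ℤ) : Spinor :=
  (M : ℂ)⁻¹ • ∑ j : Fin M,
    Complex.exp (-(2 * Complex.I * ((j : ℕ) : ℂ) * l * Real.pi / M)) • U j.castSucc

/-- The trigonometric interpolant `(I_M U)(x) = ∑_l Ũ_l e^{iμ_l(x-a)}`. -/
noncomputable def interp (a b : ℝ) (M : ℕ) (U : GridFun M) (x : ℝ) : Spinor :=
  ∑ l ∈ freqs M, mode a b l x • dft M U l

/-- The symbol `Γ_l = μ_l σ₁ + σ₃` of the free Dirac operator. -/
noncomputable def Gam (a b : ℝ) (l : ℤ) : Matrix (Fin 2) (Fin 2) ℂ :=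
  (mu a b l : ℂ) • sigma1 + sigma3

/-- The pseudospectral linear half step,
`U ↦ (∑_l e^{-iκΓ_l/(2ε²)} Ũ_l e^{iμ_l(x_j-a)})_j`. -/
noncomputable def linHalfStep (a b ε κ : ℝ) (M : ℕ) (U : GridFun M) : GridFun M := fun j =>
  ∑ l ∈ freqs M, mode a b l (gridPt a b M j) •
    Matrix.mulVec
      (NormedSpace.exp ((-(Complex.I * κ / (2 * (ε : ℂ) ^ 2))) • Gam a b l)) (dft M U l)

/-- The pointwise nonlinear step `U_j ↦ e^{-iκF(U_j)} U_j`. -/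
noncomputable def nonlinStep (lam1 lam2 κ : ℝ) (M : ℕ) (U : GridFun M) : GridFun M := fun j =>
  Matrix.mulVec (NormedSpace.exp ((-(Complex.I * κ)) • nonlinF lam1 lam2 (U j))) (U j)

/-- The time-splitting Fourier pseudospectral (TSFP) method: Strang splitting with time step `κ`
on `M` grid cells, started from the grid values of `u₀`. -/
noncomputable def tsfp (a b ε lam1 lam2 κ : ℝ) (M : ℕ) (u₀ : ℝ → Spinor) : ℕ → GridFun M
  | 0 => fun j => u₀ (gridPt a b M j)
  | n + 1 => linHalfStep a b ε κ M
      (nonlinStep lam1 lam2 κ M (linHalfStep a b ε κ M (tsfp a b ε lam1 lam2 κ M u₀ n)))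

/-- The error `‖Φ(s_n) - I_M Φⁿ‖_{H^1}` at `s_n = nκ`. -/
noncomputable def errH1 (a b ε lam1 lam2 κ : ℝ) (M : ℕ) (Φ : ℝ → ℝ → Spinor) (n : ℕ) : ENNReal :=
  sobolevNorm a b 1
    (fun x => Φ (n * κ) x - interp a b M (tsfp a b ε lam1 lam2 κ M (Φ 0) n) x)

end OscNLDE

/-! Write τ = κ/ε² and work with sequences of Fourier coefficients. Since Γ_l² = ω_l² with ω_l =
(1+μ_l²)^{1/2}, the free propagator splits into two branches with phases ±ω_l. In the interaction
variable χ(s) = e^{isΓ/ε²}Φ̂(s) the linear part disappears: χ' is -i times a cubic convolution in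
which each interaction of frequencies p, q, r = l-p+q carries the factor e^{isδ/ε²}, δ = ±ω_l ∓ ω_p
± ω_q ∓ ω_r with independent signs (`hasDerivAt_interaction`). Hence χ moves by O(κ) per step,
uniformly in ε.

In the same variable, one step of the splitting, before aliasing, solves the equation with the
oscillation frozen at the midpoint time (n+1/2)τ. Up to O(κ²τ), its local error is therefore the
cubic term whose kernel is the midpoint quadrature error of e^{isδ/ε²}
(`exists_nrm_local_error_le`). Over T/κ steps the O(κ²τ) remainders add up to κτ = κ²/ε².

The quadrature errors, bounded one by one, would only give τ² = κ²/ε⁴; the gain is cancellation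
between steps. The n-th kernel is e^{inτδ} times the zeroth, which has size κ(τδ)², so for τ|δ| ≤
1/2 the geometric sum is of order κτ|δ| whatever the number of steps. For τ|δ| > 1/2 resonances τδ ∈
2πℤ are possible and no cancellation is used; but such a δ forces a frequency of order at least 1/τ,
so the trivial bound can be paid for with j = m-1 derivatives and a factor τ^j ≤ κ₀^{m-1}.
`kernelBound_sumKernel` contains both regimes, and summation by parts carries them over to the
slowly varying χ (`exists_nrm_sum_cubic_stepKernel_le`).

In space the only error is aliasing, of order h^{m-1} from H^m to H¹ (`nrm_foldFreq_sub_le`). After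
the initial interpolation it acts only on the nonlinear increment of a step, which is O(κ). In
interaction variables a step changes the error by the local terms and by O(κ) times its own size
(`exists_nrm_step_le`), so `discrete_gronwall` closes the estimate, bootstrapping the a priori bound
1 that the locally Lipschitz nonlinearity needs. Part (ii) is the same bound at Sobolev order max(m,
N+1). -/

namespace OscNLDE

open Filter Topology MeasureTheory
open scoped ENNReal NNReal ComplexConjugate

/-! ### Frequency weights. -/

/-- The weight `ω_l = (1 + μ_l²)^{1/2}`. -/
noncomputable def om (a b : ℝ) (l : ℤ) : ℝ := Real.sqrt (1 + mu a b l ^ 2)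

theorem om_sq (a b : ℝ) (l : ℤ) : om a b l ^ 2 = 1 + mu a b l ^ 2 :=
  Real.sq_sqrt (by positivity)

theorem one_le_om (a b : ℝ) (l : ℤ) : 1 ≤ om a b l := by
  unfold om; rw [Real.one_le_sqrt]; nlinarith [sq_nonneg (mu a b l)]

theorem om_pos (a b : ℝ) (l : ℤ) : 0 < om a b l := lt_of_lt_of_le one_pos (one_le_om a b l)

theorem abs_mu_le_om (a b : ℝ) (l : ℤ) : |mu a b l| ≤ om a b l := by
  unfold om; apply Real.abs_le_sqrt; linarith

theorem om_add_le (a b : ℝ) (l m : ℤ) : om a b (l + m) ≤ om a b l + om a b m := by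
  have h : mu a b (l + m) = mu a b l + mu a b m := by unfold mu; push_cast; ring
  apply abs_le_of_sq_le_sq' _ (by linarith [one_le_om a b l, one_le_om a b m]) |>.2
  rw [om_sq, h]
  nlinarith [om_sq a b l, om_sq a b m, abs_mu_le_om a b l, abs_mu_le_om a b m,
    abs_mul_abs_self (mu a b l), abs_mul_abs_self (mu a b m), abs_nonneg (mu a b l),
    abs_nonneg (mu a b m), le_abs_self (mu a b l * mu a b m), abs_mul (mu a b l) (mu a b m),
    mul_le_mul (abs_mu_le_om a b l) (abs_mu_le_om a b m) (abs_nonneg _) (om_pos a b l).le]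

theorem om_neg (a b : ℝ) (l : ℤ) : om a b (-l) = om a b l := by
  unfold om mu; push_cast; congr 2; ring

/-- The indices are those of a product u v̄ w: the conjugated factor enters with frequency -q, which
the even weight does not see. -/
theorem om_tri (a b : ℝ) (l p q : ℤ) :
    om a b l ≤ om a b p + om a b q + om a b (l - p + q) := by
  have h1 := om_add_le a b (p + (-q)) (l - p + q)
  have h2 := om_add_le a b p (-q)
  rw [om_neg] at h2
  rw [show p + -q + (l - p + q) = l by ring] at h1
  linarith

/-- The weight as an extended nonnegative real. -/
noncomputable def wt (a b : ℝ) (l : ℤ) : ℝ≥0∞ := ENNReal.ofReal (om a b l)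

theorem one_le_wt (a b : ℝ) (l : ℤ) : 1 ≤ wt a b l := by
  unfold wt; rw [ENNReal.one_le_ofReal]; exact one_le_om a b l

theorem wt_ne_top (a b : ℝ) (l : ℤ) : wt a b l ≠ ∞ := ENNReal.ofReal_ne_top

theorem wt_ne_zero (a b : ℝ) (l : ℤ) : wt a b l ≠ 0 :=
  (lt_of_lt_of_le one_pos (one_le_wt a b l)).ne'

theorem wt_tri (a b : ℝ) (l p q : ℤ) :
    wt a b l ≤ wt a b p + wt a b q + wt a b (l - p + q) := by
  unfold wt
  rw [← ENNReal.ofReal_add (om_pos a b _).le (om_pos a b _).le,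
    ← ENNReal.ofReal_add (by linarith [om_pos a b p, om_pos a b q]) (om_pos a b _).le]
  exact ENNReal.ofReal_le_ofReal (om_tri a b l p q)

/-! ### ℓ² norms with values in [0,∞]: Cauchy–Schwarz and Young. -/

/-- The `ℓ²` norm of a sequence of extended nonnegative reals. -/
noncomputable def ltwo {ι : Type*} (α : ι → ℝ≥0∞) : ℝ≥0∞ := (∑' l, α l ^ 2) ^ (1 / 2 : ℝ)

section ltwo
variable {ι κ : Type*}

theorem ltwo_sq (α : ι → ℝ≥0∞) : ltwo α ^ 2 = ∑' l, α l ^ 2 := by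
  unfold ltwo
  rw [← ENNReal.rpow_natCast, ← ENNReal.rpow_mul]; norm_num

theorem sq_le_sq_iff_ennreal {x y : ℝ≥0∞} : x ^ 2 ≤ y ^ 2 ↔ x ≤ y :=
  ENNReal.pow_le_pow_left_iff two_ne_zero

/-- Reduction to finitely many modes, where ordinary limits and calculus apply. -/
theorem ltwo_le_iff {α : ι → ℝ≥0∞} {B : ℝ≥0∞} :
    ltwo α ≤ B ↔ ∀ S : Finset ι, ∑ l ∈ S, α l ^ 2 ≤ B ^ 2 := by
  rw [← sq_le_sq_iff_ennreal, ltwo_sq, ENNReal.tsum_eq_iSup_sum, iSup_le_iff]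

theorem ltwo_mono {α β : ι → ℝ≥0∞} (h : ∀ l, α l ≤ β l) : ltwo α ≤ ltwo β := by
  rw [← sq_le_sq_iff_ennreal, ltwo_sq, ltwo_sq]
  exact ENNReal.tsum_le_tsum fun l => pow_le_pow_left' (h l) 2

theorem le_ltwo (α : ι → ℝ≥0∞) (l : ι) : α l ≤ ltwo α := by
  rw [← sq_le_sq_iff_ennreal, ltwo_sq]
  exact ENNReal.le_tsum (f := fun l => α l ^ 2) l

theorem ltwo_const_mul (c : ℝ≥0∞) (α : ι → ℝ≥0∞) : ltwo (fun l => c * α l) = c * ltwo α := by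
  have h : ltwo (fun l => c * α l) ^ 2 = (c * ltwo α) ^ 2 := by
    rw [ltwo_sq, mul_pow, ltwo_sq, ← ENNReal.tsum_mul_left]
    simp_rw [mul_pow]
  exact le_antisymm (sq_le_sq_iff_ennreal.1 h.le) (sq_le_sq_iff_ennreal.1 h.ge)

theorem tsum_mul_sq_le (f g : ι → ℝ≥0∞) :
    (∑' i, f i * g i) ^ 2 ≤ (∑' i, f i ^ 2) * ∑' i, g i ^ 2 := by
  let _ : MeasurableSpace ι := ⊤
  have h := ENNReal.lintegral_mul_le_Lp_mul_Lq (μ := MeasureTheory.Measure.count)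
    (p := 2) (q := 2) (f := f) (g := g) Real.HolderConjugate.two_two
    (by exact Measurable.aemeasurable (fun _ _ => trivial))
    (by exact Measurable.aemeasurable (fun _ _ => trivial))
  simp only [MeasureTheory.lintegral_count, Pi.mul_apply] at h
  have h2 := pow_le_pow_left' h 2
  refine h2.trans (le_of_eq ?_)
  rw [mul_pow, ← ENNReal.rpow_natCast, ← ENNReal.rpow_natCast (_ ^ _), ← ENNReal.rpow_mul,
    ← ENNReal.rpow_mul]
  norm_num

theorem ltwo_add_le (α β : ι → ℝ≥0∞) : ltwo (fun l => α l + β l) ≤ ltwo α + ltwo β := by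
  rw [← sq_le_sq_iff_ennreal, ltwo_sq]
  have hc : ∑' l, α l * β l ≤ ltwo α * ltwo β := by
    rw [← sq_le_sq_iff_ennreal, mul_pow, ltwo_sq, ltwo_sq]
    exact tsum_mul_sq_le α β
  calc ∑' l, (α l + β l) ^ 2 = ∑' l, (α l ^ 2 + 2 * (α l * β l) + β l ^ 2) := by
        congr 1; ext l; ring
    _ = ltwo α ^ 2 + 2 * ∑' l, α l * β l + ltwo β ^ 2 := by
        rw [ENNReal.tsum_add, ENNReal.tsum_add, ENNReal.tsum_mul_left, ltwo_sq, ltwo_sq]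
    _ ≤ ltwo α ^ 2 + 2 * (ltwo α * ltwo β) + ltwo β ^ 2 := by gcongr
    _ = _ := by ring

/-- Young's inequality `‖∑_i c_i A(φ_i ·)‖₂ ≤ ‖c‖₁ ‖A‖₂`. -/
theorem ltwo_tsum_le (c : κ → ℝ≥0∞) (A : ι → ℝ≥0∞) (φ : κ → ι → ι)
    (hφ : ∀ i, Function.Injective (φ i)) :
    ltwo (fun l => ∑' i, c i * A (φ i l)) ≤ (∑' i, c i) * ltwo A := by
  rw [← sq_le_sq_iff_ennreal, ltwo_sq, mul_pow, ltwo_sq]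
  -- Cauchy–Schwarz with c split as √c · √c; exchanging the sums then needs only injectivity of each
  -- φ i.
  have key : ∀ l, (∑' i, c i * A (φ i l)) ^ 2 ≤ (∑' i, c i) * ∑' i, c i * A (φ i l) ^ 2 := by
    intro l
    have hs : ∀ x : ℝ≥0∞, (x ^ (1 / 2 : ℝ)) ^ 2 = x := fun x => by
      rw [← ENNReal.rpow_natCast, ← ENNReal.rpow_mul]; norm_num
    have h := tsum_mul_sq_le (fun i => c i ^ (1 / 2 : ℝ))
      (fun i => c i ^ (1 / 2 : ℝ) * A (φ i l))
    simp only [mul_pow, hs, ← mul_assoc] at h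
    simp only [← sq, hs] at h
    exact h
  calc ∑' l, (∑' i, c i * A (φ i l)) ^ 2
      ≤ ∑' l, (∑' i, c i) * ∑' i, c i * A (φ i l) ^ 2 := ENNReal.tsum_le_tsum key
    _ = (∑' i, c i) * ∑' i, c i * ∑' l, A (φ i l) ^ 2 := by
        rw [ENNReal.tsum_mul_left, ENNReal.tsum_comm]
        simp_rw [ENNReal.tsum_mul_left]
    _ ≤ (∑' i, c i) * ∑' i, c i * ∑' l, A l ^ 2 := by
        refine mul_le_mul_right (ENNReal.tsum_le_tsum fun i => mul_le_mul_right ?_ _) _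
        exact ENNReal.tsum_comp_le_tsum_of_injective (hφ i) (fun l => A l ^ 2)
    _ = _ := by rw [ENNReal.tsum_mul_right, sq, mul_assoc]

end ltwo

/-! ### Sobolev norms of coefficient sequences. -/

/-- The Sobolev norm of order `k` of a sequence of Fourier coefficients, through the norms of the
coefficients. -/
noncomputable def nrm {E : Type*} [NormedAddCommGroup E] (a b : ℝ) (k : ℕ) (u : ℤ → E) : ℝ≥0∞ :=
  ltwo fun l => wt a b l ^ k * ‖u l‖ₑ

section nrm
variable {E F : Type*} [NormedAddCommGroup E] [NormedAddCommGroup F] {a b : ℝ} {k : ℕ}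

theorem nrm_mono {u : ℤ → E} {v : ℤ → F} (h : ∀ l, ‖u l‖ₑ ≤ ‖v l‖ₑ) :
    nrm a b k u ≤ nrm a b k v := ltwo_mono fun l => by gcongr; exact h l

theorem nrm_le_mul {u : ℤ → E} {v : ℤ → F} (c : ℝ≥0∞) (h : ∀ l, ‖u l‖ₑ ≤ c * ‖v l‖ₑ) :
    nrm a b k u ≤ c * nrm a b k v := by
  unfold nrm
  rw [← ltwo_const_mul]
  refine ltwo_mono fun l => ?_
  calc _ ≤ wt a b l ^ k * (c * ‖v l‖ₑ) := by gcongr; exact h l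
    _ = _ := by ring

theorem nrm_le_of_le {u : ℤ → E} {j : ℕ} (h : j ≤ k) : nrm a b j u ≤ nrm a b k u :=
  ltwo_mono fun l => by gcongr; exact one_le_wt a b l

theorem nrm_add_le (u v : ℤ → E) : nrm a b k (u + v) ≤ nrm a b k u + nrm a b k v := by
  refine le_trans (ltwo_mono fun l => ?_) (ltwo_add_le _ _)
  rw [← mul_add]; gcongr; exact enorm_add_le _ _

theorem nrm_neg (u : ℤ → E) : nrm a b k (-u) = nrm a b k u := by
  unfold nrm; simp

theorem nrm_sub_le (u v : ℤ → E) : nrm a b k (u - v) ≤ nrm a b k u + nrm a b k v := by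
  rw [sub_eq_add_neg, ← nrm_neg v]; exact nrm_add_le _ _

theorem nrm_sub_comm (u v : ℤ → E) : nrm a b k (u - v) = nrm a b k (v - u) := by
  rw [← nrm_neg, neg_sub]

@[simp] theorem nrm_zero : nrm a b k (0 : ℤ → E) = 0 := by
  unfold nrm ltwo; simp

theorem nrm_sum_le {ι : Type*} (S : Finset ι) (u : ι → ℤ → E) :
    nrm a b k (∑ i ∈ S, u i) ≤ ∑ i ∈ S, nrm a b k (u i) := by
  classical
  induction S using Finset.induction_on with
  | empty => simp
  | insert i S hi ih =>
    rw [Finset.sum_insert hi, Finset.sum_insert hi]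
    exact (nrm_add_le _ _).trans (by gcongr)

/-- Fatou's lemma: the norm is a supremum over finite sets of modes. It serves for endpoint limits
in the mean value inequality, for the exponential series, and for turning an almost-everywhere bound
in time into an everywhere bound. -/
theorem nrm_le_of_tendsto {ι : Type*} {𝓕 : Filter ι} [𝓕.NeBot] {u : ι → ℤ → E} {v : ℤ → E}
    {B : ℝ≥0∞} (h : ∀ l, Tendsto (fun i => u i l) 𝓕 (𝓝 (v l)))
    (hB : ∀ᶠ i in 𝓕, nrm a b k (u i) ≤ B) : nrm a b k v ≤ B := by
  refine ltwo_le_iff.2 fun S => ?_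
  refine le_of_tendsto (f := fun i => ∑ l ∈ S, (wt a b l ^ k * ‖u i l‖ₑ) ^ 2) (x := 𝓕) ?_ ?_
  · refine tendsto_finsetSum _ fun l _ => ?_
    refine (ENNReal.continuous_pow 2).continuousAt.tendsto.comp ?_
    refine ENNReal.Tendsto.const_mul ?_ (Or.inr (ENNReal.pow_ne_top (wt_ne_top a b l)))
    exact (h l).enorm
  · filter_upwards [hB] with i hi
    exact ltwo_le_iff.1 hi S

end nrm

/-! ### Embedding of H¹ into the Wiener algebra. -/

section embedding
variable {a b : ℝ}

theorem tsum_inv_wt_sq_ne_top (hab : a < b) : ∑' l : ℤ, (wt a b l)⁻¹ ^ 2 ≠ ∞ := by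
  have h1 : Summable fun l : ℤ => 1 / om a b l ^ 2 := by
    have h2 : Summable fun l : ℤ => ((b - a) / (2 * Real.pi)) ^ 2 * (1 / (l : ℝ) ^ 2) :=
      (Real.summable_one_div_int_pow.2 (by norm_num)).mul_left _
    refine Summable.of_norm_bounded_eventually h2 ?_
    have : {l : ℤ | l ≠ 0} ∈ cofinite := (Set.finite_singleton (0 : ℤ)).compl_mem_cofinite
    filter_upwards [this] with l hl
    have hl' : (l : ℝ) ≠ 0 := by exact_mod_cast hl
    have hba : 0 < b - a := by linarith
    rw [om_sq, Real.norm_of_nonneg (by positivity)]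
    have : ((b - a) / (2 * Real.pi)) ^ 2 * (1 / (l : ℝ) ^ 2) = 1 / mu a b l ^ 2 := by
      unfold mu; field_simp
    rw [this]
    have hmu : 0 < mu a b l ^ 2 := by unfold mu; positivity
    exact one_div_le_one_div_of_le hmu (by linarith)
  have h3 : ∀ l : ℤ, (wt a b l)⁻¹ ^ 2 = ENNReal.ofReal (1 / om a b l ^ 2) := by
    intro l
    rw [wt, ← ENNReal.ofReal_inv_of_pos (om_pos a b l), ← ENNReal.ofReal_pow (by
      have := om_pos a b l; positivity)]
    congr 1; rw [inv_pow, one_div]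
  simp_rw [h3]
  exact h1.tsum_ofReal_ne_top

/-- The constant of the embedding of `H¹` into the Wiener algebra. -/
noncomputable def embC (a b : ℝ) : ℝ≥0∞ := ltwo fun l => (wt a b l)⁻¹

theorem embC_ne_top (hab : a < b) : embC a b ≠ ∞ := by
  intro h
  have := ltwo_sq (fun l => (wt a b l)⁻¹)
  rw [embC] at h
  rw [h] at this
  exact tsum_inv_wt_sq_ne_top hab (by rw [← this]; simp)

/-- Cauchy–Schwarz against 1/ω, which is square summable in one dimension. -/
theorem tsum_le_embC_mul (α : ℤ → ℝ≥0∞) :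
    ∑' l, α l ≤ embC a b * ltwo fun l => wt a b l * α l := by
  rw [← sq_le_sq_iff_ennreal, mul_pow, embC, ltwo_sq, ltwo_sq]
  refine le_trans (le_of_eq ?_) (tsum_mul_sq_le _ _)
  congr 2; ext l
  rw [← mul_assoc, ENNReal.inv_mul_cancel (wt_ne_zero a b l) (wt_ne_top a b l), one_mul]

theorem ltwo_wt_mono {α : ℤ → ℝ≥0∞} {j k : ℕ} (h : j ≤ k) :
    (ltwo fun l => wt a b l ^ j * α l) ≤ ltwo fun l => wt a b l ^ k * α l :=
  ltwo_mono fun l => by gcongr; exact one_le_wt a b l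

theorem tsum_le_embC_mul' (α : ℤ → ℝ≥0∞) {k : ℕ} (hk : 1 ≤ k) :
    ∑' l, α l ≤ embC a b * ltwo fun l => wt a b l ^ k * α l := by
  refine (tsum_le_embC_mul (a := a) (b := b) α).trans ?_
  gcongr
  simpa using ltwo_wt_mono (a := a) (b := b) (α := α) hk

theorem tsum_enorm_le {E : Type*} [NormedAddCommGroup E] (u : ℤ → E) {k : ℕ} (hk : 1 ≤ k) :
    ∑' l, ‖u l‖ₑ ≤ embC a b * nrm a b k u := tsum_le_embC_mul' _ hk

theorem summable_norm_of_nrm {E : Type*} [NormedAddCommGroup E] (hab : a < b) {u : ℤ → E} {k : ℕ}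
    (hk : 1 ≤ k) (h : nrm a b k u ≠ ∞) : Summable fun l => ‖u l‖ := by
  have h1 : ∑' l, ‖u l‖ₑ ≠ ∞ := ne_top_of_le_ne_top
    (ENNReal.mul_ne_top (embC_ne_top hab) h) (tsum_enorm_le u hk)
  simpa using ENNReal.summable_toReal h1

end embedding

/-! ### Trilinear convolution estimates. -/

section trilinear
variable {a b : ℝ}

/-- The weight of a triple interaction. -/
noncomputable def wt3 (a b : ℝ) (l : ℤ) (i : ℤ × ℤ) : ℝ≥0∞ :=
  wt a b i.1 + wt a b i.2 + wt a b (l - i.1 + i.2)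

/-- For fixed values of the other two frequencies, the frequency of A is a translate of l, so
Young's inequality applies with A in ℓ² and B, C in ℓ¹. The two variants below put B or C in ℓ²
instead. -/
theorem ltwo_interaction₁ (A B C : ℤ → ℝ≥0∞) :
    (ltwo fun l : ℤ => ∑' i : ℤ × ℤ, A i.1 * B i.2 * C (l - i.1 + i.2))
      ≤ (∑' q, B q) * (∑' r, C r) * ltwo A := by
  have h := ltwo_tsum_le (fun i : ℤ × ℤ => B i.1 * C i.2) A (fun i l => l + i.1 - i.2)
    (fun i x y h => by simpa using h)
  rw [ENNReal.tsum_prod (f := fun i j => B i * C j)] at h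
  simp_rw [ENNReal.tsum_mul_left, ENNReal.tsum_mul_right] at h
  refine le_trans (le_of_eq ?_) h
  congr 1; ext l
  let e : ℤ × ℤ ≃ ℤ × ℤ :=
    { toFun := fun i => (i.2, l - i.1 + i.2)
      invFun := fun i => (l + i.1 - i.2, i.1)
      left_inv := fun i => by ext <;> simp
      right_inv := fun i => by ext <;> dsimp only <;> ring }
  refine Eq.trans (tsum_congr fun i => ?_) (e.tsum_eq fun i : ℤ × ℤ => B i.1 * C i.2 * A (l + i.1 - i.2))
  have : l + i.2 - (l - i.1 + i.2) = i.1 := by ring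
  simp only [e, Equiv.coe_fn_mk, this]; ring

/-- Here the remaining frequency is a reflection of l rather than a translate, because of the
conjugation; it is still injective in l. -/
theorem ltwo_interaction₂ (A B C : ℤ → ℝ≥0∞) :
    (ltwo fun l : ℤ => ∑' i : ℤ × ℤ, A i.1 * B i.2 * C (l - i.1 + i.2))
      ≤ (∑' q, A q) * (∑' r, C r) * ltwo B := by
  have h := ltwo_tsum_le (fun i : ℤ × ℤ => A i.1 * C i.2) B (fun i l => i.1 + i.2 - l)
    (fun i x y h => by simpa using h)
  rw [ENNReal.tsum_prod (f := fun i j => A i * C j)] at h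
  simp_rw [ENNReal.tsum_mul_left, ENNReal.tsum_mul_right] at h
  refine le_trans (le_of_eq ?_) h
  congr 1; ext l
  let e : ℤ × ℤ ≃ ℤ × ℤ :=
    { toFun := fun i => (i.1, l - i.1 + i.2)
      invFun := fun i => (i.1, i.1 + i.2 - l)
      left_inv := fun i => by ext <;> simp <;> ring
      right_inv := fun i => by ext <;> dsimp only <;> ring }
  refine Eq.trans (tsum_congr fun i => ?_) (e.tsum_eq fun i : ℤ × ℤ => A i.1 * C i.2 * B (i.1 + i.2 - l))
  have : i.1 + (l - i.1 + i.2) - l = i.2 := by ring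
  simp only [e, Equiv.coe_fn_mk, this]; ring

theorem ltwo_interaction₃ (A B C : ℤ → ℝ≥0∞) :
    (ltwo fun l : ℤ => ∑' i : ℤ × ℤ, A i.1 * B i.2 * C (l - i.1 + i.2))
      ≤ (∑' q, A q) * (∑' r, B r) * ltwo C := by
  have h := ltwo_tsum_le (fun i : ℤ × ℤ => A i.1 * B i.2) C (fun i l => l - i.1 + i.2)
    (fun i x y h => by simpa using h)
  rw [ENNReal.tsum_prod (f := fun i j => A i * B j)] at h
  simpa only [ENNReal.tsum_mul_left, ENNReal.tsum_mul_right] using h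

/-- The constant of the trilinear convolution estimate in `H^n`. -/
noncomputable def triC (a b : ℝ) (n : ℕ) : ℝ≥0∞ := 3 ^ n * (3 * embC a b ^ 2)

theorem triC_ne_top (hab : a < b) (n : ℕ) : triC a b n ≠ ∞ := by
  have := embC_ne_top hab
  unfold triC
  exact ENNReal.mul_ne_top (by simp) (ENNReal.mul_ne_top (by simp) (ENNReal.pow_ne_top this))

theorem add_add_pow_le (x y z : ℝ≥0∞) (n : ℕ) :
    (x + y + z) ^ n ≤ 3 ^ n * (x ^ n + y ^ n + z ^ n) := by
  have key : ∀ m, x ≤ m → y ≤ m → z ≤ m → (x + y + z) ^ n ≤ 3 ^ n * m ^ n := by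
    intro m hx hy hz
    rw [← mul_pow]; gcongr
    calc x + y + z ≤ m + m + m := by gcongr
      _ = 3 * m := by ring
  have hx : x ^ n ≤ x ^ n + y ^ n + z ^ n := le_add_right le_self_add
  have hy : y ^ n ≤ x ^ n + y ^ n + z ^ n := le_add_right le_add_self
  have hz : z ^ n ≤ x ^ n + y ^ n + z ^ n := le_add_self
  rcases le_total x y with h | h
  · rcases le_total y z with h' | h'
    · exact (key z (h.trans h') h' le_rfl).trans (by gcongr)
    · exact (key y h le_rfl h').trans (by gcongr)
  · rcases le_total x z with h' | h'
    · exact (key z h' (h.trans h') le_rfl).trans (by gcongr)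
    · exact (key x le_rfl h h').trans (by gcongr)

/-- A kernel growing like the j-th power of the frequencies costs j derivatives. The output weight
is dominated by `wt3`, so all n = j + k powers fall on the inputs; after expanding, one factor takes
them and stays in ℓ², while the other two go to ℓ¹ through the embedding. -/
theorem ltwo_trilinear_le (j k n : ℕ) (hn : j + k = n) (hn1 : 1 ≤ n) (α β γ : ℤ → ℝ≥0∞) :
    (ltwo fun l => wt a b l ^ k * ∑' i : ℤ × ℤ,
        wt3 a b l i ^ j * (α i.1 * β i.2 * γ (l - i.1 + i.2)))
      ≤ triC a b n * ((ltwo fun l => wt a b l ^ n * α l) * (ltwo fun l => wt a b l ^ n * β l) *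
        ltwo fun l => wt a b l ^ n * γ l) := by
  set w : (ℤ → ℝ≥0∞) → ℤ → ℝ≥0∞ := fun α l => wt a b l ^ n * α l with hw
  have hpt : ∀ l, (wt a b l ^ k * ∑' i : ℤ × ℤ,
        wt3 a b l i ^ j * (α i.1 * β i.2 * γ (l - i.1 + i.2)))
      ≤ 3 ^ n * ((∑' i : ℤ × ℤ, w α i.1 * β i.2 * γ (l - i.1 + i.2)) +
        (∑' i : ℤ × ℤ, α i.1 * w β i.2 * γ (l - i.1 + i.2)) +
        (∑' i : ℤ × ℤ, α i.1 * β i.2 * w γ (l - i.1 + i.2))) := by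
    intro l
    rw [← ENNReal.tsum_add, ← ENNReal.tsum_add, ← ENNReal.tsum_mul_left, ← ENNReal.tsum_mul_left]
    refine ENNReal.tsum_le_tsum fun i => ?_
    have h1 : wt a b l ^ k * wt3 a b l i ^ j ≤ wt3 a b l i ^ n := by
      rw [← hn, add_comm, pow_add]; gcongr; exact wt_tri a b l i.1 i.2
    have h2 := h1.trans (add_add_pow_le _ _ _ n)
    rw [← mul_assoc]
    calc _ ≤ _ := mul_le_mul_left h2 _
      _ = _ := by simp only [hw]; ring
  have e1 : ∀ α : ℤ → ℝ≥0∞, ∑' l, α l ≤ embC a b * ltwo (w α) := fun α =>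
    tsum_le_embC_mul' α hn1
  calc _ ≤ _ := ltwo_mono hpt
    _ = 3 ^ n * _ := ltwo_const_mul _ _
    _ ≤ 3 ^ n * ((embC a b * ltwo (w β)) * (embC a b * ltwo (w γ)) * ltwo (w α) +
        (embC a b * ltwo (w α)) * (embC a b * ltwo (w γ)) * ltwo (w β) +
        (embC a b * ltwo (w α)) * (embC a b * ltwo (w β)) * ltwo (w γ)) := by
      gcongr
      refine (ltwo_add_le _ _).trans (add_le_add ((ltwo_add_le _ _).trans (add_le_add ?_ ?_)) ?_)
      · exact (ltwo_interaction₁ _ _ _).trans (by gcongr <;> exact e1 _)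
      · exact (ltwo_interaction₂ _ _ _).trans (by gcongr <;> exact e1 _)
      · exact (ltwo_interaction₃ _ _ _).trans (by gcongr <;> exact e1 _)
    _ = _ := by unfold triC; ring

end trilinear

/-! ### Mean value inequality in Sobolev norms, from coefficientwise derivatives. -/

section meanValue
variable {E : Type*} [NormedAddCommGroup E] [NormedSpace ℝ E] {a b : ℝ} {k : ℕ}

theorem nrm_sub_le_of_hasDerivAt_Icc {y y' : ℝ → ℤ → E} {s t : ℝ} (hst : s ≤ t) {B : ℝ≥0∞}
    (hy : ∀ r ∈ Set.Icc s t, ∀ l, HasDerivAt (fun r => y r l) (y' r l) r)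
    (hB : ∀ r ∈ Set.Icc s t, nrm a b k (y' r) ≤ B) :
    nrm a b k (y t - y s) ≤ ENNReal.ofReal (t - s) * B := by
  rcases eq_or_ne B ∞ with rfl | hBt
  · rcases hst.eq_or_lt with rfl | h
    · simp
    · rw [ENNReal.mul_top (by simpa using h)]; exact le_top
  refine ltwo_le_iff.2 fun S => ?_
  -- On a finite set S of modes the weighted norm is that of an ℓ² product, so the usual mean value
  -- inequality applies, with a bound independent of S.
  let Y : ℝ → PiLp 2 (fun _ : S => E) := fun r =>
    WithLp.toLp 2 fun l => om a b l ^ k • y r l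
  let Y' : ℝ → PiLp 2 (fun _ : S => E) := fun r =>
    WithLp.toLp 2 fun l => om a b l ^ k • y' r l
  have hnorm : ∀ v : ℤ → E, ∑ l ∈ S, (wt a b l ^ k * ‖v l‖ₑ) ^ 2 =
      ENNReal.ofReal (‖(WithLp.toLp 2 fun l => om a b l ^ k • v l : PiLp 2 (fun _ : S => E))‖ ^ 2)
      := by
    intro v
    rw [PiLp.norm_sq_eq_of_L2, ← Finset.sum_coe_sort S, ENNReal.ofReal_sum_of_nonneg
      (fun _ _ => by positivity)]
    refine Finset.sum_congr rfl fun l _ => ?_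
    rw [ENNReal.ofReal_pow (norm_nonneg _)]
    simp only [norm_smul, norm_pow]
    rw [Real.norm_of_nonneg (om_pos a b l).le, ENNReal.ofReal_mul (by
      have := om_pos a b l; positivity), ENNReal.ofReal_pow (om_pos a b l).le, ofReal_norm]
    rfl
  have hd : ∀ r ∈ Set.Icc s t, HasDerivWithinAt Y (Y' r) (Set.Icc s t) r := by
    intro r hr
    have h1 : HasDerivAt (fun r => fun l : S => om a b l ^ k • y r l)
        (fun l : S => om a b l ^ k • y' r l) r :=
      hasDerivAt_pi.2 fun l => (hy r hr l).const_smul _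
    exact ((PiLp.continuousLinearEquiv 2 ℝ (fun _ : S => E)).symm.hasFDerivAt.comp_hasDerivAt
      r h1).hasDerivWithinAt
  have hb : ∀ r ∈ Set.Icc s t, ‖Y' r‖ ≤ B.toReal := by
    intro r hr
    have h1 := ltwo_le_iff.1 (hB r hr) S
    rw [hnorm, ENNReal.ofReal_le_iff_le_toReal (ENNReal.pow_ne_top hBt), ENNReal.toReal_pow] at h1
    exact le_of_sq_le_sq h1 ENNReal.toReal_nonneg
  have h2 := (convex_Icc s t).norm_image_sub_le_of_norm_hasDerivWithin_le hd hb
    (Set.left_mem_Icc.2 hst) (Set.right_mem_Icc.2 hst)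
  have h3 : Y t - Y s = WithLp.toLp 2 fun l : S => om a b l ^ k • (y t - y s) l := by
    ext l; simp [Y, smul_sub]
  rw [Real.norm_of_nonneg (sub_nonneg.2 hst)] at h2
  rw [hnorm, ← h3, ← ENNReal.ofReal_toReal hBt, ← ENNReal.ofReal_mul (sub_nonneg.2 hst),
    ← ENNReal.ofReal_pow (mul_nonneg (sub_nonneg.2 hst) ENNReal.toReal_nonneg)]
  exact ENNReal.ofReal_le_ofReal (pow_le_pow_left₀ (norm_nonneg _) (by linarith) 2)

/-- A mean value inequality for sequences differentiable coefficient by coefficient. -/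
theorem nrm_sub_le_of_hasDerivAt {y y' : ℝ → ℤ → E} {s t : ℝ} (hst : s ≤ t) {B : ℝ≥0∞}
    (hc : ∀ l, ContinuousOn (fun r => y r l) (Set.Icc s t))
    (hy : ∀ r ∈ Set.Ioo s t, ∀ l, HasDerivAt (fun r => y r l) (y' r l) r)
    (hB : ∀ r ∈ Set.Ioo s t, nrm a b k (y' r) ≤ B) :
    nrm a b k (y t - y s) ≤ ENNReal.ofReal (t - s) * B := by
  rcases hst.eq_or_lt with rfl | hlt
  · simp
  -- Derivatives are known in the open interval only: both ends are moved inwards by δ, then δ → 0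
  -- by coefficientwise continuity and Fatou.
  have h1 : ∀ δ ∈ Set.Ioo 0 ((t - s) / 2),
      nrm a b k (y (t - δ) - y (s + δ)) ≤ ENNReal.ofReal (t - s) * B := by
    intro δ hδ
    have hδ1 := hδ.1
    have hδ2 := hδ.2
    refine (nrm_sub_le_of_hasDerivAt_Icc (y' := y') (by linarith) (B := B) ?_ ?_).trans ?_
    · exact fun r hr => hy r ⟨by linarith [hr.1], by linarith [hr.2]⟩
    · exact fun r hr => hB r ⟨by linarith [hr.1], by linarith [hr.2]⟩
    · gcongr <;> linarith
  refine nrm_le_of_tendsto (𝓕 := 𝓝[>] (0 : ℝ)) (u := fun δ => y (t - δ) - y (s + δ)) ?_ ?_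
  · intro l
    have hin : ∀ᶠ δ in 𝓝[>] (0 : ℝ), δ ∈ Set.Ioo 0 ((t - s) / 2) :=
      Ioo_mem_nhdsGT (by linarith)
    have ht : Tendsto (fun δ : ℝ => t - δ) (𝓝[>] 0) (𝓝[Set.Icc s t] t) := by
      refine tendsto_nhdsWithin_iff.2 ⟨?_, ?_⟩
      · have : Tendsto (fun δ : ℝ => t - δ) (𝓝 0) (𝓝 (t - 0)) := (continuous_const.sub continuous_id).tendsto 0
        rw [sub_zero] at this
        exact this.mono_left nhdsWithin_le_nhds
      · filter_upwards [hin] with δ hδ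
        exact ⟨by linarith [hδ.2, hδ.1], by linarith [hδ.1]⟩
    have hs : Tendsto (fun δ : ℝ => s + δ) (𝓝[>] 0) (𝓝[Set.Icc s t] s) := by
      refine tendsto_nhdsWithin_iff.2 ⟨?_, ?_⟩
      · have : Tendsto (fun δ : ℝ => s + δ) (𝓝 0) (𝓝 (s + 0)) := (continuous_const.add continuous_id).tendsto 0
        rw [add_zero] at this
        exact this.mono_left nhdsWithin_le_nhds
      · filter_upwards [hin] with δ hδ
        exact ⟨by linarith [hδ.1], by linarith [hδ.2, hδ.1]⟩
    exact ((hc l t (Set.right_mem_Icc.2 hst)).tendsto.comp ht).sub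
      ((hc l s (Set.left_mem_Icc.2 hst)).tendsto.comp hs)
  · filter_upwards [Ioo_mem_nhdsGT (show (0 : ℝ) < (t - s) / 2 by linarith)] with δ hδ
    exact h1 δ hδ

end meanValue

/-! ### The cubic nonlinearity as a trilinear form. -/

/-- The coefficients of the cubic nonlinearity, `(F(v)v)_i = ∑_j c_ij |v_j|² v_i`. -/
noncomputable def cubCoeff (lam1 lam2 : ℝ) (i j : Fin 2) : ℂ :=
  if i = j then (lam1 + lam2 : ℝ) else (lam2 - lam1 : ℝ)

/-- The trilinear form underlying the cubic nonlinearity. -/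
noncomputable def triForm (lam1 lam2 : ℝ) (u v w : Spinor) : Spinor := fun i =>
  ∑ j, cubCoeff lam1 lam2 i j * (u j * conj (v j)) * w i

section algebra
variable {lam1 lam2 : ℝ}

/-- A bound for the trilinear form. -/
noncomputable def formC (lam1 lam2 : ℝ) : ℝ := 2 * (|lam1 + lam2| + |lam2 - lam1|)

theorem formC_nonneg : 0 ≤ formC lam1 lam2 := by unfold formC; positivity

theorem norm_cubCoeff_le (i j : Fin 2) :
    ‖cubCoeff lam1 lam2 i j‖ ≤ |lam1 + lam2| + |lam2 - lam1| := by
  unfold cubCoeff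
  split_ifs <;> rw [Complex.norm_real, Real.norm_eq_abs] <;>
    linarith [abs_nonneg (lam1 + lam2), abs_nonneg (lam2 - lam1)]

theorem norm_triForm_le (u v w : Spinor) :
    ‖triForm lam1 lam2 u v w‖ ≤ formC lam1 lam2 * (‖u‖ * ‖v‖ * ‖w‖) := by
  have hC := formC_nonneg (lam1 := lam1) (lam2 := lam2)
  rw [pi_norm_le_iff_of_nonneg (by positivity)]
  intro i
  have h : ∀ j, ‖cubCoeff lam1 lam2 i j * (u j * conj (v j)) * w i‖ ≤
      (|lam1 + lam2| + |lam2 - lam1|) * (‖u‖ * ‖v‖ * ‖w‖) := by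
    intro j
    rw [norm_mul, norm_mul, norm_mul, RCLike.norm_conj, mul_assoc]
    gcongr
    · exact norm_cubCoeff_le i j
    all_goals exact norm_le_pi_norm _ _
  refine (norm_sum_le_of_le _ fun j _ => h j).trans (le_of_eq ?_)
  rw [Finset.sum_const, Finset.card_univ, Fintype.card_fin, formC]; ring

theorem triForm_smul (x y z : ℂ) (u v w : Spinor) :
    triForm lam1 lam2 (x • u) (y • v) (z • w) = (x * conj y * z) • triForm lam1 lam2 u v w := by
  ext i
  simp only [triForm, Fin.sum_univ_two, Pi.smul_apply, smul_eq_mul, map_mul]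
  ring

theorem triForm_add₁ (u u' v w : Spinor) :
    triForm lam1 lam2 (u + u') v w = triForm lam1 lam2 u v w + triForm lam1 lam2 u' v w := by
  ext i
  simp only [triForm, Fin.sum_univ_two, Pi.add_apply]
  ring

theorem triForm_add₂ (u v v' w : Spinor) :
    triForm lam1 lam2 u (v + v') w = triForm lam1 lam2 u v w + triForm lam1 lam2 u v' w := by
  ext i
  simp only [triForm, Fin.sum_univ_two, Pi.add_apply, map_add]
  ring

theorem triForm_add₃ (u v w w' : Spinor) :
    triForm lam1 lam2 u v (w + w') = triForm lam1 lam2 u v w + triForm lam1 lam2 u v w' := by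
  ext i
  simp only [triForm, Fin.sum_univ_two, Pi.add_apply]
  ring

theorem triForm_sub (u u' v v' w w' : Spinor) :
    triForm lam1 lam2 u v w - triForm lam1 lam2 u' v' w' =
      triForm lam1 lam2 (u - u') v w + triForm lam1 lam2 u' (v - v') w +
        triForm lam1 lam2 u' v' (w - w') := by
  ext i
  simp only [triForm, Fin.sum_univ_two, Pi.add_apply, Pi.sub_apply, map_sub]
  ring

theorem norm_triForm_sub_le (u u' v v' w w' : Spinor) :
    ‖triForm lam1 lam2 u v w - triForm lam1 lam2 u' v' w'‖ ≤ formC lam1 lam2 *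
      (‖u - u'‖ * ‖v‖ * ‖w‖ + ‖u'‖ * ‖v - v'‖ * ‖w‖ + ‖u'‖ * ‖v'‖ * ‖w - w'‖) := by
  rw [triForm_sub, mul_add, mul_add]
  exact norm_add_le_of_le (norm_add_le_of_le (norm_triForm_le _ _ _) (norm_triForm_le _ _ _))
    (norm_triForm_le _ _ _)

end algebra

/-! ### Spectral decomposition of the free Dirac symbol. -/

/-- The sign attached to a branch of the dispersion relation. -/
def sgn (η : Bool) : ℝ := if η then 1 else -1

@[simp] theorem abs_sgn (η : Bool) : |sgn η| = 1 := by cases η <;> simp [sgn]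

/-- The spectral projections `(1 ± Γ_l/ω_l)/2`. -/
noncomputable def specProj (a b : ℝ) (l : ℤ) (η : Bool) : Spinor →L[ℂ] Spinor :=
  (1 / 2 : ℂ) • (ContinuousLinearMap.id ℂ Spinor +
    ((sgn η / om a b l : ℝ) : ℂ) • (Matrix.mulVecLin (Gam a b l)).toContinuousLinearMap)

/-- The linear propagator `e^{-iθΓ_l}`. -/
noncomputable def prop (a b θ : ℝ) (l : ℤ) : Spinor →L[ℂ] Spinor :=
  ∑ η : Bool, Complex.exp (-(Complex.I * θ * (sgn η * om a b l : ℝ))) • specProj a b l η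

section dirac
variable {a b : ℝ} {l : ℤ}

theorem Gam_mulVec (v : Spinor) :
    Matrix.mulVec (Gam a b l) v = ![mu a b l * v 1 + v 0, mu a b l * v 0 - v 1] := by
  ext i; fin_cases i <;>
    simp [Gam, sigma1, sigma3, Matrix.mulVec, dotProduct, Fin.sum_univ_two] <;> ring

theorem specProj_apply (η : Bool) (v : Spinor) : specProj a b l η v =
    (1 / 2 : ℂ) • (v + ((sgn η / om a b l : ℝ) : ℂ) • Matrix.mulVec (Gam a b l) v) := rfl

/-- The Clifford relations of σ₁ and σ₃ give Γ² = μ² + 1. This makes (1 ± Γ/ω)/2 complementary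
projections onto the eigenspaces ±ω. -/
theorem Gam_Gam (v : Spinor) :
    Matrix.mulVec (Gam a b l) (Matrix.mulVec (Gam a b l) v) = ((om a b l : ℂ) ^ 2) • v := by
  have h : ((om a b l : ℂ)) ^ 2 = 1 + (mu a b l : ℂ) ^ 2 := by exact_mod_cast om_sq a b l
  rw [h, Gam_mulVec, Gam_mulVec]
  ext i; fin_cases i <;> simp <;> ring

theorem norm_specProj_le (η : Bool) (v : Spinor) : ‖specProj a b l η v‖ ≤ 2 * ‖v‖ := by
  have hG : ‖Matrix.mulVec (Gam a b l) v‖ ≤ om a b l * (2 * ‖v‖) := by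
    have h0 := om_pos a b l
    rw [pi_norm_le_iff_of_nonneg (by positivity), Gam_mulVec]
    have h1 : ‖(mu a b l : ℂ)‖ ≤ om a b l := by
      rw [Complex.norm_real]; exact abs_mu_le_om a b l
    have h2 := one_le_om a b l
    have hv := fun i => norm_le_pi_norm v i
    have hm : ∀ i, ‖(mu a b l : ℂ) * v i‖ ≤ om a b l * ‖v‖ := fun i => by
      rw [norm_mul]; exact mul_le_mul h1 (hv i) (norm_nonneg _) h0.le
    have h3 : ∀ i, ‖v i‖ ≤ om a b l * ‖v‖ := fun i =>
      (hv i).trans (le_mul_of_one_le_left (norm_nonneg _) h2)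
    intro i; fin_cases i
    · simpa using (norm_add_le _ _).trans (by linarith [hm 1, h3 0])
    · simpa using (norm_sub_le _ _).trans (by linarith [hm 0, h3 1])
  rw [specProj_apply, norm_smul]
  have h4 : ‖((sgn η / om a b l : ℝ) : ℂ) • Matrix.mulVec (Gam a b l) v‖ ≤ 2 * ‖v‖ := by
    rw [norm_smul, Complex.norm_real, Real.norm_eq_abs, abs_div, abs_sgn, abs_of_pos (om_pos a b l)]
    refine (mul_le_mul_of_nonneg_left hG (by have := om_pos a b l; positivity)).trans ?_
    rw [← mul_assoc, one_div_mul_cancel (om_pos a b l).ne', one_mul]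
  have := norm_add_le v (((sgn η / om a b l : ℝ) : ℂ) • Matrix.mulVec (Gam a b l) v)
  have h5 : ‖(1 / 2 : ℂ)‖ = 1 / 2 := by norm_num
  rw [h5]
  linarith [norm_nonneg v]

theorem specProj_add (v : Spinor) : ∑ η, specProj a b l η v = v := by
  simp only [Fintype.sum_bool, specProj_apply, sgn, if_true, Bool.false_eq_true, if_false]
  push_cast
  module

theorem specProj_specProj (η η' : Bool) (v : Spinor) :
    specProj a b l η (specProj a b l η' v) = if η = η' then specProj a b l η v else 0 := by
  have h0 : (om a b l : ℂ) ≠ 0 := by exact_mod_cast (om_pos a b l).ne'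
  generalize hG : Matrix.mulVec (Gam a b l) v = g
  have hg : Matrix.mulVec (Gam a b l) g = ((om a b l : ℂ) ^ 2) • v := by rw [← hG, Gam_Gam]
  have key : specProj a b l η (specProj a b l η' v) =
      (1 / 4 : ℂ) • (v + ((sgn η : ℂ) * sgn η') • v +
        (((sgn η : ℂ) + sgn η') / om a b l) • g) := by
    simp only [specProj_apply, Matrix.mulVec_smul, Matrix.mulVec_add, smul_add,
      hG, hg, smul_smul]
    push_cast
    have e1 : (1 / 2 : ℂ) * (sgn η / om a b l * (1 / 2 * (sgn η' / om a b l) * om a b l ^ 2))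
        = 1 / 4 * (sgn η * sgn η') := by field_simp; ring
    have e2 : (1 / 4 : ℂ) * ((sgn η + sgn η') / om a b l) =
        1 / 2 * (1 / 2 * (sgn η' / om a b l)) + 1 / 2 * (sgn η / om a b l * (1 / 2)) := by ring
    rw [e1, e2]; module
  rw [key]
  cases η <;> cases η' <;> simp only [sgn, specProj_apply, if_true, Bool.false_eq_true, if_false,
    Bool.true_eq_false, hG] <;> push_cast <;> module

theorem specProj_prop (θ : ℝ) (η : Bool) (v : Spinor) :
    specProj a b l η (prop a b θ l v) =
      Complex.exp (-(Complex.I * θ * (sgn η * om a b l : ℝ))) • specProj a b l η v := by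
  simp only [prop, sum_apply, smul_apply, map_sum, map_smul, specProj_specProj]
  simp

theorem prop_specProj (θ : ℝ) (η : Bool) (v : Spinor) :
    prop a b θ l (specProj a b l η v) =
      Complex.exp (-(Complex.I * θ * (sgn η * om a b l : ℝ))) • specProj a b l η v := by
  simp only [prop, sum_apply, smul_apply, specProj_specProj]
  simp

theorem prop_prop (θ θ' : ℝ) (v : Spinor) :
    prop a b θ l (prop a b θ' l v) = prop a b (θ + θ') l v := by
  conv_lhs => rw [prop]
  conv_rhs => rw [prop]
  simp only [sum_apply, smul_apply, specProj_prop, smul_smul,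
    ← Complex.exp_add]
  refine Finset.sum_congr rfl fun η _ => ?_
  congr 2; push_cast; ring

@[simp] theorem prop_zero (v : Spinor) : prop a b 0 l v = v := by
  simp only [prop, sum_apply, smul_apply]
  simpa using specProj_add (a := a) (b := b) (l := l) v

/-- The norm on spinors is the sup norm, for which the propagator is not isometric; each of the two
projections contributes 2. The factor 4 must not be iterated over time steps, which is one reason
for arguing in interaction variables. -/
theorem norm_prop_le (θ : ℝ) (v : Spinor) : ‖prop a b θ l v‖ ≤ 4 * ‖v‖ := by
  simp only [prop, sum_apply, smul_apply]
  have h : ∀ η : Bool, ‖Complex.exp (-(Complex.I * θ * (sgn η * om a b l : ℝ))) •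
      specProj a b l η v‖ ≤ 2 * ‖v‖ := by
    intro η
    rw [norm_smul, show -(Complex.I * θ * (sgn η * om a b l : ℝ)) =
      ((-(θ * (sgn η * om a b l)) : ℝ) : ℂ) * Complex.I by push_cast; ring,
      Complex.norm_exp_ofReal_mul_I, one_mul]
    exact norm_specProj_le η v
  refine (norm_sum_le_of_le _ fun η _ => h η).trans (le_of_eq ?_)
  simp; ring

theorem Gam_specProj (η : Bool) (v : Spinor) :
    Matrix.mulVec (Gam a b l) (specProj a b l η v) =
      ((sgn η * om a b l : ℝ) : ℂ) • specProj a b l η v := by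
  have h0 : (om a b l : ℂ) ≠ 0 := by exact_mod_cast (om_pos a b l).ne'
  simp only [specProj_apply, Matrix.mulVec_smul, Matrix.mulVec_add, Gam_Gam, smul_add, smul_smul]
  push_cast
  have hs : (sgn η : ℂ) * sgn η = 1 := by cases η <;> simp [sgn]
  have e1 : (1 / 2 : ℂ) * (sgn η / om a b l) * om a b l ^ 2 = sgn η * om a b l * (1 / 2) := by
    field_simp
  have e2 : (sgn η : ℂ) * om a b l * (1 / 2 * (sgn η / om a b l)) = 1 / 2 := by
    field_simp; rw [sq, hs]
  rw [e1, e2]; abel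

end dirac

/-! ### Resonances and cubic interactions with an oscillatory kernel. -/

/-- The resonance function `±ω_l ∓ ω_p ± ω_q ∓ ω_r` with `r = l - p + q`. -/
noncomputable def phase (a b : ℝ) (l : ℤ) (i : ℤ × ℤ) (η : Bool × Bool × Bool × Bool) : ℝ :=
  sgn η.1 * om a b l - sgn η.2.1 * om a b i.1 + sgn η.2.2.1 * om a b i.2
    - sgn η.2.2.2 * om a b (l - i.1 + i.2)

/-- One branch of a triple interaction, without the kernel. -/
noncomputable def branch (a b lam1 lam2 : ℝ) (u : ℤ → Spinor) (l : ℤ) (i : ℤ × ℤ)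
    (η : Bool × Bool × Bool × Bool) : Spinor :=
  specProj a b l η.1 (triForm lam1 lam2 (specProj a b i.1 η.2.1 (u i.1))
    (specProj a b i.2 η.2.2.1 (u i.2))
    (specProj a b (l - i.1 + i.2) η.2.2.2 (u (l - i.1 + i.2))))

/-- A triple interaction with kernel `K` evaluated at the resonance function. -/
noncomputable def interaction (a b lam1 lam2 : ℝ) (K : ℝ → ℂ) (u : ℤ → Spinor) (l : ℤ)
    (i : ℤ × ℤ) : Spinor :=
  ∑ η, K (phase a b l i η) • branch a b lam1 lam2 u l i η

/-- The cubic nonlinearity on the Fourier side, with kernel `K`. -/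
noncomputable def cubic (a b lam1 lam2 : ℝ) (K : ℝ → ℂ) (u : ℤ → Spinor) (l : ℤ) : Spinor :=
  ∑' i, interaction a b lam1 lam2 K u l i

/-- `|K(δ)| ≤ B x^j` whenever `|δ| ≤ 2x` and `x ≥ 1`. -/
def KernelBound (K : ℝ → ℂ) (B : ℝ≥0∞) (j : ℕ) : Prop :=
  ∀ δ x : ℝ, 1 ≤ x → |δ| ≤ 2 * x → ‖K δ‖ₑ ≤ B * ENNReal.ofReal x ^ j

section cubic
variable {a b lam1 lam2 : ℝ} {K K' : ℝ → ℂ} {u v : ℤ → Spinor} {B R : ℝ≥0∞} {j k n : ℕ}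

/-- The output weight ω_l is absorbed by the three input weights; this is the origin of the 2 in
`KernelBound`. -/
theorem abs_phase_le (l : ℤ) (i : ℤ × ℤ) (η : Bool × Bool × Bool × Bool) :
    |phase a b l i η| ≤ 2 * (om a b i.1 + om a b i.2 + om a b (l - i.1 + i.2)) := by
  have h : ∀ (η : Bool) (l : ℤ), |sgn η * om a b l| = om a b l := fun η l => by
    rw [abs_mul, abs_sgn, one_mul, abs_of_pos (om_pos a b l)]
  have h1 := om_tri a b l i.1 i.2
  unfold phase
  have h2 := abs_sub (sgn η.1 * om a b l - sgn η.2.1 * om a b i.1 + sgn η.2.2.1 * om a b i.2)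
    (sgn η.2.2.2 * om a b (l - i.1 + i.2))
  have h3 := abs_add_le (sgn η.1 * om a b l - sgn η.2.1 * om a b i.1) (sgn η.2.2.1 * om a b i.2)
  have h4 := abs_sub (sgn η.1 * om a b l) (sgn η.2.1 * om a b i.1)
  simp only [h] at h2 h3 h4
  linarith

theorem KernelBound.enorm_phase_le (hK : KernelBound K B j) (l : ℤ) (i : ℤ × ℤ)
    (η : Bool × Bool × Bool × Bool) : ‖K (phase a b l i η)‖ₑ ≤ B * wt3 a b l i ^ j := by
  refine (hK _ (om a b i.1 + om a b i.2 + om a b (l - i.1 + i.2)) ?_ (abs_phase_le l i η)).trans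
    (le_of_eq ?_)
  · linarith [one_le_om a b i.1, om_pos a b i.2, om_pos a b (l - i.1 + i.2)]
  · rw [ENNReal.ofReal_add (by linarith [om_pos a b i.1, om_pos a b i.2]) (om_pos a b _).le,
      ENNReal.ofReal_add (om_pos a b _).le (om_pos a b _).le]
    rfl

theorem norm_branch_sub_le (u v : ℤ → Spinor) (l : ℤ) (i : ℤ × ℤ)
    (η : Bool × Bool × Bool × Bool) :
    ‖branch a b lam1 lam2 u l i η - branch a b lam1 lam2 v l i η‖ ≤ 16 * formC lam1 lam2 *
      (‖(u - v) i.1‖ * ‖u i.2‖ * ‖u (l - i.1 + i.2)‖ +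
        ‖v i.1‖ * ‖(u - v) i.2‖ * ‖u (l - i.1 + i.2)‖ +
        ‖v i.1‖ * ‖v i.2‖ * ‖(u - v) (l - i.1 + i.2)‖) := by
  unfold branch
  rw [← map_sub]
  have hC := formC_nonneg (lam1 := lam1) (lam2 := lam2)
  refine (norm_specProj_le _ _).trans ?_
  refine (mul_le_mul_of_nonneg_left (norm_triForm_sub_le _ _ _ _ _ _) zero_le_two).trans ?_
  simp only [← map_sub]
  have h := fun (l : ℤ) (η : Bool) (v : Spinor) => norm_specProj_le (a := a) (b := b) (l := l) η v
  calc _ ≤ 2 * (formC lam1 lam2 *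
      ((2 * ‖(u - v) i.1‖) * (2 * ‖u i.2‖) * (2 * ‖u (l - i.1 + i.2)‖) +
        (2 * ‖v i.1‖) * (2 * ‖(u - v) i.2‖) * (2 * ‖u (l - i.1 + i.2)‖) +
        (2 * ‖v i.1‖) * (2 * ‖v i.2‖) * (2 * ‖(u - v) (l - i.1 + i.2)‖))) := by
        gcongr <;> exact h _ _ _
    _ = _ := by ring

/-- The increments entering the local Lipschitz bound. -/
noncomputable def tripleInc (u v : ℤ → Spinor) (l : ℤ) (i : ℤ × ℤ) : ℝ≥0∞ :=
  ‖(u - v) i.1‖ₑ * ‖u i.2‖ₑ * ‖u (l - i.1 + i.2)‖ₑ +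
    ‖v i.1‖ₑ * ‖(u - v) i.2‖ₑ * ‖u (l - i.1 + i.2)‖ₑ +
    ‖v i.1‖ₑ * ‖v i.2‖ₑ * ‖(u - v) (l - i.1 + i.2)‖ₑ

/-- The constant in the pointwise bound of an interaction. -/
noncomputable def branchC (lam1 lam2 : ℝ) : ℝ≥0∞ := 16 * ENNReal.ofReal (16 * formC lam1 lam2)

theorem branchC_ne_top : branchC lam1 lam2 ≠ ∞ :=
  ENNReal.mul_ne_top (by simp) ENNReal.ofReal_ne_top

theorem enorm_interaction_sub_le (hK : KernelBound K B j) (u v : ℤ → Spinor) (l : ℤ)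
    (i : ℤ × ℤ) :
    ‖interaction a b lam1 lam2 K u l i - interaction a b lam1 lam2 K v l i‖ₑ ≤
      branchC lam1 lam2 * B * (wt3 a b l i ^ j * tripleInc u v l i) := by
  unfold interaction
  rw [← Finset.sum_sub_distrib]
  have h : ∀ η, ‖K (phase a b l i η) • branch a b lam1 lam2 u l i η -
      K (phase a b l i η) • branch a b lam1 lam2 v l i η‖ₑ ≤
      (B * wt3 a b l i ^ j) * (ENNReal.ofReal (16 * formC lam1 lam2) * tripleInc u v l i) := by
    intro η
    rw [← smul_sub, enorm_smul]
    refine mul_le_mul' (hK.enorm_phase_le l i η) ?_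
    rw [← ofReal_norm]
    refine (ENNReal.ofReal_le_ofReal (norm_branch_sub_le u v l i η)).trans (le_of_eq ?_)
    have hC := formC_nonneg (lam1 := lam1) (lam2 := lam2)
    rw [ENNReal.ofReal_mul (by positivity), ENNReal.ofReal_add (by positivity) (by positivity),
      ENNReal.ofReal_add (by positivity) (by positivity)]
    simp only [ENNReal.ofReal_mul (norm_nonneg _), ENNReal.ofReal_mul
      (mul_nonneg (norm_nonneg _) (norm_nonneg _)), ofReal_norm]
    rfl
  refine (enorm_sum_le _ _).trans ((Finset.sum_le_sum fun η _ => h η).trans (le_of_eq ?_))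
  rw [Finset.sum_const, Finset.card_univ, branchC]
  simp only [Fintype.card_prod, Fintype.card_bool, nsmul_eq_mul]
  push_cast; ring

theorem ltwo_tripleInc_le (hn : j + k = n) (hn1 : 1 ≤ n) (hu : nrm a b n u ≤ R)
    (hv : nrm a b n v ≤ R) :
    (ltwo fun l => wt a b l ^ k * ∑' i, wt3 a b l i ^ j * tripleInc u v l i) ≤
      triC a b n * (3 * R ^ 2) * nrm a b n (u - v) := by
  have h1 := ltwo_trilinear_le (a := a) (b := b) j k n hn hn1
  have e : ∀ l, wt a b l ^ k * ∑' i, wt3 a b l i ^ j * tripleInc u v l i =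
    wt a b l ^ k * (∑' i : ℤ × ℤ, wt3 a b l i ^ j *
      (‖(u - v) i.1‖ₑ * ‖u i.2‖ₑ * ‖u (l - i.1 + i.2)‖ₑ)) +
    wt a b l ^ k * (∑' i : ℤ × ℤ, wt3 a b l i ^ j *
      (‖v i.1‖ₑ * ‖(u - v) i.2‖ₑ * ‖u (l - i.1 + i.2)‖ₑ)) +
    wt a b l ^ k * (∑' i : ℤ × ℤ, wt3 a b l i ^ j *
      (‖v i.1‖ₑ * ‖v i.2‖ₑ * ‖(u - v) (l - i.1 + i.2)‖ₑ)) := by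
    intro l
    rw [← mul_add, ← mul_add, ← ENNReal.tsum_add, ← ENNReal.tsum_add]
    simp_rw [← mul_add]; rfl
  simp_rw [e]
  refine (ltwo_add_le _ _).trans ((add_le_add ((ltwo_add_le _ _).trans (add_le_add
    (h1 (fun l => ‖(u - v) l‖ₑ) (fun l => ‖u l‖ₑ) (fun l => ‖u l‖ₑ))
    (h1 (fun l => ‖v l‖ₑ) (fun l => ‖(u - v) l‖ₑ) (fun l => ‖u l‖ₑ))))
    (h1 (fun l => ‖v l‖ₑ) (fun l => ‖v l‖ₑ) (fun l => ‖(u - v) l‖ₑ))).trans ?_)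
  change triC a b n * (nrm a b n (u - v) * nrm a b n u * nrm a b n u) +
    triC a b n * (nrm a b n v * nrm a b n (u - v) * nrm a b n u) +
    triC a b n * (nrm a b n v * nrm a b n v * nrm a b n (u - v)) ≤ _
  calc _ ≤ triC a b n * (nrm a b n (u - v) * R * R) + triC a b n * (R * nrm a b n (u - v) * R) +
    triC a b n * (R * R * nrm a b n (u - v)) := by gcongr
    _ = _ := by ring

theorem interaction_zero (l : ℤ) (i : ℤ × ℤ) : interaction a b lam1 lam2 K 0 l i = 0 := by
  have h : triForm lam1 lam2 0 0 0 = 0 := by ext i; simp [triForm]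
  unfold interaction branch
  simp [h]

@[simp] theorem cubic_zero : cubic a b lam1 lam2 K 0 = 0 := by
  ext1 l; unfold cubic; simp [interaction_zero]

theorem tsum_enorm_interaction_ne_top (hab : a < b) (hK : KernelBound K B j) (hB : B ≠ ∞)
    (hjn : j ≤ n) (hn1 : 1 ≤ n) (hu : nrm a b n u ≠ ∞) (l : ℤ) :
    ∑' i, ‖interaction a b lam1 lam2 K u l i‖ₑ ≠ ∞ := by
  obtain ⟨k, rfl⟩ := Nat.exists_eq_add_of_le hjn
  have h1 := ltwo_tripleInc_le (a := a) (b := b) (j := j) (k := k) (u := u) (v := 0) rfl hn1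
    (R := nrm a b (j + k) u) le_rfl (by simp)
  have h2 : ∑' i, wt3 a b l i ^ j * tripleInc u 0 l i ≠ ∞ := by
    have h : wt a b l ^ k * ∑' i, wt3 a b l i ^ j * tripleInc u 0 l i ≠ ∞ := by
      refine ne_top_of_le_ne_top ?_ ((le_ltwo _ l).trans h1)
      rw [sub_zero]
      exact ENNReal.mul_ne_top (ENNReal.mul_ne_top (triC_ne_top hab _)
        (ENNReal.mul_ne_top (by simp) (ENNReal.pow_ne_top hu))) hu
    intro h'
    rw [h', ENNReal.mul_top (pow_ne_zero _ (wt_ne_zero a b l))] at h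
    exact h rfl
  have h3 : ∀ i, ‖interaction a b lam1 lam2 K u l i‖ₑ ≤
      branchC lam1 lam2 * B * (wt3 a b l i ^ j * tripleInc u 0 l i) := fun i => by
    simpa [interaction_zero] using enorm_interaction_sub_le (lam1 := lam1) (lam2 := lam2)
      (a := a) (b := b) hK u 0 l i
  refine ne_top_of_le_ne_top ?_ (ENNReal.tsum_le_tsum h3)
  rw [ENNReal.tsum_mul_left]
  exact ENNReal.mul_ne_top (ENNReal.mul_ne_top branchC_ne_top hB) h2

theorem summable_norm_interaction (hab : a < b) (hK : KernelBound K B j) (hB : B ≠ ∞)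
    (hjn : j ≤ n) (hn1 : 1 ≤ n) (hu : nrm a b n u ≠ ∞) (l : ℤ) :
    Summable fun i => ‖interaction a b lam1 lam2 K u l i‖ := by
  simpa using ENNReal.summable_toReal
    (tsum_enorm_interaction_ne_top (lam1 := lam1) (lam2 := lam2) hab hK hB hjn hn1 hu l)

theorem summable_interaction (hab : a < b) (hK : KernelBound K B j) (hB : B ≠ ∞)
    (hjn : j ≤ n) (hn1 : 1 ≤ n) (hu : nrm a b n u ≠ ∞) (l : ℤ) :
    Summable fun i => interaction a b lam1 lam2 K u l i :=
  (summable_norm_interaction hab hK hB hjn hn1 hu l).of_norm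

/-- The constant in the bounds of the cubic nonlinearity on `H^n`. -/
noncomputable def cubicC (a b lam1 lam2 : ℝ) (n : ℕ) : ℝ≥0∞ :=
  branchC lam1 lam2 * (triC a b n * 3)

theorem cubicC_ne_top (hab : a < b) : cubicC a b lam1 lam2 n ≠ ∞ :=
  ENNReal.mul_ne_top branchC_ne_top (ENNReal.mul_ne_top (triC_ne_top hab n) (by simp))

/-- The trilinear estimate with kernel: growth of order j in the resonance function is exchanged for
j derivatives, from H^n to H^k, and the constant B is kept explicit because all the smallness later
sits in it. -/
theorem nrm_cubic_sub_le (hab : a < b) (hK : KernelBound K B j) (hB : B ≠ ∞) (hn : j + k = n)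
    (hn1 : 1 ≤ n) (hR : R ≠ ∞) (hu : nrm a b n u ≤ R) (hv : nrm a b n v ≤ R) :
    nrm a b k (cubic a b lam1 lam2 K u - cubic a b lam1 lam2 K v) ≤
      cubicC a b lam1 lam2 n * B * R ^ 2 * nrm a b n (u - v) := by
  have hjn : j ≤ n := by omega
  have h1 : ∀ l, ‖(cubic a b lam1 lam2 K u - cubic a b lam1 lam2 K v) l‖ₑ ≤
      branchC lam1 lam2 * B * ∑' i, wt3 a b l i ^ j * tripleInc u v l i := by
    intro l
    have hs := fun u hu => summable_interaction (lam1 := lam1) (lam2 := lam2) (u := u)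
      hab hK hB hjn hn1 (ne_top_of_le_ne_top hR hu) l
    simp only [Pi.sub_apply, cubic]
    rw [← (hs u hu).tsum_sub (hs v hv), ← ENNReal.tsum_mul_left]
    exact enorm_tsum_le_tsum_enorm.trans
      (ENNReal.tsum_le_tsum fun i => enorm_interaction_sub_le hK u v l i)
  calc _ ≤ ltwo fun l => branchC lam1 lam2 * B *
          (wt a b l ^ k * ∑' i, wt3 a b l i ^ j * tripleInc u v l i) := by
        refine ltwo_mono fun l => ?_
        calc _ ≤ wt a b l ^ k * _ := mul_le_mul_right (h1 l) _
          _ = _ := by ring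
    _ ≤ _ := by
        rw [ltwo_const_mul]
        refine (mul_le_mul_right (ltwo_tripleInc_le hn hn1 hu hv) _).trans (le_of_eq ?_)
        unfold cubicC; ring

theorem nrm_cubic_le (hab : a < b) (hK : KernelBound K B j) (hB : B ≠ ∞) (hn : j + k = n)
    (hn1 : 1 ≤ n) (hR : R ≠ ∞) (hu : nrm a b n u ≤ R) :
    nrm a b k (cubic a b lam1 lam2 K u) ≤ cubicC a b lam1 lam2 n * B * R ^ 3 := by
  have h := nrm_cubic_sub_le (lam1 := lam1) (lam2 := lam2) (v := 0) hab hK hB hn hn1 hR hu (by simp)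
  rw [cubic_zero, sub_zero, sub_zero] at h
  refine h.trans ?_
  calc _ ≤ cubicC a b lam1 lam2 n * B * R ^ 2 * R := by gcongr
    _ = _ := by ring

theorem cubic_sub_kernel (hab : a < b) {B' : ℝ≥0∞} (hK : KernelBound K B 0) (hB : B ≠ ∞)
    (hK' : KernelBound K' B' 0) (hB' : B' ≠ ∞) (hu : nrm a b 1 u ≠ ∞) :
    cubic a b lam1 lam2 (K - K') u = cubic a b lam1 lam2 K u - cubic a b lam1 lam2 K' u := by
  ext1 l
  have h1 := summable_interaction (lam1 := lam1) (lam2 := lam2) hab hK hB (Nat.zero_le 1) le_rfl hu l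
  have h2 := summable_interaction (lam1 := lam1) (lam2 := lam2) hab hK' hB' (Nat.zero_le 1) le_rfl hu l
  simp only [Pi.sub_apply, cubic]
  rw [← h1.tsum_sub h2]
  congr 1; ext1 i
  simp only [interaction, Pi.sub_apply, sub_smul, Finset.sum_sub_distrib]

theorem kernelBound_of_le {c : ℝ≥0∞} (h : ∀ δ, ‖K δ‖ₑ ≤ c) : KernelBound K c 0 :=
  fun δ x _ _ => by simpa using h δ

/-- The oscillatory kernel `e^{itδ}`. -/
noncomputable def expKernel (t : ℝ) : ℝ → ℂ := fun δ => Complex.exp (Complex.I * t * δ)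

theorem norm_expKernel (t δ : ℝ) : ‖expKernel t δ‖ = 1 := by
  rw [expKernel, show Complex.I * t * δ = ((t * δ : ℝ) : ℂ) * Complex.I by push_cast; ring,
    Complex.norm_exp_ofReal_mul_I]

theorem kernelBound_expKernel (t : ℝ) : KernelBound (expKernel t) 1 0 :=
  kernelBound_of_le fun δ => by rw [← ofReal_norm, norm_expKernel]; simp

/-- From |e^{ix} - 1| ≤ |x|: shifting the time in the oscillation by |t - t'| costs one derivative.
-/
theorem kernelBound_expKernel_sub (t t' : ℝ) :
    KernelBound (expKernel t - expKernel t') (ENNReal.ofReal (2 * |t - t'|)) 1 := by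
  intro δ x hx hδ
  rw [pow_one, ← ENNReal.ofReal_mul (by positivity), ← ofReal_norm]
  refine ENNReal.ofReal_le_ofReal ?_
  have h : (expKernel t - expKernel t') δ = expKernel t' δ *
      (Complex.exp (Complex.I * ((t - t') * δ : ℝ)) - 1) := by
    simp only [Pi.sub_apply, expKernel, mul_sub, mul_one, ← Complex.exp_add]
    congr 2; push_cast; ring
  rw [h, norm_mul, norm_expKernel, one_mul]
  refine Real.norm_exp_I_mul_ofReal_sub_one_le.trans ?_
  rw [Real.norm_eq_abs, abs_mul]
  nlinarith [abs_nonneg (t - t')]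

/-- The propagator acting on sequences. -/
noncomputable def propSeq (a b θ : ℝ) (u : ℤ → Spinor) : ℤ → Spinor := fun l => prop a b θ l (u l)

theorem propSeq_propSeq (θ θ' : ℝ) : propSeq a b θ (propSeq a b θ' u) = propSeq a b (θ + θ') u := by
  ext1 l; exact prop_prop θ θ' (u l)

@[simp] theorem propSeq_zero : propSeq a b 0 u = u := by
  ext1 l; exact prop_zero (u l)

theorem propSeq_sub (θ : ℝ) : propSeq a b θ (u - v) = propSeq a b θ u - propSeq a b θ v := by
  ext1 l; exact map_sub _ _ _

theorem nrm_propSeq_le (θ : ℝ) (u : ℤ → Spinor) :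
    nrm a b k (propSeq a b θ u) ≤ 4 * nrm a b k u := by
  refine nrm_le_mul 4 fun l => ?_
  have h := norm_prop_le (a := a) (b := b) (l := l) θ (u l)
  rw [← ofReal_norm, ← ofReal_norm]
  refine (ENNReal.ofReal_le_ofReal h).trans (le_of_eq ?_)
  rw [ENNReal.ofReal_mul (by norm_num)]; simp

/-- On a fixed branch every propagator is a scalar phase. Sesquilinearity conjugates the phase of
the second factor, and the four exponents add up to the resonance function. -/
theorem branch_propSeq (t : ℝ) (l : ℤ) (i : ℤ × ℤ) (η : Bool × Bool × Bool × Bool) :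
    prop a b (-t) l (branch a b lam1 lam2 (propSeq a b t u) l i η) =
      expKernel t (phase a b l i η) • branch a b lam1 lam2 u l i η := by
  unfold branch
  rw [prop_specProj]
  simp only [propSeq, specProj_prop, triForm_smul, map_smul, smul_smul, ← Complex.exp_conj,
    expKernel, phase, ← Complex.exp_add]
  congr 2
  simp only [map_neg, map_mul, Complex.conj_I, Complex.conj_ofReal]
  push_cast; ring

theorem propSeq_cubic_propSeq (hab : a < b) (t : ℝ) (hu : nrm a b 1 u ≠ ∞) :
    propSeq a b (-t) (cubic a b lam1 lam2 1 (propSeq a b t u)) =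
      cubic a b lam1 lam2 (expKernel t) u := by
  ext1 l
  have h1 : KernelBound 1 1 0 := kernelBound_of_le fun δ => by simp
  have h2 : nrm a b 1 (propSeq a b t u) ≠ ∞ :=
    ne_top_of_le_ne_top (ENNReal.mul_ne_top (by simp) hu) (nrm_propSeq_le t u)
  have h3 := summable_interaction (lam1 := lam1) (lam2 := lam2) hab h1 ENNReal.one_ne_top
    (Nat.zero_le 1) le_rfl h2 l
  simp only [propSeq, cubic]
  rw [ContinuousLinearMap.map_tsum _ h3]
  congr 1; ext1 i
  simp only [interaction, map_sum, Pi.one_apply, one_smul]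
  exact Finset.sum_congr rfl fun η _ => branch_propSeq t l i η

/-- With constant kernel the sum over branches undoes all four spectral decompositions, leaving the
plain convolution. -/
theorem cubic_one (u : ℤ → Spinor) (l : ℤ) :
    cubic a b lam1 lam2 1 u l =
      ∑' i : ℤ × ℤ, triForm lam1 lam2 (u i.1) (u i.2) (u (l - i.1 + i.2)) := by
  unfold cubic
  congr 1; ext1 i
  simp only [interaction, branch, Pi.one_apply, one_smul, Fintype.sum_prod_type, ← map_sum,
    specProj_add]
  have h1 : ∀ (η : Bool → Spinor) (v w : Spinor), ∑ i, triForm lam1 lam2 (η i) v w =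
      triForm lam1 lam2 (∑ i, η i) v w := fun η v w => by
    simp only [Fintype.sum_bool, triForm_add₁]
  have h2 : ∀ (η : Bool → Spinor) (v w : Spinor), ∑ i, triForm lam1 lam2 v (η i) w =
      triForm lam1 lam2 v (∑ i, η i) w := fun η v w => by
    simp only [Fintype.sum_bool, triForm_add₂]
  have h3 : ∀ (η : Bool → Spinor) (v w : Spinor), ∑ i, triForm lam1 lam2 v w (η i) =
      triForm lam1 lam2 v w (∑ i, η i) := fun η v w => by
    simp only [Fintype.sum_bool, triForm_add₃]
  simp only [h3, h2, h1, specProj_add]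

theorem norm_branch_le (u : ℤ → Spinor) (l : ℤ) (i : ℤ × ℤ) (η : Bool × Bool × Bool × Bool) :
    ‖branch a b lam1 lam2 u l i η‖ ≤
      16 * formC lam1 lam2 * (‖u i.1‖ * ‖u i.2‖ * ‖u (l - i.1 + i.2)‖) := by
  have h := norm_branch_sub_le (a := a) (b := b) (lam1 := lam1) (lam2 := lam2) u 0 l i η
  have h0 : branch a b lam1 lam2 0 l i η = 0 := by
    have : triForm lam1 lam2 0 0 0 = 0 := by ext i; simp [triForm]
    unfold branch; simp [this]
  simpa [h0] using h

theorem summable_triple (hu : Summable fun l => ‖u l‖) (l : ℤ) :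
    Summable fun i : ℤ × ℤ => ‖u i.1‖ * ‖u i.2‖ * ‖u (l - i.1 + i.2)‖ := by
  have h := (hu.mul_of_nonneg hu (fun _ => norm_nonneg _) (fun _ => norm_nonneg _)).mul_right
    (∑' l, ‖u l‖)
  refine Summable.of_nonneg_of_le (fun i => by positivity) (fun i => ?_) h
  gcongr
  exact hu.le_tsum _ fun _ _ => norm_nonneg _

theorem norm_interaction_le {c : ℝ} {l : ℤ} {i : ℤ × ℤ} (hK : ∀ δ, ‖K δ‖ ≤ c) :
    ‖interaction a b lam1 lam2 K u l i‖ ≤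
      16 * (c * (16 * formC lam1 lam2 * (‖u i.1‖ * ‖u i.2‖ * ‖u (l - i.1 + i.2)‖))) := by
  unfold interaction
  have hc : 0 ≤ c := (norm_nonneg _).trans (hK 0)
  have h : ∀ η, ‖K (phase a b l i η) • branch a b lam1 lam2 u l i η‖ ≤
      c * (16 * formC lam1 lam2 * (‖u i.1‖ * ‖u i.2‖ * ‖u (l - i.1 + i.2)‖)) := fun η => by
    rw [norm_smul]; gcongr
    · exact hK _
    · exact norm_branch_le u l i η
  refine (norm_sum_le_of_le _ fun η _ => h η).trans (le_of_eq ?_)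
  rw [Finset.sum_const, Finset.card_univ]
  simp only [Fintype.card_prod, Fintype.card_bool, nsmul_eq_mul]
  push_cast; ring

theorem continuous_cubic {K : ℝ → ℝ → ℂ} {c : ℝ} (hc : ∀ δ, Continuous fun ρ => K ρ δ)
    (hK : ∀ ρ δ, ‖K ρ δ‖ ≤ c) (hu : Summable fun l => ‖u l‖) (l : ℤ) :
    Continuous fun ρ => cubic a b lam1 lam2 (K ρ) u l := by
  refine continuous_tsum (fun i => ?_)
    (((summable_triple hu l).mul_left (16 * formC lam1 lam2)).mul_left c |>.mul_left 16)
    fun i ρ => norm_interaction_le (hK ρ)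
  exact continuous_finsetSum _ fun η _ => (hc _).smul continuous_const

/-- Time integration moves onto the kernel by dominated convergence; this is how the quadrature
error becomes a kernel. -/
theorem integral_cubic {K : ℝ → ℝ → ℂ} {c : ℝ} (hc : ∀ δ, Continuous fun ρ => K ρ δ)
    (hK : ∀ ρ δ, ‖K ρ δ‖ ≤ c) (hu : Summable fun l => ‖u l‖) (l : ℤ) (s t : ℝ) :
    ∫ ρ in s..t, cubic a b lam1 lam2 (K ρ) u l =
      cubic a b lam1 lam2 (fun δ => ∫ ρ in s..t, K ρ δ) u l := by
  have hs := ((summable_triple hu l).mul_left (16 * formC lam1 lam2)).mul_left c |>.mul_left 16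
  have hcont : ∀ i, Continuous fun ρ => interaction a b lam1 lam2 (K ρ) u l i := fun i =>
    continuous_finsetSum _ fun η _ => (hc _).smul continuous_const
  have h := intervalIntegral.hasSum_integral_of_dominated_convergence (μ := volume) (a := s) (b := t)
    (F := fun i ρ => interaction a b lam1 lam2 (K ρ) u l i)
    (f := fun ρ => cubic a b lam1 lam2 (K ρ) u l)
    (fun i _ => 16 * (c * (16 * formC lam1 lam2 * (‖u i.1‖ * ‖u i.2‖ * ‖u (l - i.1 + i.2)‖))))
    (fun i => (hcont i).aestronglyMeasurable)
    (fun i => ae_of_all _ fun ρ _ => norm_interaction_le (hK ρ))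
    (ae_of_all _ fun ρ _ => hs) intervalIntegrable_const
    (ae_of_all _ fun ρ _ => (Summable.of_norm_bounded hs fun i =>
      norm_interaction_le (hK ρ)).hasSum)
  rw [← h.tsum_eq]
  unfold cubic
  congr 1; ext1 i
  simp only [interaction]
  have h2 := intervalIntegral.integral_finsetSum (μ := volume) (a := s) (b := t) (s := Finset.univ)
    (f := fun η ρ => K ρ (phase a b l i η) • branch a b lam1 lam2 u l i η)
    fun η _ => ((hc _).smul continuous_const).intervalIntegrable _ _
  rw [h2]
  exact Finset.sum_congr rfl fun η _ => intervalIntegral.integral_smul_const _ _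

end cubic

/-! ### Fourier coefficients of continuous functions on the circle. -/

open AddCircle

section circle
variable {L : ℝ} [hL : Fact (0 < L)]

/-- The Fourier coefficient functional on continuous periodic functions. -/
noncomputable def coefL (l : ℤ) : C(AddCircle L, ℂ) →L[ℂ] ℂ :=
  LinearMap.mkContinuous
    { toFun := fun x => fourierCoeff x l
      map_add' := fun x y => by
        rw [ContinuousMap.coe_add, fourierCoeff.add (x.continuous.integrable_of_hasCompactSupport
          (HasCompactSupport.of_compactSpace _)) (y.continuous.integrable_of_hasCompactSupport
          (HasCompactSupport.of_compactSpace _))]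
        rfl
      map_smul' := fun c x => fourierCoeff.const_smul x c l } 1 (fun x => by
    have h : ‖fourierCoeff x l‖ ≤ ‖x‖ * (haarAddCircle (T := L)).real Set.univ := by
      refine norm_integral_le_of_norm_le_const (ae_of_all _ fun t => ?_)
      rw [norm_smul, fourier_apply, Circle.norm_coe, one_mul]
      exact x.norm_coe_le_norm t
    simpa using h)

theorem coefL_apply (l : ℤ) (x : C(AddCircle L, ℂ)) : coefL l x = fourierCoeff x l := rfl

/-- The sequence of Fourier coefficients. -/
noncomputable def coef (x : C(AddCircle L, ℂ)) (l : ℤ) : ℂ := coefL l x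

/-- The Fourier series with given coefficients. -/
noncomputable def synth (L : ℝ) [Fact (0 < L)] (c : ℤ → ℂ) : C(AddCircle L, ℂ) :=
  ∑' l, c l • fourier l

theorem summable_synth {c : ℤ → ℂ} (hc : Summable fun l => ‖c l‖) :
    Summable fun l => c l • (fourier l : C(AddCircle L, ℂ)) := by
  refine Summable.of_norm ?_
  simpa only [norm_smul, fourier_norm, mul_one] using hc

theorem coef_fourier (l n : ℤ) : coef (fourier l : C(AddCircle L, ℂ)) n = if n = l then 1 else 0 := by
  rw [coef, coefL_apply, fourierCoeff_fourier, Pi.single_apply]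

theorem coef_synth {c : ℤ → ℂ} (hc : Summable fun l => ‖c l‖) : coef (synth L c) = c := by
  ext n
  have h := (coefL (L := L) n).map_tsum (summable_synth hc)
  rw [coef, synth, h]
  simp only [map_smul, smul_eq_mul]
  rw [tsum_eq_single n]
  · have := coef_fourier (L := L) n n
    rw [coef] at this; simp [this]
  · intro l hl
    have := coef_fourier (L := L) l n
    rw [coef] at this; simp [this, hl.symm]

theorem synth_coef {x : C(AddCircle L, ℂ)} (hx : Summable fun l => ‖coef x l‖) :
    synth L (coef x) = x :=
  (hasSum_fourier_series_of_summable (f := x) hx.of_norm).tsum_eq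

theorem coef_fourier_mul (p l : ℤ) (y : C(AddCircle L, ℂ)) :
    coef (fourier p * y) l = coef y (l - p) := by
  simp only [coef, coefL_apply, fourierCoeff]
  congr 1; ext t
  rw [ContinuousMap.mul_apply, smul_eq_mul, smul_eq_mul, ← mul_assoc, ← fourier_add]
  congr 2; ring_nf

/-- Only x needs a summable series: it is expanded, and multiplication by a character just shifts
the coefficients of y. -/
theorem coef_mul {x : C(AddCircle L, ℂ)} (hx : Summable fun l => ‖coef x l‖)
    (y : C(AddCircle L, ℂ)) (l : ℤ) : coef (x * y) l = ∑' p, coef x p * coef y (l - p) := by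
  have h1 := (hasSum_fourier_series_of_summable (f := x) hx.of_norm).mul_right y
  have h2 := ((coefL l).hasSum h1).tsum_eq
  rw [coef, ← h2]
  congr 1; ext p
  rw [smul_mul_assoc, map_smul, ← coef_fourier_mul]; rfl

theorem coef_star (x : C(AddCircle L, ℂ)) (l : ℤ) : coef (star x) l = conj (coef x (-l)) := by
  simp only [coef, coefL_apply, fourierCoeff]
  rw [← integral_conj]
  congr 1; ext t
  rw [smul_eq_mul, smul_eq_mul, map_mul, ← fourier_neg, neg_neg,
    ContinuousMap.star_apply]
  rfl

end circle

/-! ### Algebra property of H^k and the exponential. -/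

section product
variable {L : ℝ} [hL : Fact (0 < L)] {a b : ℝ} {k : ℕ}

theorem wt_add_le (a b : ℝ) (l p : ℤ) : wt a b l ≤ wt a b p + wt a b (l - p) := by
  unfold wt
  rw [← ENNReal.ofReal_add (om_pos a b _).le (om_pos a b _).le]
  refine ENNReal.ofReal_le_ofReal ?_
  have := om_add_le a b p (l - p)
  rwa [add_sub_cancel] at this

theorem add_pow_le_three (x y : ℝ≥0∞) (n : ℕ) (hn : n ≠ 0) :
    (x + y) ^ n ≤ 3 ^ n * (x ^ n + y ^ n) := by
  simpa [hn] using add_add_pow_le x y 0 n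

theorem ltwo_bilinear_le (hk : 1 ≤ k) (α β : ℤ → ℝ≥0∞) :
    (ltwo fun l => wt a b l ^ k * ∑' p, α p * β (l - p)) ≤ 3 ^ k * (2 * embC a b) *
      ((ltwo fun l => wt a b l ^ k * α l) * (ltwo fun l => wt a b l ^ k * β l)) := by
  set w : (ℤ → ℝ≥0∞) → ℤ → ℝ≥0∞ := fun α l => wt a b l ^ k * α l with hw
  have hpt : ∀ l, wt a b l ^ k * ∑' p, α p * β (l - p) ≤
      3 ^ k * ((∑' q, β q * w α (l - q)) + ∑' p, α p * w β (l - p)) := by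
    intro l
    have e : ∑' q, β q * w α (l - q) = ∑' p, w α p * β (l - p) := by
      rw [← (Equiv.subLeft l).tsum_eq fun q => β q * w α (l - q)]
      congr 1; ext p
      simp [mul_comm]
    rw [e, ← ENNReal.tsum_add, ← ENNReal.tsum_mul_left, ← ENNReal.tsum_mul_left]
    refine ENNReal.tsum_le_tsum fun p => ?_
    have h2 := (pow_le_pow_left' (wt_add_le a b l p) k).trans
      (add_pow_le_three (wt a b p) (wt a b (l - p)) k (by omega))
    calc _ ≤ _ := mul_le_mul_left h2 _
      _ = _ := by simp only [hw]; ring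
  have e1 : ∀ α : ℤ → ℝ≥0∞, ∑' l, α l ≤ embC a b * ltwo (w α) := fun α =>
    tsum_le_embC_mul' α hk
  have hinj : ∀ q : ℤ, Function.Injective fun l : ℤ => l - q := fun q => sub_left_injective
  calc _ ≤ _ := ltwo_mono hpt
    _ = 3 ^ k * _ := ltwo_const_mul _ _
    _ ≤ 3 ^ k * ((embC a b * ltwo (w β)) * ltwo (w α) + (embC a b * ltwo (w α)) * ltwo (w β)) := by
      gcongr
      refine (ltwo_add_le _ _).trans (add_le_add ?_ ?_)
      · exact (ltwo_tsum_le β (w α) (fun q l => l - q) hinj).trans (by gcongr; exact e1 _)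
      · exact (ltwo_tsum_le α (w β) (fun q l => l - q) hinj).trans (by gcongr; exact e1 _)
    _ = _ := by ring

/-- The constant of the algebra property of `H^k`. -/
noncomputable def algC (a b : ℝ) (k : ℕ) : ℝ≥0∞ := 3 ^ k * (2 * embC a b)

theorem algC_ne_top (hab : a < b) : algC a b k ≠ ∞ :=
  ENNReal.mul_ne_top (by simp) (ENNReal.mul_ne_top (by simp) (embC_ne_top hab))

theorem nrm_coef_mul_le (hab : a < b) (hk : 1 ≤ k) {x : C(AddCircle L, ℂ)}
    (hx : nrm a b k (coef x) ≠ ∞) (y : C(AddCircle L, ℂ)) :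
    nrm a b k (coef (x * y)) ≤ algC a b k * (nrm a b k (coef x) * nrm a b k (coef y)) := by
  refine le_trans (ltwo_mono fun l => ?_) (ltwo_bilinear_le hk (fun l => ‖coef x l‖ₑ)
    (fun l => ‖coef y l‖ₑ))
  gcongr
  rw [coef_mul (summable_norm_of_nrm hab hk hx)]
  refine enorm_tsum_le_tsum_enorm.trans (le_of_eq ?_)
  simp_rw [enorm_mul]

theorem coef_add (x y : C(AddCircle L, ℂ)) : coef (x + y) = coef x + coef y := by
  ext l; exact map_add _ _ _

theorem coef_sub (x y : C(AddCircle L, ℂ)) : coef (x - y) = coef x - coef y := by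
  ext l; exact map_sub _ _ _

theorem coef_smul (c : ℂ) (x : C(AddCircle L, ℂ)) : coef (c • x) = c • coef x := by
  ext l; exact (coefL l).map_smul c x

theorem coef_sum {ι : Type*} (s : Finset ι) (x : ι → C(AddCircle L, ℂ)) :
    coef (∑ i ∈ s, x i) = ∑ i ∈ s, coef (x i) := by
  ext l; simp [coef]

theorem nrm_coef_smul (c : ℂ) (x : C(AddCircle L, ℂ)) :
    nrm a b k (coef (c • x)) ≤ ‖c‖ₑ * nrm a b k (coef x) := by
  rw [coef_smul]
  exact nrm_le_mul _ fun l => by rw [Pi.smul_apply, enorm_smul]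

theorem nrm_coef_star (x : C(AddCircle L, ℂ)) : nrm a b k (coef (star x)) = nrm a b k (coef x) := by
  unfold nrm ltwo
  congr 1
  rw [← (Equiv.neg ℤ).tsum_eq]
  congr 1; ext l
  simp only [coef_star, Equiv.neg_apply, neg_neg, wt, om_neg]
  rw [← ofReal_norm, RCLike.norm_conj, ofReal_norm]

theorem nrm_coef_pow_mul_le (hab : a < b) (hk : 1 ≤ k) {x : C(AddCircle L, ℂ)} {r : ℝ≥0∞}
    (hr : algC a b k * nrm a b k (coef x) ≤ r) (hx : nrm a b k (coef x) ≠ ∞)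
    (y : C(AddCircle L, ℂ)) (n : ℕ) :
    nrm a b k (coef (x ^ n * y)) ≤ r ^ n * nrm a b k (coef y) := by
  induction n with
  | zero => simp
  | succ n ih =>
    rw [pow_succ', mul_assoc]
    refine (nrm_coef_mul_le hab hk hx _).trans ?_
    rw [← mul_assoc]
    exact (mul_le_mul' hr ih).trans (le_of_eq (by ring))

/-- Each factor x costs at most r, so the partial sums of the exponential series are dominated by
those of e^r - 1; Fatou passes to the limit. -/
theorem nrm_coef_exp_sub_one_mul_le (hab : a < b) (hk : 1 ≤ k) {x : C(AddCircle L, ℂ)} {r : ℝ}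
    (hr0 : 0 ≤ r) (hr : algC a b k * nrm a b k (coef x) ≤ ENNReal.ofReal r)
    (hx : nrm a b k (coef x) ≠ ∞) (y : C(AddCircle L, ℂ)) :
    nrm a b k (coef ((NormedSpace.exp x - 1) * y)) ≤
      ENNReal.ofReal (Real.exp r - 1) * nrm a b k (coef y) := by
  have h1 : HasSum (fun n : ℕ => ((n.factorial : ℂ)⁻¹) • x ^ n) (NormedSpace.exp x) :=
    NormedSpace.exp_series_hasSum_exp' x
  have h2 := ((hasSum_nat_add_iff' 1).2 h1).mul_right y
  simp only [Finset.range_one, Finset.sum_singleton, Nat.factorial_zero, Nat.cast_one, inv_one,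
    pow_zero, one_smul] at h2
  refine nrm_le_of_tendsto (𝓕 := atTop) (u := fun N => coef (∑ n ∈ Finset.range N,
    (((n + 1).factorial : ℂ)⁻¹ • x ^ (n + 1)) * y)) (fun l => ?_) (Eventually.of_forall fun N => ?_)
  · exact ((coefL l).continuous.tendsto _).comp h2.tendsto_sum_nat
  · rw [coef_sum]
    refine (nrm_sum_le _ _).trans ?_
    have h3 : ∀ n ∈ Finset.range N, nrm a b k (coef ((((n + 1).factorial : ℂ)⁻¹ • x ^ (n + 1)) * y))
        ≤ ENNReal.ofReal (r ^ (n + 1) / (n + 1).factorial) * nrm a b k (coef y) := by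
      intro n _
      rw [smul_mul_assoc]
      refine (nrm_coef_smul _ _).trans ?_
      rw [div_eq_inv_mul, ENNReal.ofReal_mul (by positivity), ENNReal.ofReal_pow hr0, mul_assoc]
      refine mul_le_mul' (le_of_eq ?_) (nrm_coef_pow_mul_le hab hk hr hx y _)
      rw [← ofReal_norm, norm_inv, Complex.norm_natCast]
    refine (Finset.sum_le_sum h3).trans ?_
    rw [← Finset.sum_mul, ← ENNReal.ofReal_sum_of_nonneg fun _ _ => by positivity]
    gcongr
    have h4 := Real.sum_le_exp_of_nonneg hr0 (N + 1)
    rw [Finset.sum_range_succ'] at h4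
    simp at h4 ⊢
    linarith

end product

/-! ### Comparison of spinor norms with their components. -/

section components
variable {a b : ℝ} {k : ℕ}

theorem nrm_comp_le (u : ℤ → Spinor) (i : Fin 2) : nrm a b k (fun l => u l i) ≤ nrm a b k u := by
  refine nrm_mono fun l => ?_
  rw [← ofReal_norm, ← ofReal_norm]
  exact ENNReal.ofReal_le_ofReal (norm_le_pi_norm _ i)

theorem nrm_le_sum_comp (u : ℤ → Spinor) : nrm a b k u ≤ ∑ i, nrm a b k (fun l => u l i) := by
  have h : ∀ l, wt a b l ^ k * ‖u l‖ₑ ≤ wt a b l ^ k * ‖u l 0‖ₑ + wt a b l ^ k * ‖u l 1‖ₑ := by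
    intro l
    rw [← mul_add]
    gcongr
    rw [← ofReal_norm, ← ofReal_norm, ← ofReal_norm,
      ← ENNReal.ofReal_add (norm_nonneg _) (norm_nonneg _)]
    refine ENNReal.ofReal_le_ofReal ((pi_norm_le_iff_of_nonneg (by positivity)).2 fun i => ?_)
    fin_cases i <;> simp
  rw [Fin.sum_univ_two]
  exact (ltwo_mono h).trans (ltwo_add_le _ _)

end components

/-! ### The exact flow of the nonlinear part. -/

section flow
variable {L : ℝ} [hL : Fact (0 < L)] {a b lam1 lam2 : ℝ} {k : ℕ}

/-- Fourier coefficients of a two-component function. -/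
noncomputable def coefS (v : Fin 2 → C(AddCircle L, ℂ)) (l : ℤ) : Spinor := fun i => coef (v i) l

/-- Synthesis of a two-component function. -/
noncomputable def synthS (L : ℝ) [Fact (0 < L)] (u : ℤ → Spinor) : Fin 2 → C(AddCircle L, ℂ) :=
  fun i => synth L fun l => u l i

/-- The diagonal entries of the nonlinearity matrix. -/
noncomputable def potential (lam1 lam2 : ℝ) (v : Fin 2 → C(AddCircle L, ℂ)) (i : Fin 2) :
    C(AddCircle L, ℂ) := ∑ j, cubCoeff lam1 lam2 i j • (v j * star (v j))

/-- The flow of the nonlinear part, on functions. -/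
noncomputable def flowFun (lam1 lam2 σ : ℝ) (v : Fin 2 → C(AddCircle L, ℂ)) (i : Fin 2) :
    C(AddCircle L, ℂ) :=
  NormedSpace.exp ((-(Complex.I * σ)) • potential lam1 lam2 v i) * v i

/-- The flow of the nonlinear part, on Fourier coefficients. -/
noncomputable def flow (L : ℝ) [Fact (0 < L)] (lam1 lam2 σ : ℝ) (u : ℤ → Spinor) : ℤ → Spinor :=
  coefS (flowFun lam1 lam2 σ (synthS L u))

theorem summable_comp (hab : a < b) (hk : 1 ≤ k) {u : ℤ → Spinor} (hu : nrm a b k u ≠ ∞)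
    (i : Fin 2) : Summable fun l => ‖u l i‖ :=
  summable_norm_of_nrm hab hk (ne_top_of_le_ne_top hu (nrm_comp_le u i))

theorem coef_synthS (hab : a < b) (hk : 1 ≤ k) {u : ℤ → Spinor} (hu : nrm a b k u ≠ ∞)
    (i : Fin 2) : coef (synthS L u i) = fun l => u l i :=
  coef_synth (summable_comp hab hk hu i)

theorem coefS_synthS (hab : a < b) (hk : 1 ≤ k) {u : ℤ → Spinor} (hu : nrm a b k u ≠ ∞) :
    coefS (synthS L u) = u := by
  ext l i
  rw [coefS, coef_synthS hab hk hu]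

theorem synthS_coefS (hab : a < b) (hk : 1 ≤ k) {v : Fin 2 → C(AddCircle L, ℂ)}
    (hv : nrm a b k (coefS v) ≠ ∞) : synthS L (coefS v) = v := by
  ext1 i
  exact synth_coef (summable_comp hab hk hv i)

theorem nrm_coef_le (v : Fin 2 → C(AddCircle L, ℂ)) (i : Fin 2) :
    nrm a b k (coef (v i)) ≤ nrm a b k (coefS v) := nrm_comp_le (coefS v) i

/-- Fourier coefficients of the cubic nonlinearity. -/
theorem coefS_potential_mul (hab : a < b) {v : Fin 2 → C(AddCircle L, ℂ)}
    (hv : nrm a b 1 (coefS v) ≠ ∞) :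
    coefS (fun i => potential lam1 lam2 v i * v i) = cubic a b lam1 lam2 1 (coefS v) := by
  have hs : ∀ i, Summable fun l => ‖coef (v i) l‖ := summable_comp hab le_rfl hv
  have hstar : ∀ i, Summable fun l => ‖coef (star (v i)) l‖ := fun i => by
    simp_rw [coef_star, RCLike.norm_conj]
    exact (Equiv.neg ℤ).summable_iff.2 (hs i)
  have hprod : ∀ j i l, Summable fun p : ℤ × ℤ =>
      coef (v j) p.1 * (conj (coef (v j) p.2) * coef (v i) (l - p.1 + p.2)) := by
    intro j i l
    refine Summable.of_norm ?_
    have h := ((hs j).mul_of_nonneg (hs j) (fun _ => norm_nonneg _)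
      (fun _ => norm_nonneg _)).mul_right (∑' l, ‖coef (v i) l‖)
    refine Summable.of_nonneg_of_le (fun i => by positivity) (fun p => ?_) h
    rw [norm_mul, norm_mul, RCLike.norm_conj, mul_assoc]
    gcongr
    exact (hs i).le_tsum _ fun _ _ => norm_nonneg _
  have htri : ∀ j i l, coef (v j * star (v j) * v i) l = ∑' p : ℤ × ℤ,
      coef (v j) p.1 * (conj (coef (v j) p.2) * coef (v i) (l - p.1 + p.2)) := by
    intro j i l
    rw [mul_assoc, coef_mul (hs j), (hprod j i l).tsum_prod]
    congr 1; ext p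
    -- The inner convolution with the conjugate is reindexed by q ↦ -q, since conjugation reverses
    -- frequencies.
    simp only [tsum_mul_left]
    rw [coef_mul (hstar j), ← (Equiv.neg ℤ).tsum_eq]
    congr 2; ext q
    simp [coef_star]
  ext l i
  rw [cubic_one]
  have hsum : Summable fun p : ℤ × ℤ => triForm lam1 lam2 (coefS v p.1) (coefS v p.2)
      (coefS v (l - p.1 + p.2)) := by
    refine Summable.of_norm_bounded ((summable_triple (summable_norm_of_nrm hab le_rfl hv) l).mul_left
      (formC lam1 lam2)) fun p => norm_triForm_le _ _ _
  rw [tsum_apply hsum]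
  have e : ∀ p : ℤ × ℤ, triForm lam1 lam2 (coefS v p.1) (coefS v p.2) (coefS v (l - p.1 + p.2)) i =
      ∑ j, cubCoeff lam1 lam2 i j *
        (coef (v j) p.1 * (conj (coef (v j) p.2) * coef (v i) (l - p.1 + p.2))) := fun p => by
    simp only [triForm, coefS]
    exact Finset.sum_congr rfl fun j _ => by ring
  simp_rw [e]
  rw [Summable.tsum_finsetSum fun j _ => (hprod j i l).mul_left _]
  simp only [coefS, potential, Finset.sum_mul, coef_sum, Finset.sum_apply, smul_mul_assoc,
    coef_smul, Pi.smul_apply, htri, smul_eq_mul, tsum_mul_left]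

theorem flow_zero (hab : a < b) (hk : 1 ≤ k) {u : ℤ → Spinor} (hu : nrm a b k u ≠ ∞) :
    flow L lam1 lam2 0 u = u := by
  rw [flow]
  have : flowFun lam1 lam2 0 (synthS L u) = synthS L u := by
    ext1 i; simp [flowFun]
  rw [this, coefS_synthS hab hk hu]

theorem star_cubCoeff (i j : Fin 2) : conj (cubCoeff lam1 lam2 i j) = cubCoeff lam1 lam2 i j := by
  unfold cubCoeff; split_ifs <;> exact Complex.conj_ofReal _

theorem star_potential (v : Fin 2 → C(AddCircle L, ℂ)) (i : Fin 2) :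
    star (potential lam1 lam2 v i) = potential lam1 lam2 v i := by
  simp only [potential, star_sum, star_smul, star_mul, star_star]
  refine Finset.sum_congr rfl fun j _ => ?_
  rw [show star (cubCoeff lam1 lam2 i j) = _ from star_cubCoeff i j]

/-- The potential is real, so the exponential is unimodular and every |v_j|² is conserved. Hence the
explicit formula really solves the nonlinear equation. -/
theorem potential_flowFun (σ : ℝ) (v : Fin 2 → C(AddCircle L, ℂ)) :
    potential lam1 lam2 (flowFun lam1 lam2 σ v) = potential lam1 lam2 v := by
  have h : ∀ j, flowFun lam1 lam2 σ v j * star (flowFun lam1 lam2 σ v j) = v j * star (v j) := by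
    intro j
    set E := NormedSpace.exp ((-(Complex.I * σ)) • potential lam1 lam2 v j) with hE
    have h1 : E * star E = 1 := by
      rw [hE, NormedSpace.star_exp, star_smul, star_potential,
        ← NormedSpace.exp_add_of_commute (Commute.all _ _), ← add_smul]
      simp
    calc _ = (E * v j) * star (E * v j) := rfl
      _ = (E * star E) * (v j * star (v j)) := by rw [star_mul]; ring
      _ = _ := by rw [h1, one_mul]
  ext1 i
  simp only [potential, h]

theorem hasDerivAt_flow (hab : a < b) {σ : ℝ} {u : ℤ → Spinor}
    (hu : nrm a b 1 (flow L lam1 lam2 σ u) ≠ ∞) (l : ℤ) :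
    HasDerivAt (fun σ => flow L lam1 lam2 σ u l)
      ((-Complex.I) • cubic a b lam1 lam2 1 (flow L lam1 lam2 σ u) l) σ := by
  refine hasDerivAt_pi.2 fun i => ?_
  set v := synthS L u with hv
  have h1 : HasDerivAt (fun σ : ℝ => flowFun lam1 lam2 σ v i)
      ((-Complex.I) • (potential lam1 lam2 v i * flowFun lam1 lam2 σ v i)) σ := by
    have h2 := hasDerivAt_exp_smul_const (𝕂 := ℝ) ((-Complex.I) • potential lam1 lam2 v i) σ
    have e : ∀ σ : ℝ, σ • ((-Complex.I) • potential lam1 lam2 v i) =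
        (-(Complex.I * σ)) • potential lam1 lam2 v i := fun σ => by
      rw [← Complex.coe_smul, smul_smul]; congr 1; ring
    simp only [e] at h2
    refine (h2.mul_const (v i)).congr_deriv ?_
    simp only [flowFun, smul_mul_assoc, mul_smul_comm]
    congr 1; ring
  have h3 := (coefL (L := L) l).restrictScalars ℝ |>.hasFDerivAt.comp_hasDerivAt σ h1
  refine h3.congr_deriv ?_
  rw [flow, ← coefS_potential_mul hab hu, Pi.smul_apply, coefS, potential_flowFun]
  exact map_smul (coefL l) _ _

theorem nrm_potential_sub_le (hab : a < b) (hk : 1 ≤ k) {v w : Fin 2 → C(AddCircle L, ℂ)}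
    {R : ℝ≥0∞} (hR : R ≠ ∞) (hv : nrm a b k (coefS v) ≤ R) (hw : nrm a b k (coefS w) ≤ R)
    (i : Fin 2) :
    nrm a b k (coef (potential lam1 lam2 v i - potential lam1 lam2 w i)) ≤
      ENNReal.ofReal (formC lam1 lam2) * (algC a b k * (2 * R)) * nrm a b k (coefS v - coefS w) := by
  have e : potential lam1 lam2 v i - potential lam1 lam2 w i =
      ∑ j, cubCoeff lam1 lam2 i j • ((v j - w j) * star (v j) + star (v j - w j) * w j) := by
    rw [potential, potential, ← Finset.sum_sub_distrib]
    refine Finset.sum_congr rfl fun j _ => ?_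
    rw [← smul_sub, star_sub]; congr 1; ring
  have hd : ∀ j, nrm a b k (coef (v j - w j)) ≤ nrm a b k (coefS v - coefS w) := fun j => by
    rw [coef_sub]; exact nrm_comp_le (coefS v - coefS w) j
  have hv' := fun j => (nrm_coef_le (a := a) (b := b) (k := k) v j).trans hv
  have hw' := fun j => (nrm_coef_le (a := a) (b := b) (k := k) w j).trans hw
  have hdt : ∀ j, nrm a b k (coef (v j - w j)) ≠ ∞ := fun j => by
    rw [coef_sub]
    exact ne_top_of_le_ne_top (ENNReal.add_ne_top.2 ⟨ne_top_of_le_ne_top hR (hv' j),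
      ne_top_of_le_ne_top hR (hw' j)⟩) (nrm_sub_le _ _)
  rw [e, coef_sum]
  have hj : ∀ j, nrm a b k (coef (cubCoeff lam1 lam2 i j •
      ((v j - w j) * star (v j) + star (v j - w j) * w j))) ≤
      ENNReal.ofReal (|lam1 + lam2| + |lam2 - lam1|) *
        (algC a b k * (2 * R) * nrm a b k (coefS v - coefS w)) := by
    intro j
    refine (nrm_coef_smul _ _).trans (mul_le_mul' ?_ ?_)
    · rw [← ofReal_norm]; exact ENNReal.ofReal_le_ofReal (norm_cubCoeff_le i j)
    · rw [coef_add]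
      refine (nrm_add_le _ _).trans ((add_le_add (nrm_coef_mul_le hab hk (hdt j) _)
        (nrm_coef_mul_le hab hk (by rw [nrm_coef_star]; exact hdt j) _)).trans ?_)
      rw [nrm_coef_star, nrm_coef_star]
      calc _ ≤ algC a b k * (nrm a b k (coefS v - coefS w) * R) +
          algC a b k * (nrm a b k (coefS v - coefS w) * R) := by
            gcongr
            exacts [hd j, hv' j, hd j, hw' j]
        _ = _ := by ring
  refine (nrm_sum_le _ _).trans ((Finset.sum_le_sum fun j _ => hj j).trans (le_of_eq ?_))
  rw [Finset.sum_const, Finset.card_univ, Fintype.card_fin, formC, ENNReal.ofReal_mul zero_le_two]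
  simp only [nsmul_eq_mul]
  push_cast; rw [ENNReal.ofReal_ofNat]; ring

/-- Stated for a difference of potentials so that one bound covers both the size of an increment
(take w = 0) and its dependence on the data. -/
theorem exists_nrm_exp_bounds (lam1 lam2 : ℝ) (hab : a < b) (hk : 1 ≤ k) (R : ℝ≥0) :
    ∃ r : ℝ≥0, ∀ v w : Fin 2 → C(AddCircle L, ℂ), nrm a b k (coefS v) ≤ R →
      nrm a b k (coefS w) ≤ R → ∀ d : ℝ≥0, nrm a b k (coefS v - coefS w) ≤ d →
      ∀ σ : ℝ, 0 ≤ σ → ∀ (i : Fin 2) (y : C(AddCircle L, ℂ)),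
        nrm a b k (coef ((NormedSpace.exp ((-(Complex.I * σ)) •
          (potential lam1 lam2 v i - potential lam1 lam2 w i)) - 1) * y)) ≤
        ENNReal.ofReal (Real.exp (σ * (r * d)) - 1) * nrm a b k (coef y) := by
  have hA : algC a b k * (ENNReal.ofReal (formC lam1 lam2) * (algC a b k * (2 * R))) ≠ ∞ :=
    ENNReal.mul_ne_top (algC_ne_top hab) (ENNReal.mul_ne_top ENNReal.ofReal_ne_top
      (ENNReal.mul_ne_top (algC_ne_top hab) (ENNReal.mul_ne_top (by simp) ENNReal.coe_ne_top)))
  obtain ⟨r, hr⟩ : ∃ r : ℝ≥0, (r : ℝ≥0∞) = _ := ⟨_, ENNReal.coe_toNNReal hA⟩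
  refine ⟨r, fun v w hv hw d hd σ hσ i y => ?_⟩
  have h1 := nrm_potential_sub_le (lam1 := lam1) (lam2 := lam2) hab hk ENNReal.coe_ne_top hv hw i
  have h2 : nrm a b k (coef ((-(Complex.I * σ)) •
      (potential lam1 lam2 v i - potential lam1 lam2 w i))) ≤ ENNReal.ofReal σ *
      (ENNReal.ofReal (formC lam1 lam2) * (algC a b k * (2 * R)) * d) := by
    refine (nrm_coef_smul _ _).trans (mul_le_mul' (le_of_eq ?_) (h1.trans (by gcongr)))
    rw [← ofReal_norm]; congr 1
    simp [abs_of_nonneg hσ]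
  refine nrm_coef_exp_sub_one_mul_le hab hk (by positivity) ?_ ?_ y
  · calc _ ≤ algC a b k * _ := mul_le_mul_right h2 _
      _ = ENNReal.ofReal σ * (r * d) := by rw [hr]; ring
      _ = _ := by
        rw [ENNReal.ofReal_mul hσ, ENNReal.ofReal_mul r.coe_nonneg, ENNReal.ofReal_coe_nnreal,
          ENNReal.ofReal_coe_nnreal]
  · refine ne_top_of_le_ne_top ?_ h2
    exact ENNReal.mul_ne_top ENNReal.ofReal_ne_top (ENNReal.mul_ne_top (ENNReal.mul_ne_top
      ENNReal.ofReal_ne_top (ENNReal.mul_ne_top (algC_ne_top hab) (ENNReal.mul_ne_top (by simp)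
      ENNReal.coe_ne_top))) ENNReal.coe_ne_top)

end flow

/-! ### Size and Lipschitz bounds of the nonlinear increment. -/

section flowBounds
variable {L : ℝ} [hL : Fact (0 < L)] {a b lam1 lam2 : ℝ} {k : ℕ}

theorem exp_mul_sub_one_le {σ x y : ℝ} (hσ0 : 0 ≤ σ) (hσ1 : σ ≤ 1) (hx : 0 ≤ x) (hxy : x ≤ y) :
    Real.exp (σ * x) - 1 ≤ σ * (x * Real.exp y) := by
  have h1 : Real.exp (σ * x) - 1 ≤ σ * x * Real.exp (σ * x) := by
    have h2 := Real.add_one_le_exp (-(σ * x))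
    have h3 := Real.exp_pos (σ * x)
    have h4 : Real.exp (-(σ * x)) * Real.exp (σ * x) = 1 := by rw [← Real.exp_add]; simp
    nlinarith
  have h5 : Real.exp (σ * x) ≤ Real.exp y := Real.exp_le_exp.2 (by nlinarith)
  calc _ ≤ _ := h1
    _ ≤ σ * x * Real.exp y := by gcongr
    _ = _ := by ring

theorem coefS_sub (v w : Fin 2 → C(AddCircle L, ℂ)) : coefS (v - w) = coefS v - coefS w := by
  ext l i
  simp [coefS, coef_sub]

theorem potential_zero (i : Fin 2) :
    potential lam1 lam2 (0 : Fin 2 → C(AddCircle L, ℂ)) i = 0 := by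
  simp [potential]

@[simp] theorem coefS_zero : coefS (0 : Fin 2 → C(AddCircle L, ℂ)) = 0 := by
  ext l i; simp [coefS, coef]

theorem flow_sub_self (hab : a < b) (hk : 1 ≤ k) (σ : ℝ) {u : ℤ → Spinor}
    (hu : nrm a b k u ≠ ∞) : flow L lam1 lam2 σ u - u =
      coefS fun i => (NormedSpace.exp ((-(Complex.I * σ)) • potential lam1 lam2 (synthS L u) i) - 1)
        * synthS L u i := by
  have h : flow L lam1 lam2 σ u - u =
      coefS (flowFun lam1 lam2 σ (synthS L u)) - coefS (synthS L u) := by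
    rw [coefS_synthS hab hk hu]; rfl
  rw [h, ← coefS_sub]
  congr 1; ext1 i
  rw [Pi.sub_apply, flowFun]; ring

theorem exists_nrm_flow_sub_self_le (L lam1 lam2 : ℝ) [Fact (0 < L)] (hab : a < b) (hk : 1 ≤ k)
    (R : ℝ≥0) : ∃ C : ℝ≥0, ∀ u : ℤ → Spinor, nrm a b k u ≤ R → ∀ σ : ℝ, 0 ≤ σ → σ ≤ 1 →
      nrm a b k (flow L lam1 lam2 σ u - u) ≤ C * ENNReal.ofReal σ := by
  obtain ⟨r, hr⟩ := exists_nrm_exp_bounds (L := L) lam1 lam2 hab hk R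
  refine ⟨2 * (Real.toNNReal (r * R * Real.exp (r * R)) * R), fun u hu σ hσ0 hσ1 => ?_⟩
  have hut : nrm a b k u ≠ ∞ := ne_top_of_le_ne_top ENNReal.coe_ne_top hu
  have hv : coefS (synthS L u) = u := coefS_synthS hab hk hut
  rw [flow_sub_self hab hk σ hut]
  refine (nrm_le_sum_comp _).trans ?_
  have h : ∀ i, nrm a b k (coef ((NormedSpace.exp ((-(Complex.I * σ)) •
      potential lam1 lam2 (synthS L u) i) - 1) * synthS L u i)) ≤
      ENNReal.ofReal (σ * (r * R * Real.exp (r * R))) * R := by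
    intro i
    have h1 := hr (synthS L u) 0 (by rwa [hv]) (by simp) R (by simpa [hv] using hu) σ hσ0 i
      (synthS L u i)
    rw [potential_zero, sub_zero] at h1
    refine h1.trans (mul_le_mul' (ENNReal.ofReal_le_ofReal ?_) ?_)
    · exact exp_mul_sub_one_le hσ0 hσ1 (by positivity) le_rfl
    · refine (nrm_coef_le _ i).trans ?_
      rwa [hv]
  refine (Finset.sum_le_sum fun i _ => h i).trans (le_of_eq ?_)
  rw [Finset.sum_const, Finset.card_univ, Fintype.card_fin, ENNReal.ofReal_mul hσ0]
  push_cast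
  simp only [nsmul_eq_mul, ENNReal.ofReal]; push_cast; ring

/-- The estimate is for the increments, not for the flow: the factor σ in front of the difference of
the data is what makes a step amplify errors by 1 + O(κ) only. -/
theorem exists_nrm_flow_sub_flow_le (L lam1 lam2 : ℝ) [Fact (0 < L)] (hab : a < b) (hk : 1 ≤ k)
    (R : ℝ≥0) : ∃ C : ℝ≥0, ∀ u w : ℤ → Spinor, nrm a b k u ≤ R → nrm a b k w ≤ R →
      ∀ σ : ℝ, 0 ≤ σ → σ ≤ 1 →
      nrm a b k ((flow L lam1 lam2 σ u - u) - (flow L lam1 lam2 σ w - w)) ≤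
        C * ENNReal.ofReal σ * nrm a b k (u - w) := by
  obtain ⟨r, hr⟩ := exists_nrm_exp_bounds (L := L) lam1 lam2 hab hk R
  obtain ⟨C₀, hC₀⟩ := exists_nrm_flow_sub_self_le L lam1 lam2 hab hk R
  refine ⟨2 * (Real.toNNReal (r * R * Real.exp (r * R)) +
    Real.toNNReal (r * Real.exp (r * (2 * R))) * (C₀ + R)), fun u w hu hw σ hσ0 hσ1 => ?_⟩
  have hut : nrm a b k u ≠ ∞ := ne_top_of_le_ne_top ENNReal.coe_ne_top hu
  have hwt : nrm a b k w ≠ ∞ := ne_top_of_le_ne_top ENNReal.coe_ne_top hw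
  have hv : coefS (synthS L u) = u := coefS_synthS hab hk hut
  have hv' : coefS (synthS L w) = w := coefS_synthS hab hk hwt
  have hdt : nrm a b k (u - w) ≤ R + R := (nrm_sub_le _ _).trans (add_le_add hu hw)
  obtain ⟨d, hd⟩ : ∃ d : ℝ≥0, (d : ℝ≥0∞) = nrm a b k (u - w) :=
    ⟨_, ENNReal.coe_toNNReal (ne_top_of_le_ne_top (by simp) hdt)⟩
  have hd2 : (d : ℝ) ≤ 2 * R := by
    rw [← hd] at hdt
    have : d ≤ R + R := by exact_mod_cast hdt
    have h : (d : ℝ) ≤ R + R := by exact_mod_cast this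
    linarith
  rw [flow_sub_self hab hk σ hut, flow_sub_self hab hk σ hwt, ← coefS_sub]
  refine (nrm_le_sum_comp _).trans ?_
  set v := synthS L u
  set v' := synthS L w
  have h : ∀ i, nrm a b k (coef ((NormedSpace.exp ((-(Complex.I * σ)) • potential lam1 lam2 v i) - 1)
      * v i - (NormedSpace.exp ((-(Complex.I * σ)) • potential lam1 lam2 v' i) - 1) * v' i)) ≤
      ENNReal.ofReal (σ * (r * R * Real.exp (r * R))) * d +
      ENNReal.ofReal (σ * (r * d * Real.exp (r * (2 * R)))) * (C₀ + R) := by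
    intro i
    -- The exponentials commute, so e^{A} - e^{A'} = (e^{A-A'} - 1)e^{A'}. The first term carries
    -- the difference of the data, the second the difference of the potentials.
    have e : (NormedSpace.exp ((-(Complex.I * σ)) • potential lam1 lam2 v i) - 1)
      * v i - (NormedSpace.exp ((-(Complex.I * σ)) • potential lam1 lam2 v' i) - 1) * v' i =
      (NormedSpace.exp ((-(Complex.I * σ)) • (potential lam1 lam2 v i -
        potential lam1 lam2 (0 : Fin 2 → C(AddCircle L, ℂ)) i)) - 1) * (v i - v' i) +
      (NormedSpace.exp ((-(Complex.I * σ)) • (potential lam1 lam2 v i - potential lam1 lam2 v' i))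
        - 1) * flowFun lam1 lam2 σ v' i := by
      have : NormedSpace.exp ((-(Complex.I * σ)) • potential lam1 lam2 v i) =
        NormedSpace.exp ((-(Complex.I * σ)) • (potential lam1 lam2 v i - potential lam1 lam2 v' i))
        * NormedSpace.exp ((-(Complex.I * σ)) • potential lam1 lam2 v' i) := by
        rw [← NormedSpace.exp_add_of_commute (Commute.all _ _), ← smul_add, sub_add_cancel]
      rw [potential_zero, sub_zero, flowFun, this]; ring
    rw [e, coef_add]
    refine (nrm_add_le _ _).trans (add_le_add ?_ ?_)
    · refine (hr v 0 (by rwa [hv]) (by simp) R (by simpa [hv] using hu) σ hσ0 i _).trans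
        (mul_le_mul' (ENNReal.ofReal_le_ofReal
          (exp_mul_sub_one_le hσ0 hσ1 (by positivity) le_rfl)) ?_)
      rw [hd, coef_sub]
      have : nrm a b k (coef (v i) - coef (v' i)) ≤ nrm a b k (coefS v - coefS v') :=
        nrm_comp_le (coefS v - coefS v') i
      rwa [hv, hv'] at this
    · refine (hr v v' (by rwa [hv]) (by rwa [hv']) d (by rw [hv, hv', hd]) σ hσ0 i _).trans
        (mul_le_mul' (ENNReal.ofReal_le_ofReal
          (exp_mul_sub_one_le hσ0 hσ1 (by positivity) (by gcongr))) ?_)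
      refine (nrm_coef_le _ i).trans ?_
      have h2 : coefS (flowFun lam1 lam2 σ v') = (flow L lam1 lam2 σ w - w) + w := by
        rw [sub_add_cancel]; rfl
      rw [h2]
      refine (nrm_add_le _ _).trans (add_le_add ((hC₀ w hw σ hσ0 hσ1).trans ?_) hw)
      calc _ ≤ (C₀ : ℝ≥0∞) * 1 := by gcongr; simpa using hσ1
        _ = _ := mul_one _
  refine (Finset.sum_le_sum fun i _ => h i).trans (le_of_eq ?_)
  rw [Finset.sum_const, Finset.card_univ, Fintype.card_fin, ENNReal.ofReal_mul hσ0,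
    ENNReal.ofReal_mul hσ0, show (r : ℝ) * d * Real.exp (r * (2 * R)) =
      d * (r * Real.exp (r * (2 * R))) by ring, ENNReal.ofReal_mul d.coe_nonneg, ← hd,
      ENNReal.ofReal_coe_nnreal]
  push_cast
  simp only [nsmul_eq_mul, ENNReal.ofReal]; push_cast; ring

end flowBounds

/-! ### Local error in interaction variables. -/

section localError
variable {L : ℝ} [hL : Fact (0 < L)] {a b lam1 lam2 : ℝ} {k : ℕ}

theorem nrm_const_smul (c : ℂ) (u : ℤ → Spinor) : nrm a b k (c • u) ≤ ‖c‖ₑ * nrm a b k u :=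
  nrm_le_mul _ fun l => by rw [Pi.smul_apply, enorm_smul]

theorem nrm_neg_I_smul (u : ℤ → Spinor) : nrm a b k ((-Complex.I) • u) ≤ nrm a b k u := by
  refine (nrm_const_smul _ _).trans (le_of_eq ?_)
  rw [enorm_neg, ← ofReal_norm, Complex.norm_I]; simp

theorem hasDerivAt_propSeq_flow (hab : a < b) {σ t : ℝ} {u : ℤ → Spinor}
    (hu : nrm a b 1 (flow L lam1 lam2 σ u) ≠ ∞) (l : ℤ) :
    HasDerivAt (fun σ => propSeq a b (-t) (flow L lam1 lam2 σ u) l)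
      (((-Complex.I) • cubic a b lam1 lam2 (expKernel t)
        (propSeq a b (-t) (flow L lam1 lam2 σ u))) l) σ := by
  have h1 := ((prop a b (-t) l).restrictScalars ℝ).hasFDerivAt.comp_hasDerivAt σ
    (hasDerivAt_flow hab hu l)
  refine h1.congr_deriv ?_
  have h2 : nrm a b 1 (propSeq a b (-t) (flow L lam1 lam2 σ u)) ≠ ∞ :=
    ne_top_of_le_ne_top (ENNReal.mul_ne_top (by simp) hu) (nrm_propSeq_le _ _)
  rw [← propSeq_cubic_propSeq hab t h2, propSeq_propSeq, add_neg_cancel, propSeq_zero]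
  exact (prop a b (-t) l).map_smul _ _

/-- Comparison of the nonlinear flow with the exact evolution in interaction variables, over one
time step: up to higher order terms, the difference is the quadrature error of the midpoint rule
for the oscillatory nonlinearity. -/
theorem exists_nrm_local_error_le (L lam1 lam2 : ℝ) [Fact (0 < L)] (hab : a < b) (R : ℝ≥0) :
    ∃ C : ℝ≥0, ∀ (X : ℝ → ℤ → Spinor) (θ : ℝ → ℝ) (t τ κ : ℝ), 0 ≤ κ → κ ≤ 1 → κ ≤ τ →
      Continuous θ → (∀ σ ∈ Set.Icc 0 κ, |t - θ σ| ≤ τ) →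
      (∀ σ ∈ Set.Icc 0 κ, nrm a b 2 (X σ) ≤ R) →
      (∀ l, ContinuousOn (fun σ => X σ l) (Set.Icc 0 κ)) →
      (∀ σ ∈ Set.Ioo 0 κ, ∀ l, HasDerivAt (fun σ => X σ l)
        (((-Complex.I) • cubic a b lam1 lam2 (expKernel (θ σ)) (X σ)) l) σ) →
      nrm a b 1 (propSeq a b (-t) (flow L lam1 lam2 κ (propSeq a b t (X 0))) - X κ -
        (-Complex.I) • cubic a b lam1 lam2
          (fun δ => ∫ ρ in (0 : ℝ)..κ, (expKernel t - expKernel (θ ρ)) δ) (X 0)) ≤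
        C * ENNReal.ofReal κ ^ 2 * ENNReal.ofReal τ := by
  obtain ⟨C₀, hC₀⟩ := exists_nrm_flow_sub_self_le (k := 2) L lam1 lam2 hab (by norm_num) (4 * R)
  obtain ⟨c1, hc1⟩ : ∃ r : ℝ≥0, (r : ℝ≥0∞) = cubicC a b lam1 lam2 1 :=
    ⟨_, ENNReal.coe_toNNReal (cubicC_ne_top hab)⟩
  obtain ⟨c2, hc2⟩ : ∃ r : ℝ≥0, (r : ℝ≥0∞) = cubicC a b lam1 lam2 2 :=
    ⟨_, ENNReal.coe_toNNReal (cubicC_ne_top hab)⟩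
  set R' : ℝ≥0 := R + 4 * (C₀ + 4 * R) with hR'
  set C1 : ℝ≥0 := c2 * R' ^ 3 with hC1
  set C2 : ℝ≥0 := c2 * 2 * R' ^ 3 + c1 * R' ^ 2 * (2 * C1) with hC2
  refine ⟨c2 * 2 * R' ^ 2 * C1 + c1 * R' ^ 2 * C2, ?_⟩
  intro X θ t τ κ hκ0 hκ1 hκτ hθc hθ hX hXc hXd
  have hτ0 : 0 ≤ τ := hκ0.trans hκτ
  have h0mem : (0 : ℝ) ∈ Set.Icc 0 κ := ⟨le_rfl, hκ0⟩
  have hRt : (R' : ℝ≥0∞) ≠ ∞ := ENNReal.coe_ne_top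
  set w := X 0 with hw
  -- Y solves the interaction equation with the time of the oscillation frozen at t, X the one with
  -- the true time θ; both start at w.
  set Y : ℝ → ℤ → Spinor := fun σ => propSeq a b (-t) (flow L lam1 lam2 σ (propSeq a b t w)) with hY
  have hw2 : nrm a b 2 (propSeq a b t w) ≤ ((4 * R : ℝ≥0) : ℝ≥0∞) := by
    push_cast
    exact (nrm_propSeq_le t w).trans (mul_le_mul_right (hX 0 h0mem) _)
  have hflow2 : ∀ σ ∈ Set.Icc 0 κ, nrm a b 2 (flow L lam1 lam2 σ (propSeq a b t w)) ≤
      C₀ + 4 * R := by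
    intro σ hσ
    have h1 := hC₀ _ hw2 σ hσ.1 (hσ.2.trans hκ1)
    have h2 := nrm_add_le (a := a) (b := b) (k := 2)
      (flow L lam1 lam2 σ (propSeq a b t w) - propSeq a b t w) (propSeq a b t w)
    rw [sub_add_cancel] at h2
    refine h2.trans (add_le_add (h1.trans ?_) (by simpa using hw2))
    calc _ ≤ (C₀ : ℝ≥0∞) * 1 := by gcongr; simpa using hσ.2.trans hκ1
      _ = _ := mul_one _
  have hY2 : ∀ σ ∈ Set.Icc 0 κ, nrm a b 2 (Y σ) ≤ R' := by
    intro σ hσ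
    refine (nrm_propSeq_le _ _).trans ((mul_le_mul_right (hflow2 σ hσ) _).trans ?_)
    rw [hR']; push_cast; exact le_add_self
  have hX2 : ∀ σ ∈ Set.Icc 0 κ, nrm a b 2 (X σ) ≤ R' := fun σ hσ => (hX σ hσ).trans (by
    rw [hR']; push_cast; exact le_self_add)
  have h12 : ∀ {v : ℤ → Spinor} {c : ℝ≥0∞}, nrm a b 2 v ≤ c → nrm a b 1 v ≤ c := fun h =>
    (nrm_le_of_le (by norm_num)).trans h
  have hfin : ∀ {v : ℤ → Spinor}, nrm a b 2 v ≤ R' → nrm a b 1 v ≠ ∞ := fun h =>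
    ne_top_of_le_ne_top hRt (h12 h)
  have hY0 : Y 0 = w := by
    simp only [hY]
    rw [flow_zero hab (k := 2) (by norm_num) (ne_top_of_le_ne_top ENNReal.coe_ne_top hw2),
      propSeq_propSeq, neg_add_cancel, propSeq_zero]
  have hYd : ∀ σ ∈ Set.Icc 0 κ, ∀ l, HasDerivAt (fun σ => Y σ l)
      (((-Complex.I) • cubic a b lam1 lam2 (expKernel t) (Y σ)) l) σ := fun σ hσ l =>
    hasDerivAt_propSeq_flow hab (ne_top_of_le_ne_top (by simp [ENNReal.mul_ne_top])
      (h12 (hflow2 σ hσ))) l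
  have hYc : ∀ l, ContinuousOn (fun σ => Y σ l) (Set.Icc 0 κ) := fun l σ hσ =>
    (hYd σ hσ l).continuousAt.continuousWithinAt
  have hcub2 : ∀ (s : ℝ) {v : ℤ → Spinor}, nrm a b 2 v ≤ R' →
      nrm a b 2 ((-Complex.I) • cubic a b lam1 lam2 (expKernel s) v) ≤ C1 := by
    intro s v hv
    refine (nrm_neg_I_smul _).trans ((nrm_cubic_le hab (kernelBound_expKernel s) ENNReal.one_ne_top
      (by norm_num) (by norm_num) hRt hv).trans (le_of_eq ?_))
    rw [← hc2, hC1]; push_cast; ring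
  have hmono : ∀ {σ : ℝ}, σ ∈ Set.Icc 0 κ → σ - 0 ≤ κ :=
    fun hσ => by simpa using hσ.2
  have hYw : ∀ σ ∈ Set.Icc 0 κ, nrm a b 2 (Y σ - w) ≤ ENNReal.ofReal κ * C1 := by
    intro σ hσ
    rw [← hY0]
    have hsub : Set.Icc 0 σ ⊆ Set.Icc 0 κ := Set.Icc_subset_Icc_right hσ.2
    refine (nrm_sub_le_of_hasDerivAt hσ.1 (fun l => (hYc l).mono hsub)
      (fun r hr l => hYd r (hsub (Set.Ioo_subset_Icc_self hr)) l)
      (fun r hr => hcub2 t (hY2 r (hsub (Set.Ioo_subset_Icc_self hr))))).trans ?_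
    gcongr; exact hmono hσ
  have hXw : ∀ σ ∈ Set.Icc 0 κ, nrm a b 2 (X σ - w) ≤ ENNReal.ofReal κ * C1 := by
    intro σ hσ
    have hsub : Set.Icc 0 σ ⊆ Set.Icc 0 κ := Set.Icc_subset_Icc_right hσ.2
    refine (nrm_sub_le_of_hasDerivAt hσ.1 (fun l => (hXc l).mono hsub)
      (fun r hr l => hXd r ⟨hr.1, hr.2.trans_le hσ.2⟩ l)
      (fun r hr => hcub2 (θ r) (hX2 r (hsub (Set.Ioo_subset_Icc_self hr))))).trans ?_
    gcongr; exact hmono hσ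
  have hdiff : ∀ σ ∈ Set.Icc 0 κ, KernelBound (expKernel t - expKernel (θ σ))
      (2 * ENNReal.ofReal τ) 1 := by
    intro σ hσ δ x hx hδ
    refine (kernelBound_expKernel_sub t (θ σ) δ x hx hδ).trans ?_
    gcongr
    rw [ENNReal.ofReal_mul zero_le_two, ENNReal.ofReal_ofNat]
    gcongr; exact hθ σ hσ
  have h2τ : (2 * ENNReal.ofReal τ : ℝ≥0∞) ≠ ∞ := ENNReal.mul_ne_top (by simp) ENNReal.ofReal_ne_top
  have hsubK : ∀ (σ : ℝ) {v : ℤ → Spinor}, nrm a b 2 v ≤ R' →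
      cubic a b lam1 lam2 (expKernel t - expKernel (θ σ)) v =
        cubic a b lam1 lam2 (expKernel t) v - cubic a b lam1 lam2 (expKernel (θ σ)) v :=
    fun σ v hv => cubic_sub_kernel hab (kernelBound_expKernel _) ENNReal.one_ne_top
      (kernelBound_expKernel _) ENNReal.one_ne_top (hfin hv)
  have hlip : ∀ σ ∈ Set.Icc 0 κ, ∀ c : ℝ≥0∞, nrm a b 1 (Y σ - X σ) ≤ c →
      nrm a b 1 (cubic a b lam1 lam2 (expKernel (θ σ)) (Y σ) -
        cubic a b lam1 lam2 (expKernel (θ σ)) (X σ)) ≤ c1 * R' ^ 2 * c := by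
    intro σ hσ c hc
    refine (nrm_cubic_sub_le (j := 0) (k := 1) hab (kernelBound_expKernel _) ENNReal.one_ne_top rfl le_rfl
      hRt (h12 (hY2 σ hσ)) (h12 (hX2 σ hσ))).trans ?_
    rw [← hc1, mul_one]; gcongr
  have hYX : ∀ σ ∈ Set.Icc 0 κ, nrm a b 1 (Y σ - X σ) ≤
      ENNReal.ofReal κ * (C2 * ENNReal.ofReal τ) := by
    -- First pass: both curves stay within O(κ) of w, and κ ≤ τ. Feeding this into the equation
    -- makes the derivative of Y - X of size τ, hence Y - X of size κτ.
    have hcrude : ∀ σ ∈ Set.Icc 0 κ, nrm a b 1 (Y σ - X σ) ≤ 2 * C1 * ENNReal.ofReal τ := by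
      intro σ hσ
      rw [show Y σ - X σ = (Y σ - w) - (X σ - w) by abel]
      refine (nrm_sub_le _ _).trans ((add_le_add (h12 (hYw σ hσ)) (h12 (hXw σ hσ))).trans ?_)
      calc _ = 2 * C1 * ENNReal.ofReal κ := by ring
        _ ≤ _ := by gcongr
    have hder : ∀ σ ∈ Set.Icc 0 κ, nrm a b 1
        ((-Complex.I) • cubic a b lam1 lam2 (expKernel t) (Y σ) -
          (-Complex.I) • cubic a b lam1 lam2 (expKernel (θ σ)) (X σ)) ≤ C2 * ENNReal.ofReal τ := by
      intro σ hσ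
      rw [← smul_sub]
      refine (nrm_neg_I_smul _).trans ?_
      rw [show cubic a b lam1 lam2 (expKernel t) (Y σ) - cubic a b lam1 lam2 (expKernel (θ σ)) (X σ)
        = cubic a b lam1 lam2 (expKernel t - expKernel (θ σ)) (Y σ) +
          (cubic a b lam1 lam2 (expKernel (θ σ)) (Y σ) -
            cubic a b lam1 lam2 (expKernel (θ σ)) (X σ)) by rw [hsubK σ (hY2 σ hσ)]; abel]
      refine (nrm_add_le _ _).trans ((add_le_add (nrm_cubic_le (k := 1) hab (hdiff σ hσ) h2τ rfl
        (by norm_num) hRt (hY2 σ hσ)) (hlip σ hσ _ (hcrude σ hσ))).trans (le_of_eq ?_))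
      rw [show 1 + 1 = 2 from rfl, ← hc2, hC2]; push_cast; ring
    intro σ hσ
    have hsub : Set.Icc 0 σ ⊆ Set.Icc 0 κ := Set.Icc_subset_Icc_right hσ.2
    have h := nrm_sub_le_of_hasDerivAt (a := a) (b := b) (k := 1) (y := fun σ => Y σ - X σ)
      (y' := fun σ => (-Complex.I) • cubic a b lam1 lam2 (expKernel t) (Y σ) -
          (-Complex.I) • cubic a b lam1 lam2 (expKernel (θ σ)) (X σ)) hσ.1
      (fun l => ((hYc l).sub (hXc l)).mono hsub)
      (fun r hr l => (hYd r (hsub (Set.Ioo_subset_Icc_self hr)) l).sub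
        (hXd r ⟨hr.1, hr.2.trans_le hσ.2⟩ l))
      (fun r hr => hder r (hsub (Set.Ioo_subset_Icc_self hr)))
    simp only [hY0, ← hw, sub_self] at h
    rw [sub_zero] at h
    refine h.trans ?_
    gcongr; exact hmono hσ
  have hwsum : Summable fun l => ‖w l‖ := summable_norm_of_nrm hab le_rfl (hfin (hX2 0 h0mem))
  have hKc : ∀ δ, Continuous fun ρ => (expKernel t - expKernel (θ ρ)) δ := fun δ => by
    simp only [Pi.sub_apply, expKernel]; fun_prop
  have hKb : ∀ ρ δ, ‖(expKernel t - expKernel (θ ρ)) δ‖ ≤ 2 := fun ρ δ => by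
    refine (norm_sub_le _ _).trans ?_
    rw [norm_expKernel, norm_expKernel]; norm_num
  have hpc : ∀ l, Continuous fun ρ => cubic a b lam1 lam2 (expKernel t - expKernel (θ ρ)) w l :=
    continuous_cubic hKc hKb hwsum
  -- The leading term: the kernel difference with its argument frozen at w. Replacing Y by w costs
  -- O(κ) on a kernel of size τ, and Y - X is O(κτ), so the derivative of Y - X - p is O(κτ) and its
  -- integral O(κ²τ).
  set p : ℝ → ℤ → Spinor := fun σ l =>
    (-Complex.I) • ∫ ρ in (0 : ℝ)..σ, cubic a b lam1 lam2 (expKernel t - expKernel (θ ρ)) w l with hp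
  have hpd : ∀ σ l, HasDerivAt (fun σ => p σ l)
      (((-Complex.I) • cubic a b lam1 lam2 (expKernel t - expKernel (θ σ)) w) l) σ := fun σ l =>
    ((hpc l).integral_hasStrictDerivAt 0 σ).hasDerivAt.fun_const_smul (-Complex.I)
  have h := nrm_sub_le_of_hasDerivAt (a := a) (b := b) (k := 1) (y := fun σ => Y σ - X σ - p σ)
    (y' := fun σ => (-Complex.I) • cubic a b lam1 lam2 (expKernel t) (Y σ) -
          (-Complex.I) • cubic a b lam1 lam2 (expKernel (θ σ)) (X σ) -
          (-Complex.I) • cubic a b lam1 lam2 (expKernel t - expKernel (θ σ)) w)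
    (B := (c2 * 2 * R' ^ 2 * C1 + c1 * R' ^ 2 * C2) * ENNReal.ofReal κ * ENNReal.ofReal τ) hκ0
    (fun l => ((hYc l).sub (hXc l)).sub fun σ _ => (hpd σ l).continuousAt.continuousWithinAt)
    (fun r hr l => ((hYd r (Set.Ioo_subset_Icc_self hr) l).sub (hXd r hr l)).sub (hpd r l)) (by
      intro σ hσ'
      have hσ := Set.Ioo_subset_Icc_self hσ'
      rw [← smul_sub, ← smul_sub]
      refine (nrm_neg_I_smul _).trans ?_
      rw [show cubic a b lam1 lam2 (expKernel t) (Y σ) - cubic a b lam1 lam2 (expKernel (θ σ)) (X σ)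
        - cubic a b lam1 lam2 (expKernel t - expKernel (θ σ)) w =
        (cubic a b lam1 lam2 (expKernel t - expKernel (θ σ)) (Y σ) -
          cubic a b lam1 lam2 (expKernel t - expKernel (θ σ)) w) +
          (cubic a b lam1 lam2 (expKernel (θ σ)) (Y σ) -
            cubic a b lam1 lam2 (expKernel (θ σ)) (X σ)) by rw [hsubK σ (hY2 σ hσ)]; abel]
      refine (nrm_add_le _ _).trans ((add_le_add (nrm_cubic_sub_le (k := 1) hab (hdiff σ hσ) h2τ rfl
        (by norm_num) hRt (hY2 σ hσ) (hX2 0 h0mem)) (hlip σ hσ _ (hYX σ hσ))).trans ?_)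
      rw [show 1 + 1 = 2 from rfl, ← hc2]
      calc _ ≤ c2 * (2 * ENNReal.ofReal τ) * R' ^ 2 * (ENNReal.ofReal κ * C1) +
          c1 * R' ^ 2 * (ENNReal.ofReal κ * (C2 * ENNReal.ofReal τ)) := by
            gcongr; exact hYw σ hσ
        _ = _ := by ring)
  have hp0 : p 0 = 0 := by ext1 l; simp [hp]
  have hpκ : p κ = (-Complex.I) • cubic a b lam1 lam2
          (fun δ => ∫ ρ in (0 : ℝ)..κ, (expKernel t - expKernel (θ ρ)) δ) w := by
    ext1 l
    simp only [hp, Pi.smul_apply]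
    rw [integral_cubic hKc hKb hwsum]
  simp only [hY0, ← hw, sub_self, hp0, hpκ, sub_zero] at h
  refine h.trans (le_of_eq ?_)
  push_cast; ring

end localError

/-! ### Quadrature kernels and their cancellation in time. -/

/-- The quadrature error of the midpoint rule for `e^{isδ/ε²}` on the `n`-th time step. -/
noncomputable def stepKernel (ε κ : ℝ) (n : ℕ) : ℝ → ℂ := fun δ =>
  ∫ ρ in (0 : ℝ)..κ, (expKernel ((n + 1 / 2) * (κ / ε ^ 2)) - expKernel ((n * κ + ρ) / ε ^ 2)) δ

/-- The accumulated quadrature error. -/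
noncomputable def sumKernel (ε κ : ℝ) (n : ℕ) : ℝ → ℂ := ∑ k ∈ Finset.range n, stepKernel ε κ k

section kernel
variable {ε κ : ℝ}

theorem stepKernel_eq (n : ℕ) (δ : ℝ) :
    stepKernel ε κ n δ = expKernel (κ / ε ^ 2 * δ) n * stepKernel ε κ 0 δ := by
  unfold stepKernel
  rw [← intervalIntegral.integral_const_mul]
  congr 1; ext ρ
  simp only [Pi.sub_apply, expKernel, mul_sub, ← Complex.exp_add]
  congr 2 <;> push_cast <;> ring

theorem norm_stepKernel_le (hκ : 0 ≤ κ) (n : ℕ) (δ : ℝ) : ‖stepKernel ε κ n δ‖ ≤ 2 * κ := by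
  have h := intervalIntegral.norm_integral_le_of_norm_le_const (a := 0) (b := κ) (C := 2)
    (f := fun ρ => (expKernel ((n + 1 / 2) * (κ / ε ^ 2)) - expKernel ((n * κ + ρ) / ε ^ 2)) δ)
    fun ρ _ => by
      refine (norm_sub_le _ _).trans ?_
      rw [norm_expKernel, norm_expKernel]; norm_num
  rwa [sub_zero, abs_of_nonneg hκ] at h

/-- The midpoint rule is exact on affine functions: the linear term of the exponential integrates to
zero, and only the quadratic Taylor remainder is left. -/
theorem norm_stepKernel_zero_le (hε : 0 < ε) (hκ : 0 ≤ κ) {δ : ℝ}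
    (hz : κ / ε ^ 2 * |δ| ≤ 1) : ‖stepKernel ε κ 0 δ‖ ≤ κ * (κ / ε ^ 2 * |δ|) ^ 2 := by
  set τ := κ / ε ^ 2 with hτ
  have hτ0 : 0 ≤ τ := by positivity
  set y : ℝ → ℝ := fun ρ => (ρ / ε ^ 2 - τ / 2) * δ with hy
  have hy0 : ∫ ρ in (0 : ℝ)..κ, (Complex.I * y ρ) = 0 := by
    rw [intervalIntegral.integral_const_mul, intervalIntegral.integral_ofReal]
    have : ∫ ρ in (0 : ℝ)..κ, y ρ = 0 := by
      simp only [hy]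
      rw [intervalIntegral.integral_mul_const, intervalIntegral.integral_sub (by
        apply Continuous.intervalIntegrable; fun_prop) (by simp), intervalIntegral.integral_div,
        integral_id, intervalIntegral.integral_const]
      simp only [smul_eq_mul, hτ]
      ring
    rw [this]; simp
  have e : stepKernel ε κ 0 δ = -(expKernel (τ / 2) δ *
      ∫ ρ in (0 : ℝ)..κ, (Complex.exp (Complex.I * y ρ) - 1 - Complex.I * y ρ)) := by
    rw [intervalIntegral.integral_sub (by apply Continuous.intervalIntegrable; fun_prop)
      (by apply Continuous.intervalIntegrable; fun_prop), hy0, sub_zero, stepKernel,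
      ← intervalIntegral.integral_const_mul, ← intervalIntegral.integral_neg]
    congr 1; ext ρ
    simp only [Pi.sub_apply, expKernel, mul_sub, ← Complex.exp_add, mul_one, hy, hτ]
    rw [neg_sub]
    congr 2 <;> push_cast <;> ring
  rw [e, norm_neg, norm_mul, norm_expKernel, one_mul]
  have hbound : ∀ ρ ∈ Set.uIoc 0 κ, ‖Complex.exp (Complex.I * y ρ) - 1 - Complex.I * y ρ‖ ≤
      (τ * |δ|) ^ 2 := by
    intro ρ hρ
    rw [Set.uIoc_of_le hκ] at hρ
    have h1 : |ρ / ε ^ 2 - τ / 2| ≤ τ := by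
      have h2 : ρ / ε ^ 2 ≤ τ := by rw [hτ]; gcongr; exact hρ.2
      have h3 : 0 ≤ ρ / ε ^ 2 := div_nonneg hρ.1.le (by positivity)
      rw [abs_le]; constructor <;> linarith
    have h2 : |y ρ| ≤ τ * |δ| := by
      simp only [hy, abs_mul]; gcongr
    have h3 : ‖Complex.I * (y ρ : ℂ)‖ = |y ρ| := by simp
    refine (Complex.norm_exp_sub_one_sub_id_le (by rw [h3]; linarith)).trans ?_
    rw [h3]; gcongr
  have h := intervalIntegral.norm_integral_le_of_norm_le_const hbound
  rw [sub_zero, abs_of_nonneg hκ] at h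
  linarith

/-- Successive kernels form a geometric progression of ratio e^{iτδ}. The sum is kept multiplied by
the denominator, which may vanish. -/
theorem sumKernel_mul (n : ℕ) (δ : ℝ) :
    sumKernel ε κ n δ * (expKernel (κ / ε ^ 2 * δ) 1 - 1) =
      (expKernel (κ / ε ^ 2 * δ) n - 1) * stepKernel ε κ 0 δ := by
  have hpow : ∀ n : ℕ, expKernel (κ / ε ^ 2 * δ) n = expKernel (κ / ε ^ 2 * δ) 1 ^ n := by
    intro n
    simp only [expKernel, ← Complex.exp_nat_mul]
    congr 1; push_cast; ring
  have h1 : sumKernel ε κ n δ =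
      (∑ k ∈ Finset.range n, expKernel (κ / ε ^ 2 * δ) 1 ^ k) * stepKernel ε κ 0 δ := by
    rw [sumKernel, Finset.sum_apply, Finset.sum_mul]
    exact Finset.sum_congr rfl fun k _ => by rw [stepKernel_eq, hpow]
  rw [h1, hpow n, ← geom_sum_mul]; ring

theorem norm_sumKernel_le (hκ : 0 ≤ κ) (n : ℕ) (δ : ℝ) : ‖sumKernel ε κ n δ‖ ≤ 2 * (n * κ) := by
  rw [sumKernel, Finset.sum_apply]
  refine (norm_sum_le_of_le _ fun k _ => norm_stepKernel_le hκ k δ).trans (le_of_eq ?_)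
  rw [Finset.sum_const, Finset.card_range, nsmul_eq_mul]; ring

/-- With z = τ|δ| ≤ 1/2 the denominator is at least z - z² ≥ z/2 and the numerator at most 2κz². One
power of z is lost, but the bound does not grow with n. -/
theorem norm_sumKernel_le_of_small (hε : 0 < ε) (hκ : 0 < κ) (n : ℕ) {δ : ℝ}
    (hz : κ / ε ^ 2 * |δ| ≤ 1 / 2) : ‖sumKernel ε κ n δ‖ ≤ 4 * κ * (κ / ε ^ 2 * |δ|) := by
  have hτ : 0 < κ / ε ^ 2 := by positivity
  have h0 := norm_stepKernel_zero_le hε hκ.le (δ := δ) (by linarith)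
  have hm := congrArg norm (sumKernel_mul (ε := ε) (κ := κ) n δ)
  rw [norm_mul, norm_mul] at hm
  set z := κ / ε ^ 2 * |δ| with hzdef
  have hz0 : 0 ≤ z := by positivity
  rcases hz0.eq_or_lt with hz1 | hz1
  · have hδ : δ = 0 := by
      rcases mul_eq_zero.1 (hzdef.symm.trans hz1.symm) with h | h
      · exact absurd h hτ.ne'
      · exact abs_eq_zero.1 h
    have : sumKernel ε κ n δ = 0 := by
      rw [sumKernel, Finset.sum_apply]
      refine Finset.sum_eq_zero fun k _ => ?_
      simp [stepKernel, hδ, expKernel]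
    rw [this, ← hz1]; simp
  · have h1 : ‖expKernel (κ / ε ^ 2 * δ) n - 1‖ ≤ 2 := by
      refine (norm_sub_le _ _).trans ?_
      rw [norm_expKernel]; norm_num
    have h2 : z / 2 ≤ ‖expKernel (κ / ε ^ 2 * δ) 1 - 1‖ := by
      have h3 : ‖Complex.I * ((κ / ε ^ 2 * δ : ℝ) : ℂ)‖ = z := by
        rw [norm_mul, Complex.norm_I, one_mul, Complex.norm_real, Real.norm_eq_abs, abs_mul,
          abs_of_pos hτ]
      have h4 := Complex.norm_exp_sub_one_sub_id_le
        (x := Complex.I * ((κ / ε ^ 2 * δ : ℝ) : ℂ)) (by rw [h3]; linarith)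
      rw [h3] at h4
      have h5 : expKernel (κ / ε ^ 2 * δ) 1 = Complex.exp (Complex.I * ((κ / ε ^ 2 * δ : ℝ) : ℂ)) := by
        simp [expKernel]
      have h6 := norm_sub_norm_le (Complex.I * ((κ / ε ^ 2 * δ : ℝ) : ℂ))
        (-(Complex.exp (Complex.I * ((κ / ε ^ 2 * δ : ℝ) : ℂ)) - 1 -
          Complex.I * ((κ / ε ^ 2 * δ : ℝ) : ℂ)))
      rw [norm_neg, h3, sub_neg_eq_add, add_sub_cancel] at h6
      rw [h5]
      nlinarith
    have h3 : ‖sumKernel ε κ n δ‖ * (z / 2) ≤ 2 * (κ * z ^ 2) :=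
      (mul_le_mul_of_nonneg_left h2 (norm_nonneg _)).trans
        (hm.le.trans (mul_le_mul h1 h0 (norm_nonneg _) zero_le_two))
    by_contra h
    push Not at h
    have := mul_lt_mul_of_pos_right h (half_pos hz1)
    nlinarith

/-- The non-resonant range τ|δ| ≤ 1/2 uses the geometric sum. Outside it, |δ| ≤ 2x gives 1 ≤ 4τx, so
the trivial bound 2nκ ≤ 2T may be multiplied by (4τx)^j. -/
theorem kernelBound_sumKernel (hε : 0 < ε) (hκ : 0 < κ) {T : ℝ} (j : ℕ) (hj : 1 ≤ j) {n : ℕ}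
    (hn : n * κ ≤ T) : KernelBound (sumKernel ε κ n)
      (ENNReal.ofReal (8 * κ * (κ / ε ^ 2) + 2 * T * 4 ^ j * (κ / ε ^ 2) ^ j)) j := by
  intro δ x hx hδ
  have hx0 : 0 ≤ x := by linarith
  have hτ : 0 < κ / ε ^ 2 := by positivity
  have hT : 0 ≤ T := le_trans (by positivity) hn
  rw [← ofReal_norm, ← ENNReal.ofReal_pow hx0, ← ENNReal.ofReal_mul (by positivity)]
  refine ENNReal.ofReal_le_ofReal ?_
  set τ := κ / ε ^ 2
  have hxj : x ≤ x ^ j := le_self_pow₀ hx (by omega)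
  rw [add_mul]
  by_cases hz : τ * |δ| ≤ 1 / 2
  · refine (norm_sumKernel_le_of_small hε hκ n hz).trans ?_
    have h1 : 4 * κ * (τ * |δ|) ≤ 8 * κ * τ * x ^ j := by
      calc 4 * κ * (τ * |δ|) ≤ 4 * κ * (τ * (2 * x)) := by gcongr
        _ = 8 * κ * τ * x := by ring
        _ ≤ _ := by gcongr
    have h2 : 0 ≤ 2 * T * 4 ^ j * τ ^ j * x ^ j := by positivity
    linarith
  · push Not at hz
    refine (norm_sumKernel_le hκ.le n δ).trans ?_
    have h1 : 1 ≤ 4 * τ * x := by nlinarith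
    have h2 : 1 ≤ (4 * τ * x) ^ j := one_le_pow₀ h1
    have h3 : 2 * (n * κ) ≤ 2 * T * (4 * τ * x) ^ j := by nlinarith
    have h4 : 0 ≤ 8 * κ * τ * x ^ j := by positivity
    have h5 : 2 * T * (4 * τ * x) ^ j = 2 * T * 4 ^ j * τ ^ j * x ^ j := by
      rw [mul_pow, mul_pow]; ring
    linarith

end kernel

/-! ### Summation by parts in time. -/

section abel
variable {a b lam1 lam2 : ℝ} {ε κ : ℝ}

theorem kernelBound_sumKernel_zero (hκ : 0 ≤ κ) (n : ℕ) :
    KernelBound (sumKernel ε κ n) (ENNReal.ofReal (2 * (n * κ))) 0 :=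
  kernelBound_of_le fun δ => by
    rw [← ofReal_norm]; exact ENNReal.ofReal_le_ofReal (norm_sumKernel_le hκ n δ)

/-- Abel summation: the oscillating kernels are summed, the slowly varying states differenced. -/
theorem sum_cubic_stepKernel (hab : a < b) (hκ : 0 ≤ κ) (χ : ℕ → ℤ → Spinor) (n : ℕ)
    (hχ : ∀ k < n, nrm a b 1 (χ k) ≠ ∞) :
    ∑ k ∈ Finset.range n, cubic a b lam1 lam2 (stepKernel ε κ k) (χ k) =
      cubic a b lam1 lam2 (sumKernel ε κ n) (χ n) -
      ∑ k ∈ Finset.range n, (cubic a b lam1 lam2 (sumKernel ε κ (k + 1)) (χ (k + 1)) -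
        cubic a b lam1 lam2 (sumKernel ε κ (k + 1)) (χ k)) := by
  induction n with
  | zero =>
    have : cubic a b lam1 lam2 (sumKernel ε κ 0) (χ 0) = 0 := by
      ext1 l; simp [cubic, interaction, sumKernel]
    simp [this]
  | succ n ih =>
    rw [Finset.sum_range_succ, Finset.sum_range_succ, ih fun k hk => hχ k (by omega)]
    have e : stepKernel ε κ n = sumKernel ε κ (n + 1) - sumKernel ε κ n := by
      rw [sumKernel, Finset.sum_range_succ, sumKernel, add_sub_cancel_left]
    rw [e, cubic_sub_kernel hab (kernelBound_sumKernel_zero hκ _) ENNReal.ofReal_ne_top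
      (kernelBound_sumKernel_zero hκ _) ENNReal.ofReal_ne_top (hχ n (by omega))]
    abel

/-- The accumulated leading part of the local errors, by summation by parts. -/
theorem exists_nrm_sum_cubic_stepKernel_le (lam1 lam2 : ℝ) (hab : a < b) (T : ℝ) (j : ℕ) (hj : 1 ≤ j)
    (R D : ℝ≥0) : ∃ C : ℝ≥0, ∀ ε κ : ℝ, 0 < ε → 0 < κ → ∀ n : ℕ, n * κ ≤ T →
      ∀ χ : ℕ → ℤ → Spinor, (∀ k ≤ n, nrm a b (j + 1) (χ k) ≤ R) →
      (∀ k < n, nrm a b (j + 1) (χ (k + 1) - χ k) ≤ D * ENNReal.ofReal κ) →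
      nrm a b 1 (∑ k ∈ Finset.range n, cubic a b lam1 lam2 (stepKernel ε κ k) (χ k)) ≤
        C * ENNReal.ofReal (κ * (κ / ε ^ 2) + (κ / ε ^ 2) ^ j) := by
  obtain ⟨c, hc⟩ : ∃ r : ℝ≥0, (r : ℝ≥0∞) = cubicC a b lam1 lam2 (j + 1) :=
    ⟨_, ENNReal.coe_toNNReal (cubicC_ne_top hab)⟩
  refine ⟨(c * R ^ 3 + c * R ^ 2 * D * T.toNNReal) * (8 + 2 * T.toNNReal * 4 ^ j), ?_⟩
  intro ε κ hε hκ n hn χ hχ hχd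
  have hT : 0 ≤ T := le_trans (by positivity) hn
  set τ := κ / ε ^ 2 with hτd
  have hτ : 0 < τ := by positivity
  set B := ENNReal.ofReal (8 * κ * τ + 2 * T * 4 ^ j * τ ^ j) with hB
  have hKB : ∀ k ≤ n, KernelBound (sumKernel ε κ k) B j := fun k hk =>
    kernelBound_sumKernel hε hκ j hj (le_trans (by gcongr) hn)
  have hBt : B ≠ ∞ := ENNReal.ofReal_ne_top
  have hRt : (R : ℝ≥0∞) ≠ ∞ := ENNReal.coe_ne_top
  rw [sum_cubic_stepKernel hab hκ.le χ n fun k hk => ne_top_of_le_ne_top hRt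
    ((nrm_le_of_le (by omega)).trans (hχ k hk.le))]
  have h1 : nrm a b 1 (cubic a b lam1 lam2 (sumKernel ε κ n) (χ n)) ≤ c * B * R ^ 3 := by
    rw [hc]; exact nrm_cubic_le hab (hKB n le_rfl) hBt rfl (by omega) hRt (hχ n le_rfl)
  have h2 : ∀ k ∈ Finset.range n, nrm a b 1 (cubic a b lam1 lam2 (sumKernel ε κ (k + 1)) (χ (k + 1)) -
        cubic a b lam1 lam2 (sumKernel ε κ (k + 1)) (χ k)) ≤
        c * B * R ^ 2 * (D * ENNReal.ofReal κ) := by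
    intro k hk
    have hk' := Finset.mem_range.1 hk
    refine (nrm_cubic_sub_le hab (hKB (k + 1) hk') hBt rfl (by omega) hRt (hχ _ hk')
      (hχ k hk'.le)).trans ?_
    rw [← hc]; gcongr; exact hχd k hk'
  refine (nrm_sub_le _ _).trans ((add_le_add h1 ((nrm_sum_le _ _).trans
    (Finset.sum_le_sum h2))).trans ?_)
  rw [Finset.sum_const, Finset.card_range, nsmul_eq_mul]
  -- The n difference terms each carry a factor κ from the increment of χ, so together they are no
  -- larger than the boundary term.
  have hnk : (n : ℝ≥0∞) * ENNReal.ofReal κ ≤ T.toNNReal := by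
    rw [← ENNReal.ofReal_natCast, ← ENNReal.ofReal_mul (by positivity)]
    exact ENNReal.ofReal_le_ofReal hn
  have hB2 : B ≤ (8 + 2 * T.toNNReal * 4 ^ j) * ENNReal.ofReal (κ * τ + τ ^ j) := by
    have : (8 + 2 * (T.toNNReal : ℝ≥0∞) * 4 ^ j) = ENNReal.ofReal (8 + 2 * T * 4 ^ j) := by
      rw [ENNReal.ofReal_add (by norm_num) (by positivity), ENNReal.ofReal_mul (by positivity),
        ENNReal.ofReal_mul (by norm_num), ENNReal.ofReal_pow (by norm_num)]
      simp [ENNReal.ofReal]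
    rw [this, ← ENNReal.ofReal_mul (by positivity), hB]
    refine ENNReal.ofReal_le_ofReal ?_
    have h3 : 0 ≤ 8 * τ ^ j := by positivity
    have h4 : 0 ≤ 2 * T * 4 ^ j * (κ * τ) := by positivity
    nlinarith
  calc _ = c * B * R ^ 3 + c * B * R ^ 2 * D * (n * ENNReal.ofReal κ) := by ring
    _ ≤ c * B * R ^ 3 + c * B * R ^ 2 * D * T.toNNReal := by gcongr
    _ = (c * R ^ 3 + c * R ^ 2 * D * T.toNNReal) * B := by ring
    _ ≤ (c * R ^ 3 + c * R ^ 2 * D * T.toNNReal) *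
      ((8 + 2 * T.toNNReal * 4 ^ j) * ENNReal.ofReal (κ * τ + τ ^ j)) := by gcongr
    _ = _ := by push_cast; ring

end abel

/-! ### Aliasing. -/

open Classical in
/-- The aliasing operator: the discrete Fourier coefficients of the grid values of a Fourier
series, extended by zero. -/
noncomputable def foldFreq (M : ℕ) (c : ℤ → Spinor) (l : ℤ) : Spinor :=
  if l ∈ freqs M then ∑' k : ℤ, c (l + k * M) else 0

section aliasing
variable {a b : ℝ} {M : ℕ}

/-- `∑_{k ≠ 0} k⁻²`. -/
noncomputable def invSqSum : ℝ≥0∞ := ∑' k : ℤ, ENNReal.ofReal (1 / |(k : ℝ)|) ^ 2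

theorem invSqSum_ne_top : invSqSum ≠ ∞ := by
  have h : ∀ k : ℤ, ENNReal.ofReal (1 / |(k : ℝ)|) ^ 2 = ENNReal.ofReal (1 / (k : ℝ) ^ 2) := by
    intro k
    rw [← ENNReal.ofReal_pow (by positivity)]
    congr 1; rw [div_pow, one_pow, sq_abs]
  unfold invSqSum
  simp_rw [h]
  exact (Real.summable_one_div_int_pow.2 (by norm_num)).tsum_ofReal_ne_top

theorem mem_freqs (hM : Even M) {l : ℤ} : l ∈ freqs M ↔ -(M : ℤ) ≤ 2 * l ∧ 2 * l < M := by
  obtain ⟨r, rfl⟩ := hM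
  unfold freqs
  rw [Finset.mem_Ico]; push_cast; omega

theorem abs_mu_eq (hab : a < b) (l : ℤ) : |mu a b l| = 2 * Real.pi * |(l : ℝ)| / (b - a) := by
  have : 0 < b - a := by linarith
  unfold mu
  rw [abs_div, abs_mul, abs_of_pos this, abs_of_pos (by positivity)]

theorem mul_le_om (hab : a < b) (hM0 : 0 < M) {l : ℤ} {x : ℝ} (h : x * M ≤ 2 * |(l : ℝ)|) :
    x * (Real.pi / ((b - a) / M)) ≤ om a b l := by
  have hba : 0 < b - a := by linarith
  have hM : (0 : ℝ) < M := by exact_mod_cast hM0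
  refine le_trans ?_ (abs_mu_le_om a b l)
  rw [abs_mu_eq hab, show x * (Real.pi / ((b - a) / M)) = Real.pi * (x * M) / (b - a) by
    field_simp]
  have := mul_le_mul_of_nonneg_left h Real.pi_pos.le
  exact div_le_div_of_nonneg_right (by linarith) hba.le

theorem om_le_of_mem_freqs (hab : a < b) (hM0 : 0 < M) (hM : Even M)
    (hh : (b - a) / M ≤ Real.pi) {l : ℤ} (hl : l ∈ freqs M) :
    om a b l ≤ 2 * (Real.pi / ((b - a) / M)) := by
  have hba : 0 < b - a := by linarith
  have hMp : (0 : ℝ) < M := by exact_mod_cast hM0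
  have hh0 : 0 < (b - a) / M := by positivity
  have h1 : 1 ≤ Real.pi / ((b - a) / M) := (one_le_div hh0).2 hh
  have h2 : |mu a b l| ≤ Real.pi / ((b - a) / M) := by
    rw [abs_mu_eq hab, show Real.pi / ((b - a) / M) = Real.pi * M / (b - a) by field_simp]
    have h3 : 2 * |(l : ℝ)| ≤ M := by
      rw [mem_freqs hM] at hl
      have : 2 * |l| ≤ (M : ℤ) := by
        rcases abs_cases l with h | h <;> omega
      exact_mod_cast this
    have := mul_le_mul_of_nonneg_left h3 Real.pi_pos.le
    exact div_le_div_of_nonneg_right (by linarith) hba.le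
  refine abs_le_of_sq_le_sq' ?_ (by linarith) |>.2
  rw [om_sq]
  have h3 : mu a b l ^ 2 ≤ (Real.pi / ((b - a) / M)) ^ 2 := sq_le_sq' (by linarith [neg_abs_le (mu a b l)]) (by linarith [le_abs_self (mu a b l)])
  nlinarith

/-- The retained frequencies lie in distinct residue classes mod M, so no frequency is counted
twice. -/
theorem tsum_freqs_le (hM0 : 0 < M) (hM : Even M) (f : ℤ → ℝ≥0∞) :
    ∑ l ∈ freqs M, ∑' k : ℤ, f (l + k * M) ≤ ∑' l, f l := by
  rw [← Finset.sum_coe_sort, ← tsum_fintype (L := .unconditional _), ← ENNReal.tsum_prod (f := fun (l : freqs M) (k : ℤ) =>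
    f (l + k * M))]
  refine ENNReal.tsum_comp_le_tsum_of_injective (f := fun i : freqs M × ℤ => (i.1 : ℤ) + i.2 * M)
    (fun x y hxy => ?_) f
  obtain ⟨⟨l, hl⟩, k⟩ := x
  obtain ⟨⟨l', hl'⟩, k'⟩ := y
  dsimp only at hxy
  rw [mem_freqs hM] at hl hl'
  have hk : k = k' := by
    by_contra hne
    have hMz : (0 : ℤ) < M := by exact_mod_cast hM0
    rcases lt_or_gt_of_ne hne with h | h
    · nlinarith [mul_le_mul_of_nonneg_right (show k + 1 ≤ k' by omega) hMz.le]
    · nlinarith [mul_le_mul_of_nonneg_right (show k' + 1 ≤ k by omega) hMz.le]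
  subst hk
  have : l = l' := by linarith
  subst this; rfl

theorem summable_shift (hM0 : 0 < M) {c : ℤ → Spinor} (hc : Summable fun l => ‖c l‖) (l : ℤ) :
    Summable fun k : ℤ => c (l + k * M) := by
  refine Summable.of_norm (hc.comp_injective (i := fun k : ℤ => l + k * M) fun x y h => ?_)
  have hMz : (M : ℤ) ≠ 0 := by exact_mod_cast hM0.ne'
  exact mul_right_cancel₀ hMz (add_left_cancel h)

theorem foldFreq_sub (hab : a < b) (hM0 : 0 < M) {k : ℕ} (hk : 1 ≤ k) {u v : ℤ → Spinor}
    (hu : nrm a b k u ≠ ∞) (hv : nrm a b k v ≠ ∞) :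
    foldFreq M (u - v) = foldFreq M u - foldFreq M v := by
  ext1 l
  simp only [foldFreq, Pi.sub_apply]
  split_ifs
  · exact (summable_shift hM0 (summable_norm_of_nrm hab hk hu) l).tsum_sub
      (summable_shift hM0 (summable_norm_of_nrm hab hk hv) l)
  · simp

theorem foldFreq_of_bandlimited (hM0 : 0 < M) (hM : Even M) {u : ℤ → Spinor}
    (hu : ∀ l ∉ freqs M, u l = 0) : foldFreq M u = u := by
  ext1 l
  unfold foldFreq
  split_ifs with hl
  · rw [tsum_eq_single 0]
    · simp
    · intro k hk
      refine hu _ fun h => ?_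
      rw [mem_freqs hM] at hl h
      have hMz : (0 : ℤ) < M := by exact_mod_cast hM0
      rcases lt_or_gt_of_ne hk with h' | h'
      · nlinarith [mul_le_mul_of_nonneg_right (show k + 1 ≤ 0 by omega) hMz.le]
      · nlinarith [mul_le_mul_of_nonneg_right (show 1 ≤ k by omega) hMz.le]
  · exact (hu l hl).symm

/-- A retained mode receives the aliases l + kM, k ≠ 0, whose weights are at least |k|π/h. Of the j
+ 1 powers of h/π thus gained, one pays for the H¹ weight on the left; a factor 1/|k| is kept to sum
over k by Cauchy–Schwarz. -/
theorem sq_foldFreq_sub_le (hab : a < b) (hM0 : 0 < M) (hM : Even M) (hh : (b - a) / M ≤ Real.pi)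
    (j : ℕ) {c : ℤ → Spinor} (hsum : Summable fun l => ‖c l‖) {l : ℤ} (hl : l ∈ freqs M) :
    (wt a b l ^ 1 * ‖(foldFreq M c - c) l‖ₑ) ^ 2 ≤
      4 * invSqSum * (ENNReal.ofReal (Real.pi / ((b - a) / M))⁻¹ ^ j) ^ 2 *
        ∑' k : ℤ, (wt a b (l + k * M) ^ (j + 1) * ‖c (l + k * M)‖ₑ) ^ 2 := by
  have hba : 0 < b - a := by linarith
  have hMp : (0 : ℝ) < M := by exact_mod_cast hM0
  set h := (b - a) / M with hhd
  have hh0 : 0 < h := by positivity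
  set q := Real.pi / h with hq
  have hq1 : 1 ≤ q := (one_le_div hh0).2 hh
  have hq0 : 0 < q := by linarith
  set Q := ENNReal.ofReal q⁻¹ with hQ
  have hqQ : ENNReal.ofReal q * Q = 1 := by
    rw [hQ, ← ENNReal.ofReal_mul hq0.le, mul_inv_cancel₀ hq0.ne', ENNReal.ofReal_one]
  have hlow : ∀ (x : ℝ) (l : ℤ), 0 ≤ x → x * M ≤ 2 * |(l : ℝ)| →
      ENNReal.ofReal (x * q) ≤ wt a b l := fun x l hx hl =>
    ENNReal.ofReal_le_ofReal (mul_le_om hab hM0 hl)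
  have hex : ∃ y : ℤ → ℝ≥0∞, y = fun l => wt a b l ^ (j + 1) * ‖c l‖ₑ := ⟨_, rfl⟩
  obtain ⟨y, hy⟩ := hex
  have hgoal : ∀ k : ℤ, wt a b (l + k * M) ^ (j + 1) * ‖c (l + k * M)‖ₑ = y (l + k * M) :=
    fun k => by rw [hy]
  simp_rw [hgoal]
  -- At k = 0 the convention 1/0 = 0 removes the term, matching the missing main mode.
  have hcs := tsum_mul_sq_le (fun k : ℤ => ENNReal.ofReal (1 / |(k : ℝ)|))
    (fun k : ℤ => y (l + k * M))
  rw [← invSqSum] at hcs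
  have h1 : (foldFreq M c - c) l = ∑' k : ℤ, if k = 0 then 0 else c (l + k * M) := by
    rw [Pi.sub_apply, foldFreq, if_pos hl,
      (summable_shift hM0 hsum l).tsum_eq_add_tsum_ite 0]
    simp
  have h2 : ∀ k : ℤ, ‖if k = 0 then 0 else c (l + k * M)‖ₑ ≤
      Q ^ (j + 1) * (ENNReal.ofReal (1 / |(k : ℝ)|) * y (l + k * M)) := by
    intro k
    split_ifs with hk
    · simp
    · have hk1 : 1 ≤ |(k : ℝ)| := by exact_mod_cast Int.one_le_abs hk
      have h3 : ENNReal.ofReal (|(k : ℝ)| * q) ≤ wt a b (l + k * M) := by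
        refine hlow _ _ (abs_nonneg _) ?_
        rw [mem_freqs hM] at hl
        have hMz : (0 : ℤ) < M := by exact_mod_cast hM0
        have h5 : 1 ≤ |k| := Int.one_le_abs hk
        have h6 : 2 * |l| ≤ (M : ℤ) := by rcases abs_cases l with h | h <;> omega
        have h7 : |k| * M ≤ |l + k * M| + |l| := by
          have := abs_sub (l + k * M) l
          rw [add_sub_cancel_left, abs_mul, abs_of_pos hMz] at this
          exact this
        -- |l + kM| ≥ |k|M - M/2 ≥ |k|M/2, because |l| ≤ M/2 and |k| ≥ 1.
        have h4 : |k| * M ≤ 2 * |l + k * M| := by nlinarith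
        exact_mod_cast h4
      have h4 : 1 ≤ Q ^ (j + 1) * (ENNReal.ofReal (1 / |(k : ℝ)|) * wt a b (l + k * M) ^ (j + 1))
          := by
        calc (1 : ℝ≥0∞) = ENNReal.ofReal (1 / |(k : ℝ)| * |(k : ℝ)|) := by
              rw [one_div_mul_cancel (by linarith), ENNReal.ofReal_one]
          _ ≤ ENNReal.ofReal (1 / |(k : ℝ)| * |(k : ℝ)| ^ (j + 1)) := by
              refine ENNReal.ofReal_le_ofReal ?_
              gcongr; exact le_self_pow₀ hk1 (by omega)
          _ = (ENNReal.ofReal q * Q) ^ (j + 1) *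
              (ENNReal.ofReal (1 / |(k : ℝ)|) * ENNReal.ofReal |(k : ℝ)| ^ (j + 1)) := by
              rw [hqQ, one_pow, one_mul, ENNReal.ofReal_mul (by positivity),
                ENNReal.ofReal_pow (abs_nonneg _)]
          _ = Q ^ (j + 1) * (ENNReal.ofReal (1 / |(k : ℝ)|) *
              ENNReal.ofReal (|(k : ℝ)| * q) ^ (j + 1)) := by
              rw [ENNReal.ofReal_mul (abs_nonneg _), mul_pow, mul_pow]; ring
          _ ≤ _ := by gcongr
      calc ‖c (l + k * M)‖ₑ = 1 * ‖c (l + k * M)‖ₑ := (one_mul _).symm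
        _ ≤ _ := mul_le_mul_left h4 _
        _ = _ := by simp only [hy]; ring
  have h3 : ‖(foldFreq M c - c) l‖ₑ ≤
      Q ^ (j + 1) * ∑' k : ℤ, ENNReal.ofReal (1 / |(k : ℝ)|) * y (l + k * M) := by
    rw [h1, ← ENNReal.tsum_mul_left]
    exact enorm_tsum_le_tsum_enorm.trans (ENNReal.tsum_le_tsum h2)
  have h4 : wt a b l ≤ 2 * ENNReal.ofReal q := by
    rw [← ENNReal.ofReal_ofNat, ← ENNReal.ofReal_mul zero_le_two]
    exact ENNReal.ofReal_le_ofReal (om_le_of_mem_freqs hab hM0 hM hh hl)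
  calc (wt a b l ^ 1 * ‖(foldFreq M c - c) l‖ₑ) ^ 2
      ≤ ((2 * ENNReal.ofReal q) * (Q ^ (j + 1) *
        ∑' k : ℤ, ENNReal.ofReal (1 / |(k : ℝ)|) * y (l + k * M))) ^ 2 := by
        rw [pow_one]; gcongr
    _ = 4 * (Q ^ j) ^ 2 * (ENNReal.ofReal q * Q) ^ 2 *
        (∑' k : ℤ, ENNReal.ofReal (1 / |(k : ℝ)|) * y (l + k * M)) ^ 2 := by ring
    _ ≤ 4 * (Q ^ j) ^ 2 * 1 * (invSqSum * ∑' k : ℤ, y (l + k * M) ^ 2) := by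
        rw [hqQ, one_pow]; exact mul_le_mul' le_rfl hcs
    _ = _ := by ring

/-- The aliasing error is of order `h^j` from `H^{j+1}` to `H¹`. -/
theorem nrm_foldFreq_sub_le (hab : a < b) (hM0 : 0 < M) (hM : Even M) (hh : (b - a) / M ≤ Real.pi)
    (j : ℕ) {c : ℤ → Spinor} (hc : nrm a b (j + 1) c ≠ ∞) :
    nrm a b 1 (foldFreq M c - c) ≤
      (4 * invSqSum + 1) * ENNReal.ofReal ((b - a) / M) ^ j * nrm a b (j + 1) c := by
  have hba : 0 < b - a := by linarith
  have hMp : (0 : ℝ) < M := by exact_mod_cast hM0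
  set h := (b - a) / M with hhd
  have hh0 : 0 < h := by positivity
  set q := Real.pi / h with hq
  have hq1 : 1 ≤ q := (one_le_div hh0).2 hh
  have hq0 : 0 < q := by linarith
  have hqh : q⁻¹ ≤ h := by
    rw [hq, inv_div]
    exact div_le_self hh0.le (by linarith [Real.pi_gt_three])
  set y : ℤ → ℝ≥0∞ := fun l => wt a b l ^ (j + 1) * ‖c l‖ₑ with hy
  set Q := ENNReal.ofReal q⁻¹ with hQ
  have hsum := summable_norm_of_nrm hab (by omega) hc
  have hqQ : ENNReal.ofReal q * Q = 1 := by
    rw [hQ, ← ENNReal.ofReal_mul hq0.le, mul_inv_cancel₀ hq0.ne', ENNReal.ofReal_one]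
  have hlow : ∀ (x : ℝ) (l : ℤ), 0 ≤ x → x * M ≤ 2 * |(l : ℝ)| →
      ENNReal.ofReal (x * q) ≤ wt a b l := fun x l hx hl =>
    ENNReal.ofReal_le_ofReal (mul_le_om hab hM0 hl)
  -- Outside the retained range the error is the discarded tail, with weight at least π/h.
  have hout : ∀ l ∉ freqs M, (fun l => wt a b l ^ 1 * ‖(foldFreq M c - c) l‖ₑ) l ≤ Q ^ j * y l := by
    intro l hl
    have h1 : (foldFreq M c - c) l = - c l := by simp [foldFreq, hl]
    have h2 : ENNReal.ofReal q ≤ wt a b l := by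
      rw [← one_mul q]
      refine hlow 1 l zero_le_one ?_
      rw [mem_freqs hM] at hl
      have : (M : ℤ) ≤ 2 * |l| := by rcases abs_cases l with h | h <;> omega
      rw [one_mul]; exact_mod_cast this
    simp only [h1, enorm_neg, hy, pow_one]
    calc wt a b l * ‖c l‖ₑ = (ENNReal.ofReal q * Q) ^ j * (wt a b l * ‖c l‖ₑ) := by simp [hqQ]
      _ = Q ^ j * (ENNReal.ofReal q ^ j * wt a b l * ‖c l‖ₑ) := by rw [mul_pow]; ring
      _ ≤ Q ^ j * (wt a b l ^ j * wt a b l * ‖c l‖ₑ) := by gcongr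
      _ = _ := by simp only [pow_succ]
  have hin : ∀ l ∈ freqs M, (wt a b l ^ 1 * ‖(foldFreq M c - c) l‖ₑ) ^ 2 ≤
      4 * invSqSum * (Q ^ j) ^ 2 * ∑' k : ℤ, y (l + k * M) ^ 2 := fun l hl =>
    sq_foldFreq_sub_le hab hM0 hM hh j hsum hl
  have hQh : Q ≤ ENNReal.ofReal h := ENNReal.ofReal_le_ofReal hqh
  suffices hs : nrm a b 1 (foldFreq M c - c) ≤ (4 * invSqSum + 1) * Q ^ j * nrm a b (j + 1) c from
    hs.trans (by gcongr)
  rw [← sq_le_sq_iff_ennreal, nrm, ltwo_sq]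
  have hsplit : ∑' l, (fun l => wt a b l ^ 1 * ‖(foldFreq M c - c) l‖ₑ) l ^ 2 ≤
      ∑ l ∈ freqs M, (fun l => wt a b l ^ 1 * ‖(foldFreq M c - c) l‖ₑ) l ^ 2 + ∑' l, (Q ^ j * y l) ^ 2 := by
    classical
    generalize (fun l => wt a b l ^ 1 * ‖(foldFreq M c - c) l‖ₑ) = g at hout ⊢
    have h1 : ∀ l, g l ^ 2 ≤ (if l ∈ freqs M then g l ^ 2 else 0) + (Q ^ j * y l) ^ 2 := by
      intro l
      by_cases hl : l ∈ freqs M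
      · rw [if_pos hl]; exact le_self_add
      · exact le_add_left (pow_le_pow_left' (hout l hl) 2)
    refine (ENNReal.tsum_le_tsum h1).trans (le_of_eq ?_)
    rw [ENNReal.tsum_add, tsum_eq_sum (s := freqs M) fun l hl => if_neg hl]
    congr 1
    exact Finset.sum_congr rfl fun l hl => if_pos hl
  calc _ ≤ _ := hsplit
    _ ≤ ∑ l ∈ freqs M, 4 * invSqSum * (Q ^ j) ^ 2 * ∑' k : ℤ, y (l + k * M) ^ 2 +
        (Q ^ j) ^ 2 * ∑' l, y l ^ 2 := by
        simp_rw [mul_pow (Q ^ j) _ 2, ENNReal.tsum_mul_left]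
        gcongr with l hl
        exact hin l hl
    _ ≤ 4 * invSqSum * (Q ^ j) ^ 2 * ∑' l, y l ^ 2 + (Q ^ j) ^ 2 * ∑' l, y l ^ 2 := by
        rw [← Finset.mul_sum]
        gcongr
        exact tsum_freqs_le hM0 hM fun l => y l ^ 2
    _ = (4 * invSqSum + 1) * (Q ^ j) ^ 2 * nrm a b (j + 1) c ^ 2 := by
        rw [nrm, ltwo_sq]; ring
    -- The constant is at least 1, so squaring it avoids a square root.
    _ ≤ (4 * invSqSum + 1) ^ 2 * (Q ^ j) ^ 2 * nrm a b (j + 1) c ^ 2 := by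
        gcongr
        rw [sq]; exact le_mul_of_one_le_left' le_add_self
    _ = _ := by ring

end aliasing

/-! ### Matrix exponentials, discrete Fourier transform, band-limited sequences. -/

theorem exp_mulVec_of_eigenvector {ι : Type*} [Fintype ι] [DecidableEq ι] {A : Matrix ι ι ℂ}
    {v : ι → ℂ} {c : ℂ} (h : Matrix.mulVec A v = c • v) :
    Matrix.mulVec (NormedSpace.exp A) v = Complex.exp c • v := by
  let _ : NormedRing (Matrix ι ι ℂ) := Matrix.linftyOpNormedRing
  let _ : NormedAlgebra ℂ (Matrix ι ι ℂ) := Matrix.linftyOpNormedAlgebra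
  have hp : ∀ n : ℕ, Matrix.mulVec (A ^ n) v = c ^ n • v := by
    intro n
    induction n with
    | zero => simp
    | succ n ih => rw [pow_succ, ← Matrix.mulVec_mulVec, h, Matrix.mulVec_smul, ih, smul_smul,
        pow_succ']
  have h1 : HasSum (fun n : ℕ => ((n.factorial : ℂ)⁻¹) • A ^ n) (NormedSpace.exp A) :=
    NormedSpace.exp_series_hasSum_exp' A
  have h2 : HasSum (fun n : ℕ => ((n.factorial : ℂ)⁻¹) • c ^ n) (NormedSpace.exp c) :=
    NormedSpace.exp_series_hasSum_exp' c
  have h3 := h1.map (⟨⟨fun B => Matrix.mulVec B v, Matrix.zero_mulVec v⟩,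
    fun B B' => Matrix.add_mulVec B B' v⟩ : Matrix ι ι ℂ →+ (ι → ℂ))
    (Continuous.matrix_mulVec continuous_id continuous_const)
  have h4 := h2.smul_const v
  rw [Complex.exp_eq_exp_ℂ]
  refine h3.unique (h4.congr_fun ?_)
  intro n
  change Matrix.mulVec _ _ = _
  rw [Matrix.smul_mulVec, hp, smul_smul, smul_eq_mul]

theorem exp_Gam_mulVec (a b θ : ℝ) (l : ℤ) (v : Spinor) :
    Matrix.mulVec (NormedSpace.exp ((-(Complex.I * θ)) • Gam a b l)) v = prop a b θ l v := by
  conv_lhs => rw [← specProj_add (a := a) (b := b) (l := l) v]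
  rw [Matrix.mulVec_sum]
  simp only [prop, sum_apply, smul_apply]
  refine Finset.sum_congr rfl fun η _ => ?_
  rw [exp_mulVec_of_eigenvector (c := -(Complex.I * θ * (sgn η * om a b l : ℝ)))]
  rw [Matrix.smul_mulVec, Gam_specProj, smul_smul]
  congr 1; ring

open Classical in
/-- The discrete Fourier coefficients, extended by zero. -/
noncomputable def dftS (M : ℕ) (U : GridFun M) (l : ℤ) : Spinor :=
  if l ∈ freqs M then dft M U l else 0

/-- Orthogonality of the M-th roots of unity, by the geometric sum. -/
theorem sum_exp_div (M : ℕ) (hM : 0 < M) (p : ℤ) :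
    (M : ℂ)⁻¹ * ∑ j : Fin M, Complex.exp (2 * Real.pi * Complex.I * p * ((j : ℕ) : ℂ) / M) =
      if (M : ℤ) ∣ p then 1 else 0 := by
  have hM' : (M : ℂ) ≠ 0 := by exact_mod_cast hM.ne'
  set z := Complex.exp (2 * Real.pi * Complex.I * p / M) with hz
  have h1 : ∀ j : Fin M, Complex.exp (2 * Real.pi * Complex.I * p * ((j : ℕ) : ℂ) / M) =
      z ^ (j : ℕ) := by
    intro j
    rw [hz, ← Complex.exp_nat_mul]; congr 1; ring
  simp_rw [h1]
  rw [Fin.sum_univ_eq_sum_range (fun j => z ^ j) M]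
  have hzM : z ^ M = 1 := by
    rw [hz, ← Complex.exp_nat_mul, Complex.exp_eq_one_iff]
    exact ⟨p, by field_simp⟩
  have hz1 : z = 1 ↔ (M : ℤ) ∣ p := by
    rw [hz, Complex.exp_eq_one_iff]
    constructor
    · rintro ⟨n, hn⟩
      refine ⟨n, ?_⟩
      have hpi : (2 * Real.pi * Complex.I : ℂ) ≠ 0 := Complex.two_pi_I_ne_zero
      have h2 : (p : ℂ) = M * n := by
        field_simp at hn
        exact hn
      exact_mod_cast h2
    · rintro ⟨n, rfl⟩
      exact ⟨n, by push_cast; field_simp⟩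
  split_ifs with h
  · rw [hz1.2 h]; simp [hM']
  · have h2 := mul_geom_sum z M
    rw [hzM, sub_self] at h2
    rcases mul_eq_zero.1 h2 with h3 | h3
    · exact absurd (hz1.1 (sub_eq_zero.1 h3)) h
    · rw [h3, mul_zero]

section
variable {a b : ℝ}

theorem mode_eq_fourier (l : ℤ) (x : ℝ) :
    mode a b l x = fourier l ((x - a : ℝ) : AddCircle (b - a)) := by
  rw [fourier_coe_apply, mode, mu]
  congr 1
  push_cast
  ring

theorem nrm_ne_top_of_bandlimited {k : ℕ} {u : ℤ → Spinor} {S : Finset ℤ}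
    (hu : ∀ l ∉ S, u l = 0) : nrm a b k u ≠ ∞ := by
  unfold nrm ltwo
  refine ENNReal.rpow_ne_top_of_nonneg (by norm_num) ?_
  rw [tsum_eq_sum (s := S) fun l hl => by simp [hu l hl]]
  exact ENNReal.sum_ne_top.2 fun l _ => ENNReal.pow_ne_top (ENNReal.mul_ne_top
    (ENNReal.pow_ne_top (wt_ne_top _ _ _)) enorm_ne_top)

theorem propSeq_bandlimited {θ : ℝ} {u : ℤ → Spinor} {S : Finset ℤ} (hu : ∀ l ∉ S, u l = 0) :
    ∀ l ∉ S, propSeq a b θ u l = 0 := fun l hl => by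
  rw [propSeq, hu l hl, map_zero]

end

/-! ### The scheme on the Fourier side. -/

section samples
variable {a b : ℝ} [hF : Fact (0 < b - a)] {M : ℕ}

/-- A pair of functions on the circle of length `b - a` as a spinor field on the line. -/
noncomputable def evalAt (v : Fin 2 → C(AddCircle (b - a), ℂ)) (x : ℝ) : Spinor := fun i =>
  v i ((x - a : ℝ) : AddCircle (b - a))

/-- The grid values of a spinor field. -/
noncomputable def sample (M : ℕ) (v : Fin 2 → C(AddCircle (b - a), ℂ)) : GridFun M := fun j =>
  evalAt v (gridPt a b M j)

theorem hasSum_evalAt_synthS {u : ℤ → Spinor} (hu : ∀ i, Summable fun l => ‖u l i‖) (x : ℝ) :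
    HasSum (fun l => mode a b l x • u l) (evalAt (synthS (b - a) u) x) := by
  rw [Pi.hasSum]
  intro i
  have h := ((ContinuousMap.evalCLM ℂ ((x - a : ℝ) : AddCircle (b - a))).hasSum
    (summable_synth (L := b - a) (hu i)).hasSum)
  refine h.congr_fun fun l => ?_
  rw [Pi.smul_apply, mode_eq_fourier, smul_eq_mul, mul_comm]
  rfl

theorem dftS_of_notMem {U : GridFun M} {l : ℤ} (hl : l ∉ freqs M) : dftS M U l = 0 := if_neg hl

/-- The aliasing formula: orthogonality of roots of unity selects the frequencies congruent to l mod
M. -/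
theorem dft_sample_synthS (hM0 : 0 < M) {u : ℤ → Spinor} (hu : Summable fun l => ‖u l‖) (l : ℤ) :
    dft M (sample M (synthS (b - a) u)) l = ∑' k : ℤ, u (l + k * M) := by
  have hM' : (M : ℂ) ≠ 0 := by exact_mod_cast hM0.ne'
  have hba : (b - a : ℂ) ≠ 0 := by exact_mod_cast hF.out.ne'
  have hui : ∀ i, Summable fun l => ‖u l i‖ := fun i =>
    Summable.of_nonneg_of_le (fun _ => norm_nonneg _) (fun l => norm_le_pi_norm (u l) i) hu
  have h1 := (hasSum_sum (s := Finset.univ) fun (j : Fin M) _ =>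
    ((hasSum_evalAt_synthS (a := a) (b := b) hui (gridPt a b M j.castSucc)).const_smul
      (Complex.exp (-(2 * Complex.I * ((j : ℕ) : ℂ) * l * Real.pi / M))))).const_smul (M : ℂ)⁻¹
  have h2 : HasSum (fun p : ℤ => (if (M : ℤ) ∣ p - l then (1 : ℂ) else 0) • u p)
      (dft M (sample M (synthS (b - a) u)) l) := by
    refine h1.congr_fun fun p => ?_
    rw [← sum_exp_div M hM0, ← smul_smul, Finset.sum_smul]
    congr 1
    refine Finset.sum_congr rfl fun j _ => ?_
    rw [smul_smul, mode, ← Complex.exp_add, gridPt, mu]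
    congr 2
    push_cast [Fin.val_castSucc]
    field_simp
    ring
  have hinj : Function.Injective fun k : ℤ => l + k * M := fun x y h => by
    have hMz : (M : ℤ) ≠ 0 := by exact_mod_cast hM0.ne'
    exact mul_right_cancel₀ hMz (add_left_cancel h)
  rw [← hinj.hasSum_iff] at h2
  · refine (h2.congr_fun fun k => ?_).tsum_eq.symm
    simp
  · intro p hp
    rw [if_neg, zero_smul]
    rintro ⟨k, hk⟩
    exact hp ⟨k, by simp only; linarith⟩

theorem dftS_sample_synthS (hM0 : 0 < M) {u : ℤ → Spinor} (hu : Summable fun l => ‖u l‖) :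
    dftS M (sample M (synthS (b - a) u)) = foldFreq M u := by
  ext1 l
  unfold dftS foldFreq
  rw [dft_sample_synthS hM0 hu]

theorem summable_comp_of_bandlimited {u : ℤ → Spinor} {S : Finset ℤ} (hu : ∀ l ∉ S, u l = 0)
    (i : Fin 2) : Summable fun l => ‖u l i‖ :=
  summable_of_ne_finset_zero (s := S) fun l hl => by simp [hu l hl]

theorem evalAt_synthS_bandlimited {u : ℤ → Spinor} {S : Finset ℤ} (hu : ∀ l ∉ S, u l = 0) (x : ℝ) :
    evalAt (synthS (b - a) u) x = ∑ l ∈ S, mode a b l x • u l :=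
  (hasSum_evalAt_synthS (summable_comp_of_bandlimited hu) x).unique
    (hasSum_sum_of_ne_finset_zero fun l hl => by simp [hu l hl])

theorem interp_eq (U : GridFun M) (x : ℝ) :
    interp a b M U x = evalAt (synthS (b - a) (dftS M U)) x := by
  rw [evalAt_synthS_bandlimited fun l hl => dftS_of_notMem hl, interp]
  exact Finset.sum_congr rfl fun l hl => by rw [dftS, if_pos hl]

theorem linHalfStep_eq (ε κ : ℝ) (U : GridFun M) :
    linHalfStep a b ε κ M U =
      sample M (synthS (b - a) (propSeq a b (κ / (2 * ε ^ 2)) (dftS M U))) := by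
  ext1 j
  rw [sample, evalAt_synthS_bandlimited (propSeq_bandlimited fun l hl => dftS_of_notMem hl),
    linHalfStep]
  refine Finset.sum_congr rfl fun l hl => ?_
  rw [propSeq, dftS, if_pos hl, ← exp_Gam_mulVec]
  congr 4
  push_cast; ring

theorem nonlinF_eq_diagonal (lam1 lam2 : ℝ) (v : Spinor) : nonlinF lam1 lam2 v =
    Matrix.diagonal fun i => ∑ j, cubCoeff lam1 lam2 i j * (v j * conj (v j)) := by
  ext i j
  fin_cases i <;> fin_cases j <;>
    simp [nonlinF, sigma3, Matrix.mulVec, dotProduct, Fin.sum_univ_two, cubCoeff] <;> ring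

/-- The matrix is diagonal, and evaluation at a point is a continuous algebra homomorphism, so it
commutes with the exponential. The grid step is therefore the sampled exact flow. -/
theorem evalAt_flowFun (lam1 lam2 σ : ℝ) (v : Fin 2 → C(AddCircle (b - a), ℂ)) (x : ℝ) :
    Matrix.mulVec (NormedSpace.exp ((-(Complex.I * σ)) • nonlinF lam1 lam2 (evalAt v x)))
      (evalAt v x) = evalAt (flowFun lam1 lam2 σ v) x := by
  ext i
  set t : AddCircle (b - a) := ((x - a : ℝ) : AddCircle (b - a))
  rw [nonlinF_eq_diagonal, ← Matrix.diagonal_smul, Matrix.exp_diagonal, Matrix.mulVec_diagonal,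
    Pi.coe_exp]
  have h := NormedSpace.map_exp (ContinuousMap.evalAlgHom ℂ ℂ t)
    (ContinuousMap.evalCLM ℂ t).continuous ((-(Complex.I * σ)) • potential lam1 lam2 v i)
  change _ = (NormedSpace.exp ((-(Complex.I * σ)) • potential lam1 lam2 v i) * v i) t
  rw [ContinuousMap.mul_apply]
  change (NormedSpace.exp ((-(Complex.I * σ)) • potential lam1 lam2 v i)) t = _ at h
  rw [h]
  congr 2

theorem nonlinStep_sample (lam1 lam2 κ : ℝ) (v : Fin 2 → C(AddCircle (b - a), ℂ)) :
    nonlinStep lam1 lam2 κ M (sample M v) = sample M (flowFun lam1 lam2 κ v) := by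
  ext1 j
  exact evalAt_flowFun lam1 lam2 κ v _

/-- The discrete solution on the Fourier side. -/
theorem dftS_tsfp_succ (ε lam1 lam2 κ : ℝ) (hκ0 : 0 ≤ κ) (hκ1 : κ ≤ 1) (hM0 : 0 < M) (hM : Even M)
    (u₀ : ℝ → Spinor) (n : ℕ) :
    dftS M (tsfp a b ε lam1 lam2 κ M u₀ (n + 1)) =
      propSeq a b (κ / (2 * ε ^ 2)) (foldFreq M (flow (b - a) lam1 lam2 κ
        (propSeq a b (κ / (2 * ε ^ 2)) (dftS M (tsfp a b ε lam1 lam2 κ M u₀ n))))) := by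
  have hab : a < b := by linarith [hF.out]
  rw [tsfp, linHalfStep_eq, linHalfStep_eq]
  set V := propSeq a b (κ / (2 * ε ^ 2)) (dftS M (tsfp a b ε lam1 lam2 κ M u₀ n)) with hV
  have hVt : nrm a b 1 V ≠ ∞ := nrm_ne_top_of_bandlimited (S := freqs M)
    (propSeq_bandlimited fun l hl => dftS_of_notMem hl)
  have hW : nrm a b 1 (flow (b - a) lam1 lam2 κ V) ≠ ∞ := by
    lift nrm a b 1 V to ℝ≥0 using hVt with r hr
    obtain ⟨C, hC⟩ := exists_nrm_flow_sub_self_le (b - a) lam1 lam2 hab le_rfl r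
    have h1 := nrm_add_le (a := a) (b := b) (k := 1) (flow (b - a) lam1 lam2 κ V - V) V
    rw [sub_add_cancel] at h1
    refine ne_top_of_le_ne_top ?_ (h1.trans (add_le_add (hC V hr.ge κ hκ0 hκ1) hr.ge))
    finiteness
  -- The flow has a summable Fourier series, so it may be resynthesized from its coefficients;
  -- sampling it then introduces exactly the aliasing operator.
  have hsyn : flowFun lam1 lam2 κ (synthS (b - a) V) =
      synthS (b - a) (flow (b - a) lam1 lam2 κ V) := (synthS_coefS hab le_rfl hW).symm
  rw [nonlinStep_sample, hsyn, dftS_sample_synthS hM0 (summable_norm_of_nrm hab le_rfl hW)]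
  have hbl : ∀ l ∉ freqs M, propSeq a b (κ / (2 * ε ^ 2))
      (foldFreq M (flow (b - a) lam1 lam2 κ V)) l = 0 :=
    propSeq_bandlimited fun l hl => if_neg hl
  rw [dftS_sample_synthS hM0 (summable_norm_of_nrm hab le_rfl
    (nrm_ne_top_of_bandlimited hbl)), foldFreq_of_bandlimited hM0 hM hbl]

theorem dftS_tsfp_zero (ε lam1 lam2 κ : ℝ) (hM0 : 0 < M) {u₀ : ℝ → Spinor} {c : ℤ → Spinor}
    (hc : Summable fun l => ‖c l‖)
    (hu : ∀ x ∈ Set.Icc a b, u₀ x = evalAt (synthS (b - a) c) x) :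
    dftS M (tsfp a b ε lam1 lam2 κ M u₀ 0) = foldFreq M c := by
  have hM' : (0 : ℝ) < M := by exact_mod_cast hM0
  rw [← dftS_sample_synthS (a := a) (b := b) hM0 hc, tsfp]
  congr 1
  ext1 j
  refine hu _ ⟨?_, ?_⟩
  · have := hF.out
    unfold gridPt
    have : 0 ≤ ((j : ℕ) : ℝ) * ((b - a) / M) := by positivity
    linarith
  · have := hF.out
    unfold gridPt
    have hj : ((j : ℕ) : ℝ) ≤ M := by exact_mod_cast Nat.lt_succ_iff.1 j.2
    have h1 := mul_le_mul_of_nonneg_right hj (show 0 ≤ (b - a) / M by positivity)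
    rw [mul_div_cancel₀ _ hM'.ne'] at h1
    linarith

theorem fourierCoeffOn_evalAt (v : Fin 2 → C(AddCircle (b - a), ℂ)) :
    OscNLDE.fourierCoeffOn a b (evalAt v) = coefS v := by
  have hint : ∀ l, IntervalIntegrable (fun x => Complex.exp (-(Complex.I * mu a b l * (x - a))) •
      evalAt v x) volume a b := by
    intro l
    refine Continuous.intervalIntegrable ?_ _ _
    refine Continuous.smul (f := fun x : ℝ => Complex.exp (-(Complex.I * mu a b l * (x - a))))
      (by fun_prop) (continuous_pi fun i => ?_)
    exact (v i).continuous.comp ((AddCircle.continuous_mk' _).comp (continuous_id.sub continuous_const))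
  ext l i
  rw [OscNLDE.fourierCoeffOn, coefS, coef, coefL_apply,
    fourierCoeff_eq_intervalIntegral _ _ 0, Pi.smul_apply]
  have h1 := (ContinuousLinearMap.proj (R := ℂ) (φ := fun _ : Fin 2 => ℂ) i).intervalIntegral_comp_comm
    (hint l)
  simp only [ContinuousLinearMap.proj_apply] at h1
  rw [← h1, one_div]
  congr 1
  have h2 := intervalIntegral.integral_comp_sub_right (a := a) (b := b) (fun x : ℝ =>
    fourier (-l) (x : AddCircle (b - a)) • v i (x : AddCircle (b - a))) a
  rw [sub_self] at h2
  rw [zero_add, ← h2]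
  refine intervalIntegral.integral_congr fun x _ => ?_
  simp only [Pi.smul_apply, smul_eq_mul, evalAt]
  congr 1
  rw [← mode_eq_fourier, mode]
  congr 1
  unfold mu; push_cast; ring

end samples

/-! ### Euclidean against sup norm in the Sobolev norms. -/

section sobolev
variable {a b : ℝ} {k : ℕ}

theorem sq_norm_le_absSq (v : Spinor) : ‖v‖ ^ 2 ≤ absSq v := by
  unfold absSq
  have h : ‖v‖ ≤ Real.sqrt (∑ i, ‖v i‖ ^ 2) := by
    rw [pi_norm_le_iff_of_nonneg (Real.sqrt_nonneg _)]
    intro i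
    exact Real.le_sqrt_of_sq_le (Finset.single_le_sum (f := fun i => ‖v i‖ ^ 2)
      (fun _ _ => by positivity) (Finset.mem_univ i))
  calc _ ≤ _ := pow_le_pow_left₀ (norm_nonneg _) h 2
    _ = _ := Real.sq_sqrt (Finset.sum_nonneg fun _ _ => by positivity)

theorem absSq_le (v : Spinor) : absSq v ≤ (2 * ‖v‖) ^ 2 := by
  unfold absSq
  rw [Fin.sum_univ_two]
  have h0 := pow_le_pow_left₀ (norm_nonneg _) (norm_le_pi_norm v 0) 2
  have h1 := pow_le_pow_left₀ (norm_nonneg _) (norm_le_pi_norm v 1) 2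
  nlinarith [sq_nonneg ‖v‖]

theorem sq_wt_pow_mul_enorm (l : ℤ) (v : Spinor) :
    (wt a b l ^ k * ‖v‖ₑ) ^ 2 = ENNReal.ofReal ((1 + mu a b l ^ 2) ^ k * ‖v‖ ^ 2) := by
  rw [← om_sq, ENNReal.ofReal_mul (by positivity), ENNReal.ofReal_pow (norm_nonneg _),
    ENNReal.ofReal_pow (by positivity), ENNReal.ofReal_pow (om_pos a b l).le, ofReal_norm, wt]
  ring

theorem nrm_fourierCoeffOn_le (u : ℝ → Spinor) :
    nrm a b k (fourierCoeffOn a b u) ≤ sobolevNorm a b k u := by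
  unfold nrm ltwo sobolevNorm
  refine ENNReal.rpow_le_rpow (ENNReal.tsum_le_tsum fun l => ?_) (by norm_num)
  rw [sq_wt_pow_mul_enorm]
  exact ENNReal.ofReal_le_ofReal (mul_le_mul_of_nonneg_left (sq_norm_le_absSq _) (by positivity))

theorem sobolevNorm_le (u : ℝ → Spinor) :
    sobolevNorm a b k u ≤ 2 * nrm a b k (fourierCoeffOn a b u) := by
  unfold nrm sobolevNorm
  rw [← ltwo_const_mul]
  refine ENNReal.rpow_le_rpow (ENNReal.tsum_le_tsum fun l => ?_) (by norm_num)
  rw [mul_pow, sq_wt_pow_mul_enorm, ← ENNReal.ofReal_ofNat, ← ENNReal.ofReal_pow zero_le_two,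
    ← ENNReal.ofReal_mul (by positivity)]
  refine ENNReal.ofReal_le_ofReal ?_
  have := mul_le_mul_of_nonneg_left (absSq_le (fourierCoeffOn a b u l))
    (show 0 ≤ (1 + mu a b l ^ 2) ^ k by positivity)
  calc _ ≤ _ := this
    _ = _ := by ring

theorem fourierCoeffOn_congr (hab : a < b) {u w : ℝ → Spinor} (h : ∀ x ∈ Set.Icc a b, u x = w x) :
    fourierCoeffOn a b u = fourierCoeffOn a b w := by
  ext1 l
  unfold fourierCoeffOn
  congr 1
  refine intervalIntegral.integral_congr fun x hx => ?_
  rw [Set.uIcc_of_le hab.le] at hx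
  simp only [h x hx]

end sobolev

/-! ### The Dirac equation for the coefficients. -/

section
variable {a b : ℝ} {k : ℕ}

theorem enorm_mode (l : ℤ) (x : ℝ) : ‖mode a b l x‖ₑ = 1 := by
  rw [← ofReal_norm, mode, Complex.norm_exp]; simp

theorem nrm_mu_smul_le (u : ℤ → Spinor) :
    nrm a b k (fun l => (Complex.I * mu a b l) • u l) ≤ nrm a b (k + 1) u := by
  refine ltwo_mono fun l => ?_
  rw [pow_succ, mul_assoc, enorm_smul]
  gcongr
  rw [← ofReal_norm, norm_mul, Complex.norm_I, one_mul, Complex.norm_real, Real.norm_eq_abs]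
  exact ENNReal.ofReal_le_ofReal (abs_mu_le_om a b l)

theorem hasDerivAt_mode_smul (l : ℤ) (z : ℝ) (v : Spinor) :
    HasDerivAt (fun z : ℝ => mode a b l z • v) (mode a b l z • (Complex.I * mu a b l) • v) z := by
  have h4 : HasDerivAt (fun z : ℝ => Complex.I * mu a b l * ((z : ℂ) - a))
      (Complex.I * mu a b l) z := by
    simpa using ((hasDerivAt_id z).ofReal_comp.sub_const (a : ℂ)).const_mul
      (Complex.I * mu a b l)
  exact (h4.cexp.smul_const v).congr_deriv (by rw [smul_smul]; rfl)

theorem norm_mode_smul (l : ℤ) (z : ℝ) (v : Spinor) : ‖mode a b l z • v‖ = ‖v‖ := by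
  rw [norm_smul, ← toReal_enorm (mode a b l z), enorm_mode]; simp

theorem norm_Gam_mulVec_le (l : ℤ) (v : Spinor) :
    ‖Matrix.mulVec (Gam a b l) v‖ ≤ om a b l * (4 * ‖v‖) := by
  conv_lhs => rw [← specProj_add (a := a) (b := b) (l := l) v]
  rw [Matrix.mulVec_sum]
  refine (norm_sum_le _ _).trans ?_
  have h : ∀ η : Bool, ‖Matrix.mulVec (Gam a b l) (specProj a b l η v)‖ ≤
      om a b l * (2 * ‖v‖) := fun η => by
    rw [Gam_specProj, norm_smul, Complex.norm_real, Real.norm_eq_abs, abs_mul, abs_sgn, one_mul,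
      abs_of_pos (om_pos a b l)]
    exact mul_le_mul_of_nonneg_left (norm_specProj_le η v) (om_pos a b l).le
  rw [Fintype.sum_bool]
  linarith [h true, h false]

theorem kernelBound_one : KernelBound 1 1 0 := kernelBound_of_le fun δ => by simp

/-- The right-hand side of the equation on the Fourier side. -/
noncomputable def diracRhs (a b ε lam1 lam2 : ℝ) (u : ℤ → Spinor) : ℤ → Spinor :=
  (-Complex.I) • ((1 / (ε : ℂ) ^ 2) • (fun l => Matrix.mulVec (Gam a b l) (u l)) +
    cubic a b lam1 lam2 1 u)

theorem exists_nrm_diracRhs_le (ε lam1 lam2 : ℝ) (hab : a < b) (R : ℝ≥0) :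
    ∃ B : ℝ≥0, ∀ u : ℤ → Spinor, nrm a b 2 u ≤ R → nrm a b 1 (diracRhs a b ε lam1 lam2 u) ≤ B := by
  obtain ⟨c, hc⟩ : ∃ r : ℝ≥0, (r : ℝ≥0∞) = cubicC a b lam1 lam2 1 :=
    ⟨_, ENNReal.coe_toNNReal (cubicC_ne_top hab)⟩
  obtain ⟨d, hd⟩ : ∃ r : ℝ≥0, (r : ℝ≥0∞) = ‖1 / (ε : ℂ) ^ 2‖ₑ :=
    ⟨‖1 / (ε : ℂ) ^ 2‖₊, rfl⟩
  refine ⟨d * (4 * R) + c * R ^ 3, fun u hu => ?_⟩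
  have h1 : nrm a b 1 (fun l => Matrix.mulVec (Gam a b l) (u l)) ≤ 4 * R := by
    have h2 : nrm a b 1 (fun l => Matrix.mulVec (Gam a b l) (u l)) ≤
        ltwo fun l => 4 * (wt a b l ^ 2 * ‖u l‖ₑ) := by
      refine ltwo_mono fun l => ?_
      have h3 : ‖Matrix.mulVec (Gam a b l) (u l)‖ₑ ≤ wt a b l * (4 * ‖u l‖ₑ) := by
        rw [← ofReal_norm, ← ofReal_norm, wt, ← ENNReal.ofReal_ofNat,
          ← ENNReal.ofReal_mul (by norm_num), ← ENNReal.ofReal_mul (om_pos a b l).le]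
        exact ENNReal.ofReal_le_ofReal (norm_Gam_mulVec_le l (u l))
      calc _ ≤ wt a b l ^ 1 * (wt a b l * (4 * ‖u l‖ₑ)) := by gcongr
        _ = _ := by ring
    refine h2.trans ?_
    rw [ltwo_const_mul]
    gcongr
    exact hu
  refine (nrm_neg_I_smul _).trans ((nrm_add_le _ _).trans ?_)
  push_cast
  refine add_le_add ((nrm_const_smul _ _).trans ?_) ?_
  · rw [← hd]; gcongr
  · have h4 := nrm_cubic_le (lam1 := lam1) (lam2 := lam2) (k := 1) hab kernelBound_one
      ENNReal.one_ne_top (zero_add 1) le_rfl (ENNReal.coe_ne_top (r := R))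
      ((nrm_le_of_le (by norm_num : 1 ≤ 2)).trans hu)
    rw [← hc, mul_one] at h4
    exact h4

end

section
variable {a b : ℝ}

theorem continuous_evalAt (v : Fin 2 → C(AddCircle (b - a), ℂ)) : Continuous (evalAt v) :=
  continuous_pi fun i => (v i).continuous.comp
    ((AddCircle.continuous_mk' _).comp (continuous_id.sub continuous_const))

end

/-! ### Pointwise representation by Fourier series. -/

section representation
variable {a b : ℝ} [hF : Fact (0 < b - a)] {k : ℕ} {lam1 lam2 : ℝ}

theorem exists_evalAt_eq {u : ℝ → Spinor} (hc : ContinuousOn u (Set.Icc a b)) (hp : u a = u b) :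
    ∃ v : Fin 2 → C(AddCircle (b - a), ℂ), ∀ x ∈ Set.Icc a b, evalAt v x = u x := by
  have hL := hF.out
  have hcont : ∀ i, Continuous (liftIco (b - a) 0 fun y => u (y + a) i) := fun i => by
    refine liftIco_zero_continuous (by simp [hp]) ?_
    refine (continuous_apply i).comp_continuousOn (hc.comp (by fun_prop) fun y hy => ?_)
    exact ⟨by linarith [hy.1], by linarith [hy.2]⟩
  refine ⟨fun i => ⟨_, hcont i⟩, fun x hx => ?_⟩
  ext i
  change liftIco (b - a) 0 (fun y => u (y + a) i) ((x - a : ℝ) : AddCircle (b - a)) = _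
  rcases eq_or_lt_of_le hx.2 with rfl | hlt
  · rw [AddCircle.coe_period, ← AddCircle.coe_zero, liftIco_zero_coe_apply ⟨le_rfl, hL⟩]
    simp [hp]
  · rw [liftIco_zero_coe_apply ⟨by linarith [hx.1], by linarith⟩]
    simp

theorem evalAt_synthS_fourierCoeffOn {u : ℝ → Spinor} (hc : ContinuousOn u (Set.Icc a b))
    (hp : u a = u b) (hu : nrm a b 1 (fourierCoeffOn a b u) ≠ ∞) {x : ℝ} (hx : x ∈ Set.Icc a b) :
    evalAt (synthS (b - a) (fourierCoeffOn a b u)) x = u x := by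
  have hab : a < b := by linarith [hF.out]
  obtain ⟨v, hv⟩ := exists_evalAt_eq hc hp
  have h1 : fourierCoeffOn a b u = coefS v := by
    rw [← fourierCoeffOn_evalAt v]
    exact (fourierCoeffOn_congr hab hv).symm
  rw [h1] at hu ⊢
  rw [synthS_coefS hab le_rfl hu, hv x hx]

theorem sobolevNorm_sub_interp_le {u : ℝ → Spinor} (hc : ContinuousOn u (Set.Icc a b))
    (hp : u a = u b) {M : ℕ} (U : GridFun M) :
    sobolevNorm a b k (fun x => u x - interp a b M U x) ≤
      2 * nrm a b k (fourierCoeffOn a b u - dftS M U) := by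
  have hab : a < b := by linarith [hF.out]
  obtain ⟨v, hv⟩ := exists_evalAt_eq hc hp
  refine (sobolevNorm_le _).trans (le_of_eq ?_)
  have h1 : fourierCoeffOn a b u = coefS v := by
    rw [← fourierCoeffOn_evalAt v]
    exact (fourierCoeffOn_congr hab hv).symm
  have h2 : coefS (synthS (b - a) (dftS M U)) = dftS M U :=
    coefS_synthS hab le_rfl (nrm_ne_top_of_bandlimited (k := 1) fun l hl => dftS_of_notMem hl)
  rw [h1, ← h2, ← coefS_sub, ← fourierCoeffOn_evalAt]
  congr 2
  refine fourierCoeffOn_congr hab fun x hx => ?_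
  rw [interp_eq, ← hv x hx]
  rfl

theorem hasSum_evalAt {u : ℤ → Spinor} (hu : nrm a b 1 u ≠ ∞) (x : ℝ) :
    HasSum (fun l => mode a b l x • u l) (evalAt (synthS (b - a) u) x) :=
  hasSum_evalAt_synthS (summable_comp (by linarith [hF.out]) le_rfl hu) x

theorem enorm_evalAt_synthS_le {u : ℤ → Spinor} (hu : nrm a b 1 u ≠ ∞) (x : ℝ) :
    ‖evalAt (synthS (b - a) u) x‖ₑ ≤ embC a b * nrm a b 1 u := by
  rw [← (hasSum_evalAt hu x).tsum_eq]
  refine enorm_tsum_le_tsum_enorm.trans (le_trans (le_of_eq ?_) (tsum_enorm_le u le_rfl))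
  congr 1; ext1 l
  rw [enorm_smul, enorm_mode, one_mul]

theorem hasDerivAt_evalAt_synthS {u : ℤ → Spinor} (hu : nrm a b 2 u ≠ ∞) (x : ℝ) :
    HasDerivAt (evalAt (synthS (b - a) u))
      (evalAt (synthS (b - a) fun l => (Complex.I * mu a b l) • u l) x) x := by
  have hab : a < b := by linarith [hF.out]
  have h1 : nrm a b 1 u ≠ ∞ := ne_top_of_le_ne_top hu (nrm_le_of_le (by norm_num))
  have h2 : nrm a b 1 (fun l => (Complex.I * mu a b l) • u l) ≠ ∞ :=
    ne_top_of_le_ne_top hu (nrm_mu_smul_le u)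
  have hfun : evalAt (synthS (b - a) u) = fun z => ∑' l, mode a b l z • u l := by
    ext1 z; exact (hasSum_evalAt h1 z).tsum_eq.symm
  have h3 := hasDerivAt_tsum (𝕜 := ℝ) (g := fun l z => mode a b l z • u l)
    (g' := fun l z => mode a b l z • (Complex.I * mu a b l) • u l)
    (summable_norm_of_nrm hab le_rfl h2) (fun l z => hasDerivAt_mode_smul l z (u l))
    (fun l z => (norm_mode_smul l z _).le) (y₀ := x) (hasSum_evalAt h1 x).summable x
  rw [hfun]
  exact h3.congr_deriv (hasSum_evalAt h2 x).tsum_eq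

/-- The convolution `cubic` with kernel 1 gives the coefficients of F(Φ)Φ, and it is again in H¹, so
its series converges pointwise to that product. -/
theorem hasSum_cubic {u : ℤ → Spinor} (hu : nrm a b 1 u ≠ ∞) (x : ℝ) :
    HasSum (fun l => mode a b l x • cubic a b lam1 lam2 1 u l)
      (Matrix.mulVec (nonlinF lam1 lam2 (evalAt (synthS (b - a) u) x))
        (evalAt (synthS (b - a) u) x)) := by
  have hab : a < b := by linarith [hF.out]
  have h1 : coefS (synthS (b - a) u) = u := coefS_synthS hab le_rfl hu
  have h2 := coefS_potential_mul (lam1 := lam1) (lam2 := lam2) (v := synthS (b - a) u) hab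
    (by rwa [h1])
  rw [h1] at h2
  have h3 : nrm a b 1 (cubic a b lam1 lam2 1 u) ≠ ∞ := by
    refine ne_top_of_le_ne_top ?_ (nrm_cubic_le (k := 1) hab kernelBound_one ENNReal.one_ne_top
      (zero_add 1) le_rfl hu le_rfl)
    exact ENNReal.mul_ne_top (ENNReal.mul_ne_top (cubicC_ne_top hab) ENNReal.one_ne_top)
      (ENNReal.pow_ne_top hu)
  have h4 := hasSum_evalAt h3 x
  rw [← h2] at h3
  have h5 := synthS_coefS hab le_rfl h3
  rw [h2] at h5
  rw [h5] at h4
  have h6 : evalAt (fun i => potential lam1 lam2 (synthS (b - a) u) i * synthS (b - a) u i) x =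
      Matrix.mulVec (nonlinF lam1 lam2 (evalAt (synthS (b - a) u) x))
        (evalAt (synthS (b - a) u) x) := by
    ext i
    rw [nonlinF_eq_diagonal, Matrix.mulVec_diagonal]
    simp [evalAt, potential]
  rwa [h6] at h4

end representation

/-! ### From classical solutions to the interaction equation. -/

section solution
variable {a b T ε lam1 lam2 : ℝ} {Φ : ℝ → ℝ → Spinor}

theorem continuousOn_fourierCoeffOn (hab : a < b) (hT : 0 < T)
    (hc : ContinuousOn (fun p : ℝ × ℝ => Φ p.1 p.2) (Set.Icc 0 T ×ˢ Set.Icc a b)) (l : ℤ) :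
    ContinuousOn (fun s => fourierCoeffOn a b (Φ s) l) (Set.Icc 0 T) := by
  -- Clamping both variables to the rectangle gives a globally continuous function with the same
  -- values there.
  set Ψ : ℝ → ℝ → Spinor := fun s x => Φ (Set.projIcc 0 T hT.le s) (Set.projIcc a b hab.le x) with hΨ
  have hΨc : Continuous fun p : ℝ × ℝ => Ψ p.1 p.2 :=
    hc.comp_continuous (f := fun p : ℝ × ℝ =>
      (((Set.projIcc 0 T hT.le p.1 : ℝ)), ((Set.projIcc a b hab.le p.2 : ℝ)))) (by fun_prop)
      fun p => ⟨Subtype.coe_prop _, Subtype.coe_prop _⟩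
  have h1 : Continuous fun s => ∫ x in a..b,
      Complex.exp (-(Complex.I * mu a b l * (x - a))) • Ψ s x := by
    refine intervalIntegral.continuous_parametric_intervalIntegral_of_continuous' ?_ a b
    exact Continuous.smul (f := fun p : ℝ × ℝ =>
      Complex.exp (-(Complex.I * mu a b l * (p.2 - a)))) (by fun_prop) hΨc
  have h2 : Continuous fun s => fourierCoeffOn a b (Ψ s) l := h1.const_smul (b - a)⁻¹
  refine h2.continuousOn.congr fun s hs => ?_
  refine congrFun (fourierCoeffOn_congr hab fun x hx => ?_) l
  simp only [hΨ, Set.projIcc_of_mem _ hs, Set.projIcc_of_mem _ hx]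

/-- The bound holds on a set of full measure, hence dense; each coefficient is continuous in time,
so Fatou extends it to every time, in particular to the grid times and endpoints. -/
theorem nrm_fourierCoeffOn_le_of_LinftyHBound (hT : 0 < T) {m : ℕ} {R : ℝ}
    (hc : ∀ l, ContinuousOn (fun s => fourierCoeffOn a b (Φ s) l) (Set.Icc 0 T))
    (h : LinftyHBound a b T m R Φ) : ∀ s ∈ Set.Icc 0 T,
      nrm a b m (fourierCoeffOn a b (Φ s)) ≤ ENNReal.ofReal R := by
  intro s hs
  set A : Set ℝ := {s | s ∈ Set.Icc 0 T ∧ sobolevNorm a b m (Φ s) ≤ ENNReal.ofReal R} with hA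
  have hsA : s ∈ closure A := by
    have h1 : Set.Ioo 0 T ⊆ closure A := by
      by_contra hne
      obtain ⟨x, hx, hxA⟩ := Set.not_subset.1 hne
      have hopen : IsOpen (Set.Ioo 0 T \ closure A) := isOpen_Ioo.sdiff isClosed_closure
      refine (hopen.measure_pos volume ⟨x, hx, hxA⟩).ne' ?_
      rw [LinftyHBound, ae_restrict_iff' measurableSet_Icc] at h
      refine measure_mono_null (fun y hy => ?_) h
      intro hy2
      have hyI : y ∈ Set.Icc 0 T := Set.Ioo_subset_Icc_self hy.1
      exact hy.2 (subset_closure ⟨hyI, hy2 hyI⟩)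
    have h2 : closure (Set.Ioo 0 T) ⊆ closure A := closure_minimal h1 isClosed_closure
    rw [closure_Ioo hT.ne] at h2
    exact h2 hs
  have : (𝓝[A] s).NeBot := mem_closure_iff_nhdsWithin_neBot.1 hsA
  refine nrm_le_of_tendsto (𝓕 := 𝓝[A] s) (u := fun s => fourierCoeffOn a b (Φ s)) (fun l => ?_) ?_
  · exact (hc l s hs).mono_left (nhdsWithin_mono _ fun x hx => hx.1)
  · filter_upwards [self_mem_nhdsWithin] with r hr
    exact (nrm_fourierCoeffOn_le _).trans hr.2

theorem specProj_Gam (l : ℤ) (η : Bool) (v : Spinor) :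
    specProj a b l η (Matrix.mulVec (Gam a b l) v) =
      ((sgn η * om a b l : ℝ) : ℂ) • specProj a b l η v := by
  rw [← Gam_specProj]
  simp only [specProj_apply, Matrix.mulVec_smul, Matrix.mulVec_add]

/-- The equation in interaction variables. -/
theorem hasDerivAt_interaction (hab : a < b) {φ : ℝ → ℤ → Spinor} {s : ℝ}
    (hφ : ∀ l, HasDerivAt (fun r => φ r l) (diracRhs a b ε lam1 lam2 (φ s) l) s)
    (hn : nrm a b 1 (φ s) ≠ ∞) (l : ℤ) :
    HasDerivAt (fun r => propSeq a b (-(r / ε ^ 2)) (φ r) l)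
      (((-Complex.I) • cubic a b lam1 lam2 (expKernel (s / ε ^ 2))
        (propSeq a b (-(s / ε ^ 2)) (φ s))) l) s := by
  have h2 : nrm a b 1 (propSeq a b (-(s / ε ^ 2)) (φ s)) ≠ ∞ :=
    ne_top_of_le_ne_top (ENNReal.mul_ne_top (by simp) hn) (nrm_propSeq_le _ _)
  rw [← propSeq_cubic_propSeq hab _ h2, propSeq_propSeq, add_neg_cancel, propSeq_zero]
  have hE : ∀ η : Bool, HasDerivAt
      (fun r : ℝ => Complex.exp (-(Complex.I * ((-(r / ε ^ 2) : ℝ) : ℂ) * (sgn η * om a b l : ℝ))))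
      (Complex.exp (-(Complex.I * ((-(s / ε ^ 2) : ℝ) : ℂ) * (sgn η * om a b l : ℝ))) *
        (Complex.I * (1 / (ε : ℂ) ^ 2) * (sgn η * om a b l : ℝ))) s := by
    intro η
    refine HasDerivAt.cexp ?_
    have h3 : HasDerivAt (fun r : ℝ => (r : ℂ) * (Complex.I * (1 / (ε : ℂ) ^ 2) *
        (sgn η * om a b l : ℝ))) (1 * (Complex.I * (1 / (ε : ℂ) ^ 2) * (sgn η * om a b l : ℝ))) s :=
      (hasDerivAt_id s).ofReal_comp.mul_const _
    rw [one_mul] at h3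
    refine h3.congr_of_eventuallyEq (Eventually.of_forall fun r => ?_)
    push_cast; ring
  have hP : ∀ η : Bool, HasDerivAt (fun r => specProj a b l η (φ r l))
      (specProj a b l η (diracRhs a b ε lam1 lam2 (φ s) l)) s := fun η =>
    ((specProj a b l η).restrictScalars ℝ).hasFDerivAt.comp_hasDerivAt s (hφ l)
  have h4 := HasDerivAt.fun_sum (u := Finset.univ) fun (η : Bool) _ => (hE η).smul (hP η)
  have h5 : (fun r => propSeq a b (-(r / ε ^ 2)) (φ r) l) = fun r => ∑ η : Bool,
      (Complex.exp (-(Complex.I * ((-(r / ε ^ 2) : ℝ) : ℂ) * (sgn η * om a b l : ℝ)))) •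
        specProj a b l η (φ r l) := by
    ext1 r
    simp only [propSeq, prop, sum_apply, smul_apply]
  rw [h5]
  refine h4.congr_deriv ?_
  simp only [Pi.smul_apply, propSeq, prop, sum_apply, smul_apply]
  rw [Finset.smul_sum]
  refine Finset.sum_congr rfl fun η _ => ?_
  -- On each branch Γ is the scalar ±ω, so the linear term cancels the derivative of the phase.
  have h6 : specProj a b l η (diracRhs a b ε lam1 lam2 (φ s) l) = (-Complex.I) •
      ((1 / (ε : ℂ) ^ 2) • ((sgn η * om a b l : ℝ) : ℂ) • specProj a b l η (φ s l) +
        specProj a b l η (cubic a b lam1 lam2 1 (φ s) l)) := by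
    rw [← specProj_Gam, ← map_smul, ← map_add, ← map_smul]
    rfl
  rw [h6]
  module

variable [hF : Fact (0 < b - a)]

/-- The definition of a solution gives no control of the time derivative; the equation together with
the H² bound rewrites it as an absolutely convergent Fourier series, which supplies a uniform bound.
-/
theorem IsSolution.hasDerivAt_time (hsol : IsSolution a b T ε lam1 lam2 Φ) {s x : ℝ}
    (hs : s ∈ Set.Ioo 0 T) (hx : x ∈ Set.Ioo a b) (hn : nrm a b 2 (fourierCoeffOn a b (Φ s)) ≠ ∞) :
    HasDerivAt (fun r => Φ r x)
      (evalAt (synthS (b - a) (diracRhs a b ε lam1 lam2 (fourierCoeffOn a b (Φ s)))) x) s := by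
  have hab : a < b := by linarith [hF.out]
  have hsI : s ∈ Set.Icc 0 T := Set.Ioo_subset_Icc_self hs
  have hxI : x ∈ Set.Icc a b := Set.Ioo_subset_Icc_self hx
  have hcs : ContinuousOn (Φ s) (Set.Icc a b) :=
    hsol.cont.comp (f := fun x : ℝ => (s, x)) (by fun_prop) fun y hy => ⟨hsI, hy⟩
  have hp := hsol.periodic s hsI
  set u := fourierCoeffOn a b (Φ s) with hu
  have hn1 : nrm a b 1 u ≠ ∞ := ne_top_of_le_ne_top hn (nrm_le_of_le (by norm_num))
  have hrep : ∀ y ∈ Set.Icc a b, evalAt (synthS (b - a) u) y = Φ s y := fun y hy =>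
    evalAt_synthS_fourierCoeffOn hcs hp hn1 hy
  have h0 := hasSum_evalAt hn1 x
  rw [hrep x hxI] at h0
  have h1 := hasSum_evalAt (ne_top_of_le_ne_top hn (nrm_mu_smul_le u)) x
  have hd : deriv (Φ s) x = evalAt (synthS (b - a) fun l => (Complex.I * mu a b l) • u l) x := by
    refine ((hasDerivAt_evalAt_synthS hn x).congr_of_eventuallyEq ?_).deriv
    filter_upwards [isOpen_Ioo.mem_nhds hx] with y hy
    exact (hrep y (Set.Ioo_subset_Icc_self hy)).symm
  rw [← hd] at h1
  have h2 := hasSum_cubic (lam1 := lam1) (lam2 := lam2) hn1 x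
  rw [hrep x hxI] at h2
  have h3 : nrm a b 1 (diracRhs a b ε lam1 lam2 u) ≠ ∞ := by
    lift nrm a b 2 u to ℝ≥0 using hn with r hr
    obtain ⟨B, hB⟩ := exists_nrm_diracRhs_le ε lam1 lam2 hab r
    exact ne_top_of_le_ne_top ENNReal.coe_ne_top (hB u hr.ge)
  have h4 := hasSum_evalAt h3 x
  have h5 := (((((Matrix.mulVecLin sigma1).toContinuousLinearMap.hasSum h1).const_smul
    (-Complex.I)).add ((Matrix.mulVecLin sigma3).toContinuousLinearMap.hasSum h0)).const_smul
    (1 / (ε : ℂ) ^ 2)).add h2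
  have hsd := (hsol.diff_time s hs x hx).hasDerivAt
  refine hsd.congr_deriv ?_
  have heq := hsol.equation s hs x hx
  have h6 : deriv (fun r => Φ r x) s = (-Complex.I) • (Complex.I • deriv (fun r => Φ r x) s) := by
    rw [smul_smul, neg_mul, Complex.I_mul_I, neg_neg, one_smul]
  rw [h6, heq]
  refine ((h5.const_smul (-Complex.I)).unique (h4.congr_fun fun l => ?_))
  change (-Complex.I) • ((1 / (ε : ℂ) ^ 2) • ((-Complex.I) • Matrix.mulVec sigma1
    (mode a b l x • (Complex.I * mu a b l) • u l) + Matrix.mulVec sigma3 (mode a b l x • u l)) +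
      mode a b l x • cubic a b lam1 lam2 1 u l) = mode a b l x • ((-Complex.I) •
        ((1 / (ε : ℂ) ^ 2) • Matrix.mulVec (Gam a b l) (u l) + cubic a b lam1 lam2 1 u l))
  have h7 : (-Complex.I) • Matrix.mulVec sigma1 (mode a b l x • (Complex.I * mu a b l) • u l) =
      (mode a b l x * mu a b l) • Matrix.mulVec sigma1 (u l) := by
    rw [Matrix.mulVec_smul, Matrix.mulVec_smul, smul_smul, smul_smul]
    congr 1
    linear_combination (-(mode a b l x) * mu a b l) * Complex.I_mul_I
  rw [h7, Matrix.mulVec_smul, Gam, Matrix.add_mulVec, Matrix.smul_mulVec]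
  module

theorem IsSolution.hasDerivAt_fourierCoeffOn (hsol : IsSolution a b T ε lam1 lam2 Φ) {R : ℝ≥0}
    (hR : ∀ s ∈ Set.Icc 0 T, nrm a b 2 (fourierCoeffOn a b (Φ s)) ≤ R) {s : ℝ}
    (hs : s ∈ Set.Ioo 0 T) (l : ℤ) :
    HasDerivAt (fun r => fourierCoeffOn a b (Φ r) l)
      (diracRhs a b ε lam1 lam2 (fourierCoeffOn a b (Φ s)) l) s := by
  have hab : a < b := by linarith [hF.out]
  obtain ⟨B, hB⟩ := exists_nrm_diracRhs_le ε lam1 lam2 hab R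
  set w : ℝ → ℤ → Spinor := fun r => diracRhs a b ε lam1 lam2 (fourierCoeffOn a b (Φ r)) with hw
  have hwB : ∀ r ∈ Set.Ioo 0 T, nrm a b 1 (w r) ≤ B := fun r hr =>
    hB _ (hR r (Set.Ioo_subset_Icc_self hr))
  have hint : ∀ u : ℝ → Spinor, ContinuousOn u (Set.Icc a b) → IntervalIntegrable
      (fun x => Complex.exp (-(Complex.I * mu a b l * (x - a))) • u x) volume a b := by
    intro u hu
    refine ContinuousOn.intervalIntegrable ?_
    rw [Set.uIcc_of_le hab.le]
    exact ContinuousOn.smul (f := fun x : ℝ => Complex.exp (-(Complex.I * mu a b l * (x - a))))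
      (by fun_prop) hu
  have hcs : ∀ r ∈ Set.Icc 0 T, ContinuousOn (Φ r) (Set.Icc a b) := fun r hr =>
    hsol.cont.comp (f := fun x : ℝ => (r, x)) (by fun_prop) fun y hy => ⟨hr, hy⟩
  have hIoo : Set.Ioo 0 T ∈ 𝓝 s := isOpen_Ioo.mem_nhds hs
  have hE : ∀ x : ℝ, ‖Complex.exp (-(Complex.I * mu a b l * (x - a)))‖ = 1 := by
    intro x
    rw [Complex.norm_exp]
    simp
  have hbd : ∀ r ∈ Set.Ioo 0 T, ∀ x, ‖evalAt (synthS (b - a) (w r)) x‖ ≤ (embC a b * B).toReal := by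
    intro r hr x
    have h1 : nrm a b 1 (w r) ≠ ∞ := ne_top_of_le_ne_top ENNReal.coe_ne_top (hwB r hr)
    rw [← toReal_enorm]
    refine ENNReal.toReal_mono (ENNReal.mul_ne_top (embC_ne_top hab) ENNReal.coe_ne_top) ?_
    exact (enorm_evalAt_synthS_le h1 x).trans (mul_le_mul_right (hwB r hr) _)
  -- The integral runs over (a, b], while the equation holds only on the open interval.
  have hne : ∀ᵐ x : ℝ, x ≠ b := by simp [ae_iff]
  have key := (intervalIntegral.hasDerivAt_integral_of_dominated_loc_of_deriv_le (μ := volume)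
    (a := a) (b := b) (x₀ := s)
    (F := fun r x => Complex.exp (-(Complex.I * mu a b l * (x - a))) • Φ r x)
    (F' := fun r x => Complex.exp (-(Complex.I * mu a b l * (x - a))) •
      evalAt (synthS (b - a) (w r)) x)
    (bound := fun _ => (embC a b * B).toReal) hIoo ?_ (hint _ (hcs s (Set.Ioo_subset_Icc_self hs)))
    ((intervalIntegrable_iff.1 (hint _ (continuous_evalAt _).continuousOn)).aestronglyMeasurable)
    ?_ intervalIntegrable_const ?_).2
  · have h1 : nrm a b 1 (w s) ≠ ∞ := ne_top_of_le_ne_top ENNReal.coe_ne_top (hwB s hs)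
    have h2 : fourierCoeffOn a b (evalAt (synthS (b - a) (w s))) l = w s l := by
      rw [fourierCoeffOn_evalAt, coefS_synthS hab le_rfl h1]
    exact (key.const_smul (b - a)⁻¹).congr_deriv h2
  · filter_upwards [hIoo] with r hr
    exact (intervalIntegrable_iff.1 (hint _ (hcs r (Set.Ioo_subset_Icc_self hr)))).aestronglyMeasurable
  · refine ae_of_all _ fun x _ r hr => ?_
    rw [norm_smul, hE, one_mul]
    exact hbd r hr x
  · filter_upwards [hne] with x hxb hx r hr
    rw [Set.uIoc_of_le hab.le] at hx
    refine HasDerivAt.fun_const_smul _ ?_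
    exact hsol.hasDerivAt_time hr ⟨hx.1, lt_of_le_of_ne hx.2 hxb⟩
      (ne_top_of_le_ne_top ENNReal.coe_ne_top (hR r (Set.Ioo_subset_Icc_self hr)))

end solution

/-! ### Discrete Gronwall inequality with bootstrap. -/

theorem discrete_gronwall {x : ℕ → ℝ≥0∞} {A c : ℝ≥0∞} {N : ℕ}
    (h : ∀ n ≤ N, (∀ k < n, x k ≤ 1) → x n ≤ A + c * ∑ k ∈ Finset.range n, x k)
    (hA : A * (1 + c) ^ N ≤ 1) : ∀ n ≤ N, x n ≤ A * (1 + c) ^ n := by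
  intro n
  induction n using Nat.strong_induction_on with
  | _ n ih =>
    intro hn
    have hk : ∀ k < n, x k ≤ A * (1 + c) ^ k := fun k hk => ih k hk (by omega)
    -- The a priori bound 1 at earlier times comes from the conclusion already proved there, since
    -- the final value A(1+c)^N is at most 1.
    refine (h n hn fun k hkn => (hk k hkn).trans (le_trans ?_ hA)).trans ?_
    · gcongr
      · exact le_self_add
      · omega
    · have h1 : ∀ n : ℕ, A + c * ∑ k ∈ Finset.range n, A * (1 + c) ^ k = A * (1 + c) ^ n := by
        intro n
        induction n with
        | zero => simp
        | succ n ih => rw [Finset.sum_range_succ, mul_add, ← add_assoc, ih]; ring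
      rw [← h1 n]
      gcongr with k hkn
      exact hk k (Finset.mem_range.1 hkn)

theorem one_add_mul_pow_le_exp (c : ℝ≥0) {κ T : ℝ} {N : ℕ} (hκ : 0 ≤ κ) (hN : N * κ ≤ T) :
    (1 + c * ENNReal.ofReal κ) ^ N ≤ ((Real.exp (c * T)).toNNReal : ℝ≥0∞) := by
  have h1 : (1 + c * ENNReal.ofReal κ : ℝ≥0∞) = ENNReal.ofReal (1 + c * κ) := by
    rw [ENNReal.ofReal_add zero_le_one (by positivity), ENNReal.ofReal_one,
      ENNReal.ofReal_mul c.coe_nonneg, ENNReal.ofReal_coe_nnreal]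
  rw [h1, ← ENNReal.ofReal_pow (by positivity)]
  refine ENNReal.ofReal_le_ofReal ?_
  calc (1 + c * κ) ^ N ≤ Real.exp (c * κ) ^ N := by
        gcongr; linarith [Real.add_one_le_exp (c * κ)]
    _ = Real.exp (c * (N * κ)) := by rw [← Real.exp_nat_mul]; congr 1; ring
    _ ≤ _ := by gcongr

section
variable {a b : ℝ} {M : ℕ}

theorem nrm_foldFreq_le (hab : a < b) (hM0 : 0 < M) (hM : Even M) (hh : (b - a) / M ≤ Real.pi)
    {c : ℤ → Spinor} (hc : nrm a b 1 c ≠ ∞) :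
    nrm a b 1 (foldFreq M c) ≤ (4 * invSqSum + 2) * nrm a b 1 c := by
  have h1 := nrm_foldFreq_sub_le hab hM0 hM hh 0 hc
  have h2 := nrm_add_le (a := a) (b := b) (k := 1) (foldFreq M c - c) c
  rw [sub_add_cancel] at h2
  refine h2.trans ((add_le_add_left h1 _).trans (le_of_eq ?_))
  rw [pow_zero, mul_one, zero_add, show (4 * invSqSum + 2 : ℝ≥0∞) = 4 * invSqSum + 1 + 1 by
    rw [add_assoc, one_add_one_eq_two]]
  ring

theorem nrm_le_add_of_sub_le {k : ℕ} {u v : ℤ → Spinor} {r s : ℝ≥0∞} (h : nrm a b k (u - v) ≤ r)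
    (hv : nrm a b k v ≤ s) : nrm a b k u ≤ r + s := by
  have h2 := nrm_add_le (a := a) (b := b) (k := k) (u - v) v
  rw [sub_add_cancel] at h2
  exact h2.trans (add_le_add h hv)

end

/-! ### Error propagation for the fully discrete scheme. -/

section step
variable {a b lam1 lam2 : ℝ} [hF : Fact (0 < b - a)] {M : ℕ}

/-- The error propagation over one step of the fully discrete scheme, up to the quadrature error of
the oscillatory nonlinearity. -/
theorem exists_nrm_step_le (lam1 lam2 : ℝ) (hab : a < b) (j : ℕ) (hj : 1 ≤ j) (R : ℝ≥0) :
    ∃ c : ℝ≥0, ∀ (M : ℕ) (ε κ : ℝ) (n : ℕ) (X : ℝ → ℤ → Spinor) (z : ℤ → Spinor),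
      0 < M → Even M → (b - a) / M ≤ Real.pi → 0 < ε → ε ≤ 1 → 0 < κ → κ ≤ 1 →
      (∀ σ ∈ Set.Icc 0 κ, nrm a b (j + 1) (X σ) ≤ R) →
      (∀ l, ContinuousOn (fun σ => X σ l) (Set.Icc 0 κ)) →
      (∀ σ ∈ Set.Ioo 0 κ, ∀ l, HasDerivAt (fun σ => X σ l)
        (((-Complex.I) • cubic a b lam1 lam2 (expKernel ((n * κ + σ) / ε ^ 2)) (X σ)) l) σ) →
      (∀ l ∉ freqs M, z l = 0) → nrm a b 1 (z - X 0) ≤ 1 →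
      nrm a b 1 (propSeq a b (-((n + 1 / 2) * (κ / ε ^ 2))) (foldFreq M (flow (b - a) lam1 lam2 κ
          (propSeq a b ((n + 1 / 2) * (κ / ε ^ 2)) z))) - X κ - (z - X 0) -
          (-Complex.I) • cubic a b lam1 lam2 (stepKernel ε κ n) (X 0)) ≤
        c * ENNReal.ofReal κ *
          (nrm a b 1 (z - X 0) + ENNReal.ofReal (((b - a) / M) ^ j + κ * (κ / ε ^ 2))) := by
  obtain ⟨q, hq⟩ : ∃ r : ℝ≥0, (r : ℝ≥0∞) = invSqSum := ⟨_, ENNReal.coe_toNNReal invSqSum_ne_top⟩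
  obtain ⟨C₁, hC₁⟩ := exists_nrm_flow_sub_flow_le (k := 1) (b - a) lam1 lam2 hab le_rfl (4 * (1 + R))
  obtain ⟨C₂, hC₂⟩ := exists_nrm_flow_sub_self_le (k := j + 1) (b - a) lam1 lam2 hab (by omega) (4 * R)
  obtain ⟨C₃, hC₃⟩ := exists_nrm_flow_sub_self_le (k := 1) (b - a) lam1 lam2 hab le_rfl (4 * (1 + R))
  obtain ⟨C₄, hC₄⟩ := exists_nrm_local_error_le (b - a) lam1 lam2 hab R
  refine ⟨4 * ((4 * q + 2) * (C₁ * 4)) + 4 * ((4 * q + 1) * C₂) + C₄, ?_⟩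
  intro M ε κ n X z hM0 hM hh hε hε1 hκ hκ1 hX hXc hXd hz hzX
  have hba := hF.out
  have hMp : (0 : ℝ) < M := by exact_mod_cast hM0
  have h0mem : (0 : ℝ) ∈ Set.Icc 0 κ := ⟨le_rfl, hκ.le⟩
  set τ := κ / ε ^ 2 with hτ
  have hτ0 : 0 < τ := by positivity
  have hκτ : κ ≤ τ := (le_div_iff₀ (by positivity)).2 (by
    have : ε ^ 2 ≤ 1 := pow_le_one₀ hε.le hε1
    nlinarith)
  set t := (n + 1 / 2) * τ with ht
  set V := propSeq a b t z with hV
  set W := propSeq a b t (X 0) with hW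
  have hPerr := hC₄ X (fun σ => (n * κ + σ) / ε ^ 2) t τ κ hκ.le hκ1 hκτ (by fun_prop)
    (fun σ hσ => by
      rw [show t - (n * κ + σ) / ε ^ 2 = (κ / 2 - σ) / ε ^ 2 by rw [ht, hτ]; field_simp; ring,
        abs_div, abs_of_pos (show 0 < ε ^ 2 by positivity), hτ]
      refine div_le_div_of_nonneg_right ?_ (by positivity)
      rw [abs_le]; constructor <;> linarith [hσ.1, hσ.2])
    (fun σ hσ => (nrm_le_of_le (by omega)).trans (hX σ hσ)) hXc hXd
  have hK : (fun δ => ∫ ρ in (0 : ℝ)..κ, (expKernel t - expKernel ((n * κ + ρ) / ε ^ 2)) δ) =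
      stepKernel ε κ n := rfl
  rw [hK] at hPerr
  set P := propSeq a b (-t) (flow (b - a) lam1 lam2 κ W) - X κ -
    (-Complex.I) • cubic a b lam1 lam2 (stepKernel ε κ n) (X 0) with hP
  have hX1 : nrm a b 1 (X 0) ≤ R := (nrm_le_of_le (by omega)).trans (hX 0 h0mem)
  have hz1 : nrm a b 1 z ≤ 1 + R := nrm_le_add_of_sub_le hzX hX1
  have hV1 : nrm a b 1 V ≤ ((4 * (1 + R) : ℝ≥0) : ℝ≥0∞) := by
    push_cast; exact (nrm_propSeq_le _ _).trans (mul_le_mul_right hz1 _)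
  have hW1 : nrm a b 1 W ≤ ((4 * (1 + R) : ℝ≥0) : ℝ≥0∞) := by
    push_cast; exact (nrm_propSeq_le _ _).trans (mul_le_mul_right (hX1.trans le_add_self) _)
  have hWj : nrm a b (j + 1) W ≤ ((4 * R : ℝ≥0) : ℝ≥0∞) := by
    push_cast; exact (nrm_propSeq_le _ _).trans (mul_le_mul_right (hX 0 h0mem) _)
  have hVt : nrm a b 1 V ≠ ∞ := ne_top_of_le_ne_top ENNReal.coe_ne_top hV1
  set NV := flow (b - a) lam1 lam2 κ V - V with hNV
  set NW := flow (b - a) lam1 lam2 κ W - W with hNW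
  have hNVt : nrm a b 1 NV ≠ ∞ := ne_top_of_le_ne_top (by finiteness) (hC₃ V hV1 κ hκ.le hκ1)
  have hNWt : nrm a b 1 NW ≠ ∞ := ne_top_of_le_ne_top (by finiteness) (hC₃ W hW1 κ hκ.le hκ1)
  have hFt : nrm a b 1 (flow (b - a) lam1 lam2 κ V) ≠ ∞ := ne_top_of_le_ne_top
    (ENNReal.add_ne_top.2 ⟨hNVt, hVt⟩) (nrm_le_add_of_sub_le le_rfl le_rfl)
  have hbV : foldFreq M V = V := foldFreq_of_bandlimited hM0 hM (propSeq_bandlimited hz)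
  have e1 : foldFreq M (flow (b - a) lam1 lam2 κ V) = foldFreq M NV + V := by
    rw [hNV, foldFreq_sub hab hM0 le_rfl hFt hVt, hbV, sub_add_cancel]
  have e2 : foldFreq M (NV - NW) = foldFreq M NV - foldFreq M NW := foldFreq_sub hab hM0 le_rfl hNVt hNWt
  have hVl : ∀ l, prop a b (-t) l (V l) = z l := fun l => by
    have : propSeq a b (-t) V = z := by rw [hV, propSeq_propSeq, neg_add_cancel, propSeq_zero]
    exact congrFun this l
  have hWl : ∀ l, prop a b (-t) l (W l) = X 0 l := fun l => by
    have : propSeq a b (-t) W = X 0 := by rw [hW, propSeq_propSeq, neg_add_cancel, propSeq_zero]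
    exact congrFun this l
  -- Since V is band-limited, aliasing acts only on the increment NV, and the propagators around V
  -- cancel to give z exactly. What remains is the Lipschitz term, the aliasing error of the smooth
  -- increment NW, and the local error P; each contains a factor κ, so the constant 4 of the
  -- propagator is harmless.
  have key : propSeq a b (-t) (foldFreq M (flow (b - a) lam1 lam2 κ V)) - X κ - (z - X 0) -
      (-Complex.I) • cubic a b lam1 lam2 (stepKernel ε κ n) (X 0) =
      propSeq a b (-t) (foldFreq M (NV - NW)) + propSeq a b (-t) (foldFreq M NW - NW) + P := by
    have e3 : flow (b - a) lam1 lam2 κ W = NW + W := by rw [hNW, sub_add_cancel]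
    rw [e1, e2, hP, e3]
    ext1 l
    simp only [Pi.add_apply, Pi.sub_apply, propSeq, map_add, map_sub, hVl, hWl]
    abel
  rw [key]
  have b1 : nrm a b 1 (propSeq a b (-t) (foldFreq M (NV - NW))) ≤
      4 * ((4 * q + 2) * (C₁ * ENNReal.ofReal κ * (4 * nrm a b 1 (z - X 0)))) := by
    refine (nrm_propSeq_le _ _).trans (mul_le_mul_right ?_ _)
    have h1 : nrm a b 1 (NV - NW) ≤ C₁ * ENNReal.ofReal κ * (4 * nrm a b 1 (z - X 0)) := by
      refine (hC₁ V W hV1 hW1 κ hκ.le hκ1).trans (mul_le_mul_right ?_ _)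
      rw [hV, hW, ← propSeq_sub]
      exact nrm_propSeq_le _ _
    rw [hq]
    refine (nrm_foldFreq_le hab hM0 hM hh ?_).trans (mul_le_mul_right h1 _)
    exact ne_top_of_le_ne_top (ENNReal.add_ne_top.2 ⟨hNVt, hNWt⟩) (nrm_sub_le _ _)
  have b2 : nrm a b 1 (propSeq a b (-t) (foldFreq M NW - NW)) ≤
      4 * ((4 * q + 1) * ENNReal.ofReal ((b - a) / M) ^ j * (C₂ * ENNReal.ofReal κ)) := by
    refine (nrm_propSeq_le _ _).trans (mul_le_mul_right ?_ _)
    have h1 := hC₂ W hWj κ hκ.le hκ1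
    rw [hq]
    refine (nrm_foldFreq_sub_le hab hM0 hM hh j ?_).trans (mul_le_mul_right h1 _)
    exact ne_top_of_le_ne_top (by finiteness) h1
  refine (nrm_add_le _ _).trans ((add_le_add ((nrm_add_le _ _).trans (add_le_add b1 b2)) hPerr).trans
    ?_)
  rw [ENNReal.ofReal_add (by positivity) (by positivity), ENNReal.ofReal_pow (by positivity),
    ENNReal.ofReal_mul hκ.le]
  push_cast
  generalize nrm a b 1 (z - X 0) = x
  generalize ENNReal.ofReal ((b - a) / M) ^ j = y
  generalize ENNReal.ofReal κ = k
  generalize ENNReal.ofReal τ = w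
  calc _ = 4 * ((4 * q + 2) * (C₁ * 4)) * k * x + 4 * ((4 * q + 1) * C₂) * k * y
        + C₄ * k * (k * w) := by ring
    _ ≤ 4 * ((4 * q + 2) * (C₁ * 4)) * k * (x + (y + k * w)) + 4 * ((4 * q + 1) * C₂) * k *
        (x + (y + k * w)) + C₄ * k * (x + (y + k * w)) := by
      gcongr
      · exact le_self_add
      · exact le_self_add.trans le_add_self
      · exact le_add_self.trans le_add_self
    _ = _ := by ring

set_option maxHeartbeats 1000000 in
/-- The error of the fully discrete scheme in interaction variables. -/
theorem exists_nrm_error_le (lam1 lam2 : ℝ) (hab : a < b) {T : ℝ} (hT : 0 < T) (j : ℕ) (hj : 1 ≤ j)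
    (R : ℝ≥0) :
    ∃ C : ℝ≥0, ∀ (M : ℕ) (ε κ : ℝ) (N : ℕ) (χ : ℝ → ℤ → Spinor) (U : ℕ → ℤ → Spinor),
      0 < M → Even M → (b - a) / M ≤ Real.pi → 0 < ε → ε ≤ 1 → 0 < κ → κ ≤ 1 → N * κ ≤ T →
      (∀ s ∈ Set.Icc 0 T, nrm a b (j + 1) (χ s) ≤ R) →
      (∀ l, ContinuousOn (fun s => χ s l) (Set.Icc 0 T)) →
      (∀ s ∈ Set.Ioo 0 T, ∀ l, HasDerivAt (fun s => χ s l)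
        (((-Complex.I) • cubic a b lam1 lam2 (expKernel (s / ε ^ 2)) (χ s)) l) s) →
      (∀ n, ∀ l ∉ freqs M, U n l = 0) → U 0 = foldFreq M (χ 0) →
      (∀ n, U (n + 1) = propSeq a b (κ / (2 * ε ^ 2)) (foldFreq M (flow (b - a) lam1 lam2 κ
        (propSeq a b (κ / (2 * ε ^ 2)) (U n))))) →
      C * ENNReal.ofReal (((b - a) / M) ^ j + κ * (κ / ε ^ 2) + (κ / ε ^ 2) ^ j) ≤ 1 →
      nrm a b 1 (propSeq a b (-(N * (κ / ε ^ 2))) (U N) - χ (N * κ)) ≤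
        C * ENNReal.ofReal (((b - a) / M) ^ j + κ * (κ / ε ^ 2) + (κ / ε ^ 2) ^ j) := by
  obtain ⟨q, hq⟩ : ∃ r : ℝ≥0, (r : ℝ≥0∞) = invSqSum := ⟨_, ENNReal.coe_toNNReal invSqSum_ne_top⟩
  obtain ⟨c₀, hc₀⟩ : ∃ r : ℝ≥0, (r : ℝ≥0∞) = cubicC a b lam1 lam2 (j + 1) :=
    ⟨_, ENNReal.coe_toNNReal (cubicC_ne_top hab)⟩
  obtain ⟨c, hc⟩ := exists_nrm_step_le lam1 lam2 hab j hj R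
  obtain ⟨CS, hCS⟩ := exists_nrm_sum_cubic_stepKernel_le lam1 lam2 hab T j hj R (c₀ * R ^ 3)
  -- The three sources: initial interpolation, summed quadrature errors, and the per-step remainders
  -- added over time T.
  set A₀ : ℝ≥0 := (4 * q + 1) * R + CS + c * T.toNNReal with hA₀
  refine ⟨A₀ * (Real.exp (c * T)).toNNReal, ?_⟩
  intro M ε κ N χ U hM0 hM hh hε hε1 hκ hκ1 hN hχ hχc hχd hUb hU0 hU hsmall
  have hba := hF.out
  have hMp : (0 : ℝ) < M := by exact_mod_cast hM0
  set τ := κ / ε ^ 2 with hτ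
  have hτ0 : 0 < τ := by positivity
  set E := ((b - a) / M) ^ j + κ * τ + τ ^ j with hE
  have hmem : ∀ n ≤ N, ∀ s : ℝ, 0 ≤ s → s ≤ n * κ → s ∈ Set.Icc 0 T := fun n hn s h0 h1 =>
    ⟨h0, h1.trans (le_trans (by gcongr) hN)⟩
  have hnκ : ∀ n ≤ N, (n : ℝ) * κ ∈ Set.Icc 0 T := fun n hn =>
    hmem n hn _ (by positivity) le_rfl
  set e : ℕ → ℤ → Spinor := fun n => propSeq a b (-(n * τ)) (U n) - χ (n * κ) with he
  have hχdiff : ∀ k < N, nrm a b (j + 1) (χ ((k + 1 : ℕ) * κ) - χ (k * κ)) ≤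
      ((c₀ * R ^ 3 : ℝ≥0) : ℝ≥0∞) * ENNReal.ofReal κ := by
    intro k hk
    have hsub : Set.Icc (k * κ) ((k + 1 : ℕ) * κ) ⊆ Set.Icc 0 T := fun s hs =>
      hmem (k + 1) hk s (le_trans (by positivity) hs.1) hs.2
    have hsub' : Set.Ioo (k * κ) ((k + 1 : ℕ) * κ) ⊆ Set.Ioo 0 T := fun s hs =>
      ⟨lt_of_le_of_lt (by positivity) hs.1, lt_of_lt_of_le hs.2 (hnκ (k + 1) hk).2⟩
    refine (nrm_sub_le_of_hasDerivAt (y := χ) (y' := fun s => (-Complex.I) • cubic a b lam1 lam2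
      (expKernel (s / ε ^ 2)) (χ s)) (B := ((c₀ * R ^ 3 : ℝ≥0) : ℝ≥0∞)) (by push_cast; nlinarith)
      (fun l => (hχc l).mono hsub)
      (fun s hs l => hχd s (hsub' hs) l) (fun s hs => ?_)).trans (le_of_eq ?_)
    · refine (nrm_neg_I_smul _).trans ((nrm_cubic_le (k := j + 1) (n := j + 1) hab
        (kernelBound_expKernel _)
        ENNReal.one_ne_top (zero_add _) (by omega) (ENNReal.coe_ne_top (r := R))
        (hχ s (hsub (Set.Ioo_subset_Icc_self hs)))).trans (le_of_eq ?_))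
      rw [← hc₀, mul_one]; push_cast; rfl
    · rw [mul_comm]; congr 2; push_cast; ring
  have hstep : ∀ k < N, nrm a b 1 (e k) ≤ 1 →
      nrm a b 1 (e (k + 1) - e k - (-Complex.I) • cubic a b lam1 lam2 (stepKernel ε κ k) (χ (k * κ)))
      ≤ c * ENNReal.ofReal κ * (nrm a b 1 (e k) + ENNReal.ofReal E) := by
    intro k hk hek
    have h1 := hc M ε κ k (fun σ => χ (k * κ + σ)) (propSeq a b (-(k * τ)) (U k)) hM0 hM hh hε hε1
      hκ hκ1
      (fun σ hσ => hχ _ (hmem (k + 1) hk _ (add_nonneg (by positivity) hσ.1)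
        (by push_cast; linarith [hσ.2])))
      (fun l => (hχc l).comp (by fun_prop) fun σ hσ => hmem (k + 1) hk _
        (add_nonneg (by positivity) hσ.1) (by push_cast; linarith [hσ.2]))
      (fun σ hσ l => by
        have hs : (k * κ + σ) ∈ Set.Ioo 0 T := by
          have h2 := (hnκ (k + 1) hk).2
          push_cast at h2
          exact ⟨by have := hσ.1; positivity, by linarith [hσ.2]⟩
        exact (hχd _ hs l).comp_const_add (k * κ) σ)
      (propSeq_bandlimited (hUb k)) (by simpa only [add_zero] using hek)
    simp only [add_zero, propSeq_propSeq] at h1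
    -- The two half steps shift -(k+1)τ and kτ to the midpoint (k+1/2)τ: this is where the Strang
    -- splitting produces the midpoint rule.
    have e1 : e (k + 1) = propSeq a b (-((k + 1 / 2) * τ)) (foldFreq M (flow (b - a) lam1 lam2 κ
        (propSeq a b ((k + 1 / 2) * τ + -(k * τ)) (U k)))) - χ (k * κ + κ) := by
      simp only [he]
      rw [hU k, propSeq_propSeq]
      congr 2
      · rw [hτ]; push_cast; field_simp; ring
      · congr 3; rw [hτ]; field_simp; ring
      · push_cast; ring
    rw [e1]
    refine h1.trans ?_
    gcongr
    rw [hE]; linarith [show 0 ≤ τ ^ j by positivity]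
  have hrec : ∀ n ≤ N, (∀ k < n, nrm a b 1 (e k) ≤ 1) → nrm a b 1 (e n) ≤
      A₀ * ENNReal.ofReal E + c * ENNReal.ofReal κ * ∑ k ∈ Finset.range n, nrm a b 1 (e k) := by
    intro n hn hx
    -- The quadrature terms are separated out and summed as a whole, before any norm is taken, to
    -- keep their cancellation.
    have hsum : e n = e 0 + (∑ k ∈ Finset.range n, (e (k + 1) - e k - (-Complex.I) •
        cubic a b lam1 lam2 (stepKernel ε κ k) (χ (k * κ))) +
        (-Complex.I) • ∑ k ∈ Finset.range n, cubic a b lam1 lam2 (stepKernel ε κ k) (χ (k * κ))) := by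
      rw [Finset.smul_sum, ← Finset.sum_add_distrib]
      simp only [sub_add_cancel]
      rw [Finset.sum_range_sub, add_sub_cancel]
    have h0 : nrm a b 1 (e 0) ≤ (4 * q + 1) * R * ENNReal.ofReal E := by
      have h1 : e 0 = foldFreq M (χ 0) - χ 0 := by
        simp [he, hU0]
      have hχ0 := hχ 0 ⟨le_rfl, hT.le⟩
      rw [h1, hq]
      refine (nrm_foldFreq_sub_le hab hM0 hM hh j
        (ne_top_of_le_ne_top ENNReal.coe_ne_top hχ0)).trans ?_
      rw [← ENNReal.ofReal_pow (by positivity), mul_right_comm]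
      gcongr
      rw [hE]; linarith [show 0 ≤ τ ^ j by positivity, show 0 ≤ κ * τ by positivity]
    have hS := hCS ε κ hε hκ n (hnκ n hn).2 (fun k => χ (k * κ))
      (fun k hk => hχ _ (hnκ k (hk.trans hn))) (fun k hk => hχdiff k (by omega))
    have hS' : nrm a b 1 ((-Complex.I) • ∑ k ∈ Finset.range n,
        cubic a b lam1 lam2 (stepKernel ε κ k) (χ (k * κ))) ≤ CS * ENNReal.ofReal E := by
      refine (nrm_neg_I_smul _).trans (hS.trans ?_)
      gcongr
      rw [hE]; linarith [show 0 ≤ ((b - a) / M) ^ j by positivity]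
    have hA : nrm a b 1 (∑ k ∈ Finset.range n, (e (k + 1) - e k - (-Complex.I) •
        cubic a b lam1 lam2 (stepKernel ε κ k) (χ (k * κ)))) ≤
        c * ENNReal.ofReal κ * ∑ k ∈ Finset.range n, nrm a b 1 (e k) +
          c * ENNReal.ofReal T * ENNReal.ofReal E := by
      refine (nrm_sum_le _ _).trans ((Finset.sum_le_sum fun k hk =>
        hstep k ((Finset.mem_range.1 hk).trans_le hn) (hx k (Finset.mem_range.1 hk))).trans ?_)
      rw [← Finset.mul_sum, Finset.sum_add_distrib, mul_add]
      refine add_le_add le_rfl ?_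
      rw [Finset.sum_const, Finset.card_range, nsmul_eq_mul, ← mul_assoc]
      refine mul_le_mul_left ?_ _
      rw [mul_assoc]
      refine mul_le_mul_right ?_ _
      rw [mul_comm, ← ENNReal.ofReal_natCast, ← ENNReal.ofReal_mul (by positivity)]
      exact ENNReal.ofReal_le_ofReal (hnκ n hn).2
    have hfin := (nrm_add_le (a := a) (b := b) (k := 1) _ _).trans (add_le_add h0
      ((nrm_add_le _ _).trans (add_le_add hA hS')))
    rw [← hsum] at hfin
    refine hfin.trans (le_of_eq ?_)
    rw [hA₀]; push_cast
    rw [show ((T.toNNReal : ℝ≥0) : ℝ≥0∞) = ENNReal.ofReal T from rfl]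
    ring
  have hexp := one_add_mul_pow_le_exp c hκ.le hN
  have hle : A₀ * ENNReal.ofReal E * (1 + c * ENNReal.ofReal κ) ^ N ≤
      (A₀ * (Real.exp (c * T)).toNNReal : ℝ≥0) * ENNReal.ofReal E := by
    push_cast
    rw [mul_right_comm]
    gcongr
  exact (discrete_gronwall hrec (hle.trans hsmall) N le_rfl).trans hle

end step

/-! ### Assembly of the uniform error bound. -/

theorem continuousOn_propSeq {a b : ℝ} {φ : ℝ → ℤ → Spinor} {θ : ℝ → ℝ} {S : Set ℝ}
    (hθ : Continuous θ) {l : ℤ} (hφ : ContinuousOn (fun s => φ s l) S) :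
    ContinuousOn (fun s => propSeq a b (θ s) (φ s) l) S := by
  simp only [propSeq, prop, sum_apply, smul_apply]
  refine continuousOn_finsetSum _ fun η _ => ContinuousOn.smul
    (f := fun s => Complex.exp (-(Complex.I * θ s * (sgn η * om a b l : ℝ)))) ?_
    ((specProj a b l η).continuous.comp_continuousOn hφ)
  exact Continuous.continuousOn (by fun_prop)

/-- The uniform error bound of the TSFP method. -/
theorem exists_errH1_le (a b T lam1 lam2 α : ℝ) (m : ℕ) (hab : a < b) (hT : 0 < T)
    (hα0 : 0 < α) (hα1 : α < 1) (hm : 2 ≤ m) (R : ℝ) :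
    ∃ h₀ κbar C : ℝ, 0 < h₀ ∧ 0 < κbar ∧ κbar < 1 ∧ 0 < C ∧
      ∀ κ₀ : ℝ, 0 < κ₀ → κ₀ ≤ κbar →
      ∀ ε : ℝ, 0 < ε → ε ≤ 1 →
      ∀ Φ : ℝ → ℝ → Spinor, IsSolution a b T ε lam1 lam2 Φ → LinftyHBound a b T m R Φ →
      ∀ M : ℕ, 0 < M → Even M → (b - a) / M ≤ h₀ →
      ∀ κ : ℝ, 0 < κ → κ ≤ ε ^ 2 * α * κ₀ →
      ∀ n : ℕ, (n : ℝ) ≤ T / κ →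
        errH1 a b ε lam1 lam2 κ M Φ n
          ≤ ENNReal.ofReal
              (C * (((b - a) / M) ^ (m - 1) + κ ^ 2 / ε ^ 2 + κ₀ ^ (m - 1))) := by
  have hba : 0 < b - a := by linarith
  have : Fact (0 < b - a) := ⟨hba⟩
  obtain ⟨j, rfl⟩ : ∃ j, m = j + 1 := ⟨m - 1, by omega⟩
  have hj : 1 ≤ j := by omega
  rw [Nat.add_sub_cancel]
  obtain ⟨C, hC⟩ := exists_nrm_error_le lam1 lam2 hab hT j hj (4 * R.toNNReal)
  have hC0 : (0 : ℝ) ≤ C := C.coe_nonneg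
  -- The total error E has three terms, each at most δ when h and κ₀ are at most δ; then CE ≤ 1, as
  -- the bootstrap requires.
  set δ : ℝ := 1 / (4 * (C + 1)) with hδ
  have hδ0 : 0 < δ := by positivity
  have hδ1 : δ ≤ 1 / 4 := by
    rw [hδ]; exact one_div_le_one_div_of_le (by norm_num) (by linarith)
  have hCδ : C * (3 * δ) ≤ 1 := by
    rw [hδ, ← mul_div_assoc, ← mul_div_assoc, div_le_one (by positivity)]; linarith
  -- The 8 is 4 for undoing the change of variables and 2 for passing from the sup norm to the
  -- Euclidean one; C + 1 keeps the constant positive.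
  refine ⟨δ, δ, 8 * (C + 1), hδ0, hδ0, by linarith, by positivity, ?_⟩
  intro κ₀ hκ₀ hκ₀b ε hε hε1 Φ hsol hbound M hM0 hM hh κ hκ hκle n hn
  have hMp : (0 : ℝ) < M := by exact_mod_cast hM0
  have hε2 : 0 < ε ^ 2 := by positivity
  have hε21 : ε ^ 2 ≤ 1 := pow_le_one₀ hε.le hε1
  have hNκ : n * κ ≤ T := (le_div_iff₀ hκ).1 hn
  set h := (b - a) / M with hhd
  have hh0 : 0 < h := by positivity
  set τ := κ / ε ^ 2 with hτ
  have hτ0 : 0 < τ := by positivity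
  have hτκ₀ : τ ≤ κ₀ := by
    rw [hτ, div_le_iff₀ hε2]
    refine hκle.trans ?_
    nlinarith [mul_pos hε2 hκ₀]
  have hκτ : κ ≤ τ := (le_div_iff₀ hε2).2 (by nlinarith)
  have hκ1 : κ ≤ 1 := by linarith
  set φ : ℝ → ℤ → Spinor := fun s => fourierCoeffOn a b (Φ s) with hφ
  have hφc : ∀ l, ContinuousOn (fun s => φ s l) (Set.Icc 0 T) :=
    continuousOn_fourierCoeffOn hab hT hsol.cont
  have hφb : ∀ s ∈ Set.Icc 0 T, nrm a b (j + 1) (φ s) ≤ (R.toNNReal : ℝ≥0∞) :=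
    nrm_fourierCoeffOn_le_of_LinftyHBound hT hφc hbound
  have hφ2 : ∀ s ∈ Set.Icc 0 T, nrm a b 2 (φ s) ≤ (R.toNNReal : ℝ≥0∞) := fun s hs =>
    (nrm_le_of_le (by omega)).trans (hφb s hs)
  have hφt : ∀ s ∈ Set.Icc 0 T, nrm a b 1 (φ s) ≠ ∞ := fun s hs =>
    ne_top_of_le_ne_top ENNReal.coe_ne_top ((nrm_le_of_le (by norm_num)).trans (hφ2 s hs))
  set χ : ℝ → ℤ → Spinor := fun s => propSeq a b (-(s / ε ^ 2)) (φ s) with hχ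
  have hχ0 : χ 0 = φ 0 := by simp [hχ]
  have hcs : ∀ s ∈ Set.Icc 0 T, ContinuousOn (Φ s) (Set.Icc a b) := fun s hs =>
    hsol.cont.comp (f := fun x : ℝ => (s, x)) (by fun_prop) fun y hy => ⟨hs, hy⟩
  have h0T : (0 : ℝ) ∈ Set.Icc 0 T := ⟨le_rfl, hT.le⟩
  set U : ℕ → ℤ → Spinor := fun n => dftS M (tsfp a b ε lam1 lam2 κ M (Φ 0) n) with hU
  set E := h ^ j + κ * τ + τ ^ j with hE
  have hE3 : E ≤ 3 * δ := by
    have h1 : h ^ j ≤ h := pow_le_of_le_one hh0.le (by linarith) (by omega)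
    have h2 : τ ^ j ≤ τ := pow_le_of_le_one hτ0.le (by linarith) (by omega)
    have h3 : κ * τ ≤ τ := by nlinarith
    linarith
  have hsmall : C * ENNReal.ofReal E ≤ 1 := by
    rw [← ENNReal.ofReal_coe_nnreal, ← ENNReal.ofReal_mul hC0, ENNReal.ofReal_le_one]
    exact (mul_le_mul_of_nonneg_left hE3 hC0).trans hCδ
  have herr := hC M ε κ n χ U hM0 hM (by linarith [Real.pi_gt_three]) hε hε1 hκ hκ1 hNκ
    (fun s hs => by
      push_cast
      exact (nrm_propSeq_le _ _).trans (mul_le_mul_right (hφb s hs) _))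
    (fun l => continuousOn_propSeq (by fun_prop) (hφc l))
    (fun s hs l => hasDerivAt_interaction hab
      (fun l => hsol.hasDerivAt_fourierCoeffOn hφ2 hs l) (hφt s (Set.Ioo_subset_Icc_self hs)) l)
    (fun n l hl => dftS_of_notMem hl)
    (by
      rw [hχ0]
      exact dftS_tsfp_zero ε lam1 lam2 κ hM0 (summable_norm_of_nrm hab le_rfl (hφt 0 h0T))
        fun x hx => (evalAt_synthS_fourierCoeffOn (hcs 0 h0T) (hsol.periodic 0 h0T)
          (hφt 0 h0T) hx).symm)
    (fun n => dftS_tsfp_succ ε lam1 lam2 κ hκ.le hκ1 hM0 hM (Φ 0) n) hsmall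
  have hnT : n * κ ∈ Set.Icc 0 T := ⟨by positivity, hNκ⟩
  have h1 : φ (n * κ) - U n =
      propSeq a b (n * τ) (χ (n * κ) - propSeq a b (-(n * τ)) (U n)) := by
    rw [propSeq_sub, propSeq_propSeq]
    simp only [propSeq_propSeq]
    rw [mul_div_assoc, ← hτ, add_neg_cancel, propSeq_zero, propSeq_zero]
  have h2 : nrm a b 1 (φ (n * κ) - U n) ≤ 4 * (C * ENNReal.ofReal E) := by
    rw [h1]
    refine (nrm_propSeq_le _ _).trans (mul_le_mul_right ?_ _)
    rw [nrm_sub_comm]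
    exact herr
  refine (sobolevNorm_sub_interp_le (hcs _ hnT) (hsol.periodic _ hnT) _).trans ?_
  refine (mul_le_mul_right h2 2).trans ?_
  have h3 : (2 : ℝ≥0∞) * (4 * (C * ENNReal.ofReal E)) = ENNReal.ofReal (8 * C * E) := by
    rw [ENNReal.ofReal_mul (by positivity), ENNReal.ofReal_mul (by norm_num),
      ENNReal.ofReal_coe_nnreal, ENNReal.ofReal_ofNat, ← mul_assoc, ← mul_assoc]
    norm_num
  rw [h3]
  refine ENNReal.ofReal_le_ofReal ?_
  have h4 : E ≤ h ^ j + κ ^ 2 / ε ^ 2 + κ₀ ^ j := by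
    have h5 : κ * τ = κ ^ 2 / ε ^ 2 := by rw [hτ]; ring
    rw [hE, h5]
    gcongr
  have h6 : 0 ≤ E := by positivity
  exact mul_le_mul (by linarith) h4 h6 (by positivity)

end OscNLDE

/-! ### The two statements of the theorem. -/

theorem theorem3 (a b T lam1 lam2 α : ℝ) (m : ℕ) (hab : a < b) (hT : 0 < T)
    (hα0 : 0 < α) (hα1 : α < 1) (hm : 3 ≤ m) :
    (∀ R : ℝ, ∃ h₀ κbar C : ℝ, 0 < h₀ ∧ 0 < κbar ∧ κbar < 1 ∧ 0 < C ∧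
      ∀ κ₀ : ℝ, 0 < κ₀ → κ₀ ≤ κbar →
      ∀ ε : ℝ, 0 < ε → ε ≤ 1 →
      ∀ Φ : ℝ → ℝ → OscNLDE.Spinor, OscNLDE.IsSolution a b T ε lam1 lam2 Φ →
        OscNLDE.LinftyHBound a b T m R Φ →
      ∀ M : ℕ, 0 < M → Even M → (b - a) / M ≤ h₀ →
      ∀ κ : ℝ, 0 < κ → κ ≤ ε ^ 2 * α * κ₀ →
      ∀ n : ℕ, (n : ℝ) ≤ T / κ →
        OscNLDE.errH1 a b ε lam1 lam2 κ M Φ n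
          ≤ ENNReal.ofReal
              (C * (((b - a) / M) ^ (m - 1) + κ ^ 2 / ε ^ 2 + κ₀ ^ (m - 1)))) ∧
    (∀ (R : ℕ → ℝ) (N : ℕ), ∃ h₀ κbar C : ℝ, 0 < h₀ ∧ 0 < κbar ∧ κbar < 1 ∧ 0 < C ∧
      ∀ κ₀ : ℝ, 0 < κ₀ → κ₀ ≤ κbar →
      ∀ ε : ℝ, 0 < ε → ε ≤ 1 →
      ∀ Φ : ℝ → ℝ → OscNLDE.Spinor, OscNLDE.IsSolution a b T ε lam1 lam2 Φ →
        (∀ k : ℕ, OscNLDE.LinftyHBound a b T k (R k) Φ) →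
      ∀ M : ℕ, 0 < M → Even M → (b - a) / M ≤ h₀ →
      ∀ κ : ℝ, 0 < κ → κ ≤ ε ^ 2 * α * κ₀ →
      ∀ n : ℕ, (n : ℝ) ≤ T / κ →
        OscNLDE.errH1 a b ε lam1 lam2 κ M Φ n
          ≤ ENNReal.ofReal
              (C * (((b - a) / M) ^ (m - 1) + κ ^ 2 / ε ^ 2 + κ₀ ^ N)) ∧
        (κ₀ ^ N ≤ κ ^ 2 / ε ^ 2 →
          OscNLDE.errH1 a b ε lam1 lam2 κ M Φ n
            ≤ ENNReal.ofReal (C * (((b - a) / M) ^ (m - 1) + κ ^ 2 / ε ^ 2)))) := by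
  refine ⟨OscNLDE.exists_errH1_le a b T lam1 lam2 α m hab hT hα0 hα1 (by omega), fun R N => ?_⟩
  -- Order N + 1 yields κ₀^N and order m yields h^{m-1}; at the maximum both hold once h ≤ 1 and κ₀
  -- ≤ 1.
  obtain ⟨h₀, κbar, C, hh₀, hκbar, hκbar1, hC, key⟩ := OscNLDE.exists_errH1_le a b T lam1 lam2 α
    (max m (N + 1)) hab hT hα0 hα1 (le_max_of_le_left (by omega)) (R (max m (N + 1)))
  -- The factor 2 absorbs κ₀^N into κ²/ε² in the last assertion.
  refine ⟨min h₀ 1, κbar, 2 * C, lt_min hh₀ one_pos, hκbar, hκbar1, by positivity, ?_⟩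
  intro κ₀ hκ₀ hκ₀b ε hε hε1 Φ hsol hbound M hM0 hM hh κ hκ hκle n hn
  have h1 := key κ₀ hκ₀ hκ₀b ε hε hε1 Φ hsol (hbound _) M hM0 hM (hh.trans (min_le_left _ _)) κ hκ
    hκle n hn
  have hba : 0 < b - a := by linarith
  have hh0 : 0 ≤ (b - a) / M := by positivity
  have h2 : ((b - a) / M) ^ (max m (N + 1) - 1) ≤ ((b - a) / M) ^ (m - 1) :=
    pow_le_pow_of_le_one hh0 (hh.trans (min_le_right _ _)) (by omega)
  have h3 : κ₀ ^ (max m (N + 1) - 1) ≤ κ₀ ^ N :=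
    pow_le_pow_of_le_one hκ₀.le (hκ₀b.trans hκbar1.le) (by omega)
  have h4 : 0 ≤ ((b - a) / M) ^ (m - 1) := by positivity
  have h5 : 0 ≤ κ ^ 2 / ε ^ 2 := by positivity
  have h6 : 0 ≤ κ₀ ^ N := by positivity
  refine ⟨h1.trans (ENNReal.ofReal_le_ofReal ?_), fun hN =>
    h1.trans (ENNReal.ofReal_le_ofReal ?_)⟩
  · nlinarith
  · nlinarith
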